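/- Let $P$ be a simple polygon in the plane, regarded as a closed region with boundary $\partial P$ (straight angles at vertices are allowed), and let $m \ge 4$. Let $\partial P$, traversed counterclockwise, be divided at $m$ distinct vertices $v_1,\dots,v_m$ of $P$ into successive polygonal paths $B_1,\dots,B_m$, so that $B_k\cap B_{k+1}=\{v_k\}$ for $1\le k\le m-1$ and $B_m\cap B_1=\{v_m\}$. Suppose that each $B_k$ is outward convex, i.e. the interior angle of $P$ at every vertex of $B_k$ other than its two endpoints is at least $\pi$. Let $B_i, B_j$ be two of these paths with $B_i\cap B_j=\emptyset$ that are strongly mutually visible: there are points $p'\in B_i$ and $p''\in B_j$, not endpoints of these paths, such that the segment $\overline{p'p''}$ is contained in $P$ and meets $\partial P$ only at $p'$ and $p''$. Orient $B_i$ and $B_j$ counterclockwise along $\partial P$; let $\beta_1$ be the shortest path in $P$ between the initial points of $B_i$ and $B_j$, and $\beta_2$ the shortest path in $P$ between their terminal points. Put $U=B_i\cup B_j\cup\beta_1\cup\beta_2$. Then the region bounded by $U$ (the union of the bounded components of the complement of $U$) is one of the following. 1. The union of the interiors of two simple polygons $Q_1,Q_2$ with $\partial Q_1\cup\partial Q_2\subset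 U$, such that $\partial Q_1$ meets $B_i$ in a polygonal path of positive length and is disjoint from $B_j$, $\partial Q_2$ meets $B_j$ in a polygonal path of positive length and is disjoint from $B_i$, and $Q_1\cap Q_2$ (as closed regions) is a single point, which is either an interior point of $P$ or a vertex of $P$ not lying on $B_i\cup B_j$. 2. The interior of one simple polygon $Q$ with $\partial Q\subset U$, such that $\partial Q$ meets one of the two paths $B_i,B_j$ in a polygonal path of positive length and meets the other in exactly one point, which is a vertex of that other path. -/

import Mathlib

/-- The points off `S` that `S` separates from infinity: the union of the bounded connected
components of the complement of `S`. This is the open region bounded by `S`. -/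
def enclosedRegion (S : Set ℂ) : Set ℂ :=
  {x | x ∉ S ∧ Bornology.IsBounded (connectedComponentIn Sᶜ x)}

/-- A sequence of points in the Euclidean plane `ℂ`, joined in order by line segments. -/
structure PolyChain where
  numEdges : ℕ
  vertex : Fin (numEdges + 1) → ℂ

namespace PolyChain

def source (γ : PolyChain) : ℂ := γ.vertex 0

def target (γ : PolyChain) : ℂ := γ.vertex (Fin.last γ.numEdges)

def edge (γ : PolyChain) (t : Fin γ.numEdges) : Set ℂ :=
  segment ℝ (γ.vertex t.castSucc) (γ.vertex t.succ)

def carrier (γ : PolyChain) : Set ℂ := Set.range γ.vertex ∪ ⋃ t, γ.edge t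

noncomputable def length (γ : PolyChain) : ℝ :=
  ∑ t : Fin γ.numEdges, dist (γ.vertex t.castSucc) (γ.vertex t.succ)

/-- A polygonal path: distinct vertices, consecutive edges meet only in their common vertex, and
non-consecutive edges are disjoint. -/
structure IsSimple (γ : PolyChain) : Prop where
  injective : Function.Injective γ.vertex
  consecutive : ∀ s t : Fin γ.numEdges, (t : ℕ) = s + 1 →
    γ.edge s ∩ γ.edge t = {γ.vertex t.castSucc}
  disjoint : ∀ s t : Fin γ.numEdges, (s : ℕ) + 1 < t → Disjoint (γ.edge s) (γ.edge t)

/-- `γ` is a shortest path from `a` to `b` within `K`. -/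
structure IsShortest (γ : PolyChain) (K : Set ℂ) (a b : ℂ) : Prop where
  source_eq : γ.source = a
  target_eq : γ.target = b
  subset : γ.carrier ⊆ K
  minimal : ∀ δ : PolyChain, δ.source = a → δ.target = b → δ.carrier ⊆ K → γ.length ≤ δ.length

/-- The points of the path other than its two endpoints. -/
def interiorPoints (γ : PolyChain) : Set ℂ := γ.carrier \ {γ.source, γ.target}

end PolyChain

/-- The set `S` is traced by a polygonal path of positive length. -/
def IsPathOfPositiveLength (S : Set ℂ) : Prop :=
  ∃ γ : PolyChain, γ.IsSimple ∧ 0 < γ.length ∧ γ.carrier = S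

/-- A simple polygon in the plane, given by its cyclic sequence of vertices. Straight angles at
vertices are allowed. -/
structure SimplePolygon where
  n : ℕ
  three_le : 3 ≤ n
  vertex : ZMod n → ℂ
  injective : Function.Injective vertex
  consecutive : ∀ k, segment ℝ (vertex k) (vertex (k + 1)) ∩
    segment ℝ (vertex (k + 1)) (vertex (k + 2)) = {vertex (k + 1)}
  disjoint : ∀ k l, l ≠ k → l ≠ k + 1 → k ≠ l + 1 →
    Disjoint (segment ℝ (vertex k) (vertex (k + 1))) (segment ℝ (vertex l) (vertex (l + 1)))

namespace SimplePolygon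

def boundary (P : SimplePolygon) : Set ℂ := ⋃ k, segment ℝ (P.vertex k) (P.vertex (k + 1))

/-- The open region inside the polygon. -/
def inside (P : SimplePolygon) : Set ℂ := enclosedRegion P.boundary

/-- The closed region occupied by the polygon. -/
def region (P : SimplePolygon) : Set ℂ := P.boundary ∪ P.inside

/-- The vertices are listed counterclockwise: the inside lies immediately to the left of every
edge. -/
def IsCounterclockwise (P : SimplePolygon) : Prop :=
  ∀ k, ∀ t ∈ Set.Ioo (0 : ℝ) 1, ∀ᶠ ε : ℝ in nhdsWithin 0 (Set.Ioi 0),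
    AffineMap.lineMap (P.vertex k) (P.vertex (k + 1)) t
      + ε * (Complex.I * (P.vertex (k + 1) - P.vertex k)) ∈ P.inside

/-- For a polygon listed counterclockwise, the interior angle at a vertex: the angle, in
`[0, 2π)`, swept counterclockwise from the edge to the next vertex around to the edge to the
previous vertex. -/
noncomputable def interiorAngle (P : SimplePolygon) (k : ZMod P.n) : ℝ :=
  toIcoMod Real.two_pi_pos 0
    (Complex.arg ((P.vertex (k - 1) - P.vertex k) / (P.vertex (k + 1) - P.vertex k)))

def IsReflex (P : SimplePolygon) (k : ZMod P.n) : Prop := Real.pi ≤ P.interiorAngle k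

/-- Two paths in the boundary are strongly mutually visible: some interior points of the two are
joined by a segment within the polygon that meets the boundary only at its endpoints. -/
def StronglyMutuallyVisible (P : SimplePolygon) (B' B'' : PolyChain) : Prop :=
  ∃ p' ∈ B'.interiorPoints, ∃ p'' ∈ B''.interiorPoints,
    segment ℝ p' p'' ⊆ P.region ∧ segment ℝ p' p'' ∩ P.boundary = {p', p''}

/-- A division of the boundary, once around in the order of the vertices, into `m` successive
paths at `m` distinct vertices. -/
structure BoundaryPartition (P : SimplePolygon) (m : ℕ) where
  cut : Fin (m + 1) → ℕ
  strictMono : StrictMono cut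
  once_around : cut (Fin.last m) = cut 0 + P.n

namespace BoundaryPartition

variable {P : SimplePolygon} {m : ℕ}

/-- The `k`-th path, traversed in the order of the vertices of the polygon. -/
def path (B : P.BoundaryPartition m) (k : Fin m) : PolyChain where
  numEdges := B.cut k.succ - B.cut k.castSucc
  vertex t := P.vertex ((B.cut k.castSucc + t : ℕ) : ZMod P.n)

/-- Every interior vertex of the `k`-th path is reflex. -/
def OutwardConvex (B : P.BoundaryPartition m) (k : Fin m) : Prop :=
  ∀ t : ℕ, B.cut k.castSucc < t → t < B.cut k.succ → P.IsReflex (t : ZMod P.n)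

end BoundaryPartition

end SimplePolygon

section

open Set Metric MeasureTheory

/-! ### The region enclosed by a closed set -/

/-! Call an arc in P taut if no corner of it can be cut off by a triangle lying in P. Shortest paths
are taut, since cutting a corner shortens them (`PolyChain.IsShortest.taut`). Outward convex
boundary paths are taut, since at a vertex of angle greater than π such a triangle leaves P
(`taut_subpath`). The four arcs B_i, B_j, β₁, β₂ can thus be treated alike. As P has no holes, a
taut arc in P is determined by its ends (`PolyArc.eq_of_taut`): otherwise two taut arcs bound a
bigon, and at the point of the bigon farthest from a suitable centre a corner can be cut off inside
it (`not_taut_bigon`). Consequently a taut arc joining two points of another taut arc is part of it.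

Around ∂P the ends come in the order initial, terminal point of B_i, initial, terminal point of B_j.
Hence β₁ and β₂ must meet (`nonempty_inter_of_crossing`), and by uniqueness they meet in a common
subarc M. Suppose M is not a point. If β₁ and β₂ traverse M in opposite senses, switching between
them along M gives taut arcs through M joining the ends of B_i and the ends of B_j. By uniqueness M
then lies in both paths, which are disjoint. If they traverse M in the same sense, M lies on the
visibility segment, again by uniqueness. An end of M is not interior to P, because three taut prongs
cannot meet there, so M is the whole visibility segment; but this segment cannot continue both
halves of B_i tautly (`not_overlap`). So β₁ and β₂ cross in a single point x (`exists_crossedArcs`).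

If x lies on neither path, the parts of β₁ and β₂ between B_i and x, stripped of what runs along
B_i, bound a simple polygon together with a piece of B_i, and likewise for B_j: case 1. A taut arc
through an inner point of a side follows that side, so x is interior to P or a vertex. If x lies on
B_j, uniqueness forces B_j to consist of the parts of β₁ and β₂ beyond x, and nothing is enclosed on
that side: case 2.

The plane topology rests on one criterion: a compact set S fails to enclose x ∉ S exactly when z - x
has a continuous logarithm on S (`mem_enclosedRegion_iff`). Logarithms glue along connected
intersections, so arcs enclose nothing, and the region enclosed by a union can be read off from its
parts. -/

theorem mem_of_mem_closure_connectedComponentIn {A : Set ℂ} (hA : IsOpen A) {x y : ℂ}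
    (hy : y ∈ closure (connectedComponentIn A x)) (hyA : y ∈ A) :
    y ∈ connectedComponentIn A x := by
  have hopen : IsOpen (connectedComponentIn A y) := hA.connectedComponentIn
  obtain ⟨z, hz1, hz2⟩ := mem_closure_iff.1 hy _ hopen (mem_connectedComponentIn hyA)
  rw [connectedComponentIn_eq hz2, ← connectedComponentIn_eq hz1]
  exact mem_connectedComponentIn hyA

theorem connectedComponentIn_subset_enclosedRegion {S : Set ℂ} {x : ℂ}
    (hx : x ∈ enclosedRegion S) : connectedComponentIn Sᶜ x ⊆ enclosedRegion S := by
  intro y hy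
  refine ⟨connectedComponentIn_subset _ _ hy, ?_⟩
  rw [← connectedComponentIn_eq hy]
  exact hx.2

/-- A connected set that misses S stays in one component of the complement. This is the tool for
carrying enclosure from one point to another. -/
theorem IsPreconnected.mem_enclosedRegion {S C : Set ℂ} (hC : IsPreconnected C)
    (hd : Disjoint C S) {x y : ℂ} (hx : x ∈ C) (hy : y ∈ C) (hxS : x ∈ enclosedRegion S) :
    y ∈ enclosedRegion S :=
  connectedComponentIn_subset_enclosedRegion hxS
    (hC.subset_connectedComponentIn hx (fun _ hz hzS => hd.le_bot ⟨hz, hzS⟩) hy)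

theorem isOpen_enclosedRegion {S : Set ℂ} (hS : IsClosed S) : IsOpen (enclosedRegion S) := by
  rw [isOpen_iff_mem_nhds]
  intro x hx
  exact Filter.mem_of_superset
    (hS.isOpen_compl.connectedComponentIn.mem_nhds (mem_connectedComponentIn hx.1))
    (connectedComponentIn_subset_enclosedRegion hx)

theorem isOpen_unenclosed {S : Set ℂ} (hS : IsClosed S) :
    IsOpen (S ∪ enclosedRegion S)ᶜ := by
  rw [isOpen_iff_mem_nhds]
  intro x hx
  have hxS : x ∈ Sᶜ := fun h => hx (Or.inl h)
  refine Filter.mem_of_superset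
    (hS.isOpen_compl.connectedComponentIn.mem_nhds (mem_connectedComponentIn hxS)) ?_
  rintro y hy (h | h)
  · exact connectedComponentIn_subset _ _ hy h
  · refine hx (Or.inr ⟨hxS, ?_⟩)
    rw [connectedComponentIn_eq hy]
    exact h.2

/-- The exponential maps the half plane Re > log R onto the exterior of the disc. -/
theorem isPreconnected_setOf_lt_norm {R : ℝ} (hR : 0 < R) :
    IsPreconnected {z : ℂ | R < ‖z‖} := by
  have h : {z : ℂ | R < ‖z‖} = Complex.exp '' {z : ℂ | Real.log R < z.re} := by
    ext z
    constructor
    · intro hz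
      have h0 : z ≠ 0 := by
        rintro rfl
        simp only [mem_ofPred_eq, norm_zero] at hz
        linarith
      refine ⟨Complex.log z, ?_, Complex.exp_log h0⟩
      simp only [mem_ofPred_eq, Complex.log_re]
      exact Real.log_lt_log hR hz
    · rintro ⟨w, hw, rfl⟩
      simp only [mem_ofPred_eq, Complex.norm_exp] at hw ⊢
      exact (Real.log_lt_iff_lt_exp hR).1 hw
  rw [h]
  exact (convex_halfSpace_re_gt _).isPreconnected.image _ Complex.continuous_exp.continuousOn

/-- Points not enclosed by a bounded set form one connected piece. -/
theorem isPreconnected_unenclosed {S : Set ℂ} (hb : Bornology.IsBounded S) :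
    IsPreconnected (S ∪ enclosedRegion S)ᶜ := by
  obtain ⟨R, hR0, hR⟩ := hb.exists_pos_norm_le
  have hfar : {z : ℂ | R < ‖z‖} ⊆ Sᶜ := fun z hz hzS => absurd (hR z hzS) (not_le.2 hz)
  -- The component of an unenclosed point is unbounded, so it reaches beyond the disc of radius R
  -- containing S. The exterior of that disc is connected, so all these components coincide.
  have key : ∀ x ∈ (S ∪ enclosedRegion S)ᶜ, ∃ y ∈ connectedComponentIn Sᶜ x, R < ‖y‖ := by
    intro x hx
    by_contra! hcon
    refine hx (Or.inr ⟨fun h => hx (Or.inl h), ?_⟩)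
    exact isBounded_iff_forall_norm_le.2 ⟨R, hcon⟩
  refine isPreconnected_of_forall_pair fun x hx y hy => ?_
  obtain ⟨x', hx', hxR⟩ := key x hx
  obtain ⟨y', hy', hyR⟩ := key y hy
  have hfx : connectedComponentIn Sᶜ x = connectedComponentIn Sᶜ y := by
    rw [connectedComponentIn_eq hx', connectedComponentIn_eq hy']
    exact connectedComponentIn_eq
      ((isPreconnected_setOf_lt_norm hR0).subset_connectedComponentIn hxR hfar hyR)
  refine ⟨connectedComponentIn Sᶜ x, ?_, mem_connectedComponentIn fun h => hx (Or.inl h), ?_,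
    isPreconnected_connectedComponentIn⟩
  · rintro z hz (h | h)
    · exact connectedComponentIn_subset _ _ hz h
    · refine hx (Or.inr ⟨fun h => hx (Or.inl h), ?_⟩)
      rw [connectedComponentIn_eq hz]
      exact h.2
  · rw [hfx]
    exact mem_connectedComponentIn fun h => hy (Or.inl h)

theorem not_isBounded_unenclosed {S : Set ℂ} (hb : Bornology.IsBounded S) :
    ¬ Bornology.IsBounded (S ∪ enclosedRegion S)ᶜ := by
  intro h
  obtain ⟨R, hR0, hR⟩ := hb.exists_pos_norm_le
  obtain ⟨R', hR0', hR'⟩ := h.exists_pos_norm_le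
  have hpos : 0 < R + R' + 1 := by positivity
  have hn : ‖((R + R' + 1 : ℝ) : ℂ)‖ = R + R' + 1 := by
    rw [Complex.norm_real, Real.norm_of_nonneg hpos.le]
  have hmem : ((R + R' + 1 : ℝ) : ℂ) ∈ {z : ℂ | R < ‖z‖} := by
    simp only [mem_ofPred_eq, hn]; linarith
  have hfar : {z : ℂ | R < ‖z‖} ⊆ Sᶜ := fun z hz hzS => absurd (hR z hzS) (not_le.2 hz)
  have h1 : ((R + R' + 1 : ℝ) : ℂ) ∉ (S ∪ enclosedRegion S)ᶜ := by
    intro hm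
    have := hR' _ hm
    rw [hn] at this
    linarith
  rw [notMem_compl_iff] at h1
  rcases h1 with h1 | h1
  · exact hfar hmem h1
  -- An enclosed point beyond radius R would have the whole exterior of the disc in its bounded
  -- component.
  · obtain ⟨R₂, h2⟩ := (h1.2.subset ((isPreconnected_setOf_lt_norm hR0).subset_connectedComponentIn
      hmem hfar)).exists_norm_le
    have hn' : ‖((R + |R₂| + 1 : ℝ) : ℂ)‖ = R + |R₂| + 1 := by
      rw [Complex.norm_real, Real.norm_of_nonneg (by positivity)]
    have h3 := h2 ((R + |R₂| + 1 : ℝ) : ℂ) (by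
      simp only [mem_ofPred_eq, hn']; linarith [abs_nonneg R₂])
    rw [hn'] at h3
    linarith [le_abs_self R₂]

/-- A bounded nonempty open set has a frontier whose complement is disconnected. -/
theorem IsPreconnected.not_frontier_subset {C F : Set ℂ} (hF : IsPreconnected Fᶜ)
    (hFb : Bornology.IsBounded F) (ho : IsOpen C) (hne : C.Nonempty)
    (hb : Bornology.IsBounded C) (hd : Disjoint C F) (hfr : closure C ⊆ C ∪ F) : False := by
  -- C is open and closed relative to the connected set Fᶜ, so it contains Fᶜ and the plane would be
  -- the bounded set F ∪ C.
  have h := hF.subset_of_closure_inter_subset ho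
    (by obtain ⟨x, hx⟩ := hne; exact ⟨x, fun h => hd.le_bot ⟨hx, h⟩, hx⟩)
    (fun x hx => (hfr hx.1).resolve_right hx.2)
  have hbu : Bornology.IsBounded (univ : Set ℂ) :=
    (hFb.union hb).subset fun x _ => by
      by_cases hx : x ∈ F
      · exact Or.inl hx
      · exact Or.inr (h hx)
  exact NormedSpace.unbounded_univ ℝ ℂ hbu

/-- For a point enclosed by both sets, the components of the two complements coincide, because
neither set enters the region enclosed by the other. The frontier of this component lies in D ∩ E,
whose complement is connected, so it cannot bound anything. -/
theorem disjoint_enclosedRegion {D E : Set ℂ} (hD : IsClosed D) (hE : IsClosed E)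
    (hDb : Bornology.IsBounded D)
    (hDE : Disjoint D (enclosedRegion E)) (hED : Disjoint E (enclosedRegion D))
    (hc : IsPreconnected (D ∩ E)ᶜ) : Disjoint (enclosedRegion D) (enclosedRegion E) := by
  rw [Set.disjoint_left]
  intro x hxD hxE
  have h1 : connectedComponentIn Dᶜ x ⊆ connectedComponentIn Eᶜ x :=
    isPreconnected_connectedComponentIn.subset_connectedComponentIn
      (mem_connectedComponentIn hxD.1)
      fun y hy hyE => hED.le_bot ⟨hyE, connectedComponentIn_subset_enclosedRegion hxD hy⟩
  have h2 : connectedComponentIn Eᶜ x ⊆ connectedComponentIn Dᶜ x :=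
    isPreconnected_connectedComponentIn.subset_connectedComponentIn
      (mem_connectedComponentIn hxE.1)
      fun y hy hyD => hDE.le_bot ⟨hyD, connectedComponentIn_subset_enclosedRegion hxE hy⟩
  refine hc.not_frontier_subset (hDb.subset inter_subset_left) hD.isOpen_compl.connectedComponentIn
    ⟨x, mem_connectedComponentIn hxD.1⟩ hxD.2 ?_ ?_
  · rw [Set.disjoint_left]
    exact fun y hy hyF => connectedComponentIn_subset _ _ hy hyF.1
  · intro y hy
    by_contra hcon
    have hyC : y ∉ connectedComponentIn Dᶜ x := fun h => hcon (Or.inl h)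
    have hyD : y ∈ D := by
      by_contra h
      exact hyC (mem_of_mem_closure_connectedComponentIn hD.isOpen_compl hy h)
    have hyE : y ∈ E := by
      by_contra h
      exact hyC (h2 (mem_of_mem_closure_connectedComponentIn hE.isOpen_compl
        (closure_mono h1 hy) h))
    exact hcon (Or.inr ⟨hyD, hyE⟩)

/-! ### Continuous logarithms on plane sets -/

/-- `z ↦ z - x` has a continuous logarithm on `S`. -/
def HasLog (S : Set ℂ) (x : ℂ) : Prop :=
  ∃ f : ℂ → ℂ, ContinuousOn f S ∧ ∀ z ∈ S, Complex.exp (f z) = z - x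

theorem HasLog.mono {S T : Set ℂ} {x : ℂ} (h : HasLog T x) (hST : S ⊆ T) : HasLog S x := by
  obtain ⟨f, hf, hexp⟩ := h
  exact ⟨f, hf.mono hST, fun z hz => hexp z (hST hz)⟩

theorem HasLog.notMem {S : Set ℂ} {x : ℂ} (h : HasLog S x) : x ∉ S := by
  obtain ⟨f, -, hexp⟩ := h
  intro hx
  have := hexp x hx
  rw [sub_self] at this
  exact Complex.exp_ne_zero _ this

/-- Two logarithms differ by 2πi times an integer. If this integer varied, the continuous difference
would on a connected set also take the value n b + 1/2. -/
theorem IsPreconnected.eq_of_exp_eq {S : Set ℂ} (hS : IsPreconnected S) {f g : ℂ → ℂ}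
    (hf : ContinuousOn f S) (hg : ContinuousOn g S)
    (h : ∀ z ∈ S, Complex.exp (f z) = Complex.exp (g z)) {a b : ℂ} (ha : a ∈ S) (hb : b ∈ S) :
    f a - g a = f b - g b := by
  choose! n hn using fun z hz => Complex.exp_eq_exp_iff_exists_int.1 (h z hz)
  have hd : ∀ z ∈ S, (f z - g z).im = n z * (2 * Real.pi) := by
    intro z hz
    rw [hn z hz]
    simp
  have hcont : ContinuousOn (fun z => (f z - g z).im / (2 * Real.pi)) S := by fun_prop
  have hval : ∀ z ∈ S, (f z - g z).im / (2 * Real.pi) = n z := by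
    intro z hz
    rw [hd z hz]
    field_simp
  have main : ∀ a ∈ S, ∀ b ∈ S, n a ≤ n b := by
    intro a ha b hb
    by_contra! hlt
    have h1 : (n b : ℝ) + 1 ≤ n a := by exact_mod_cast hlt
    obtain ⟨z, hz, hz'⟩ := hS.intermediate_value hb ha hcont
      (show (n b : ℝ) + 1 / 2 ∈ Icc _ _ by
        rw [hval a ha, hval b hb]; constructor <;> linarith)
    simp only at hz'
    rw [hval z hz] at hz'
    have h2 : (2 * n z : ℝ) = 2 * n b + 1 := by linarith
    have h3 : 2 * n z = 2 * n b + 1 := by exact_mod_cast h2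
    omega
  have hnn : n a = n b := le_antisymm (main a ha b hb) (main b hb a ha)
  rw [hn a ha, hn b hb, hnn]
  ring

/-- On the connected intersection the two logarithms differ by a constant c with exp c = 1, and
shifting one of them by c makes them agree. An empty intersection is allowed. -/
theorem HasLog.union {S T : Set ℂ} {x : ℂ} (hS : HasLog S x) (hT : HasLog T x)
    (hSc : IsClosed S) (hTc : IsClosed T) (hc : IsPreconnected (S ∩ T)) : HasLog (S ∪ T) x := by
  classical
  obtain ⟨f, hf, hfe⟩ := hS
  obtain ⟨g, hg, hge⟩ := hT
  obtain ⟨c, hc1, hc2⟩ : ∃ c, Complex.exp c = 1 ∧ ∀ z ∈ S ∩ T, f z = g z + c := by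
    rcases (S ∩ T).eq_empty_or_nonempty with h | ⟨w, hw⟩
    · exact ⟨0, Complex.exp_zero, by simp [h]⟩
    · refine ⟨f w - g w, ?_, fun z hz => ?_⟩
      · rw [Complex.exp_sub, hfe w hw.1, hge w hw.2, div_self]
        rw [← hfe w hw.1]
        exact Complex.exp_ne_zero _
      · have := hc.eq_of_exp_eq (hf.mono inter_subset_left) (hg.mono inter_subset_right)
          (fun z hz => (hfe z hz.1).trans (hge z hz.2).symm) hz hw
        linear_combination this
  have hF1 : EqOn (fun z => if z ∈ S then f z else g z + c) f S := fun z hz => if_pos hz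
  have hF2 : EqOn (fun z => if z ∈ S then f z else g z + c) (fun z => g z + c) T := by
    intro z hz
    by_cases hzS : z ∈ S
    · simp only [if_pos hzS]
      exact hc2 z ⟨hzS, hz⟩
    · exact if_neg hzS
  refine ⟨fun z => if z ∈ S then f z else g z + c, ?_, ?_⟩
  · exact (hf.congr hF1).union_of_isClosed ((hg.add continuousOn_const).congr hF2) hSc hTc
  · rintro z (hz | hz)
    · rw [hF1 hz]; exact hfe z hz
    · rw [hF2 hz]
      simp only [Complex.exp_add, hc1, mul_one]
      exact hge z hz

/-- The principal branch applies to (z - x)/(u - x): a value on the closed negative real axis would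
put x between u and z. -/
theorem hasLog_segment {u w x : ℂ} (hx : x ∉ segment ℝ u w) : HasLog (segment ℝ u w) x := by
  have hux : u - x ≠ 0 := by
    intro h
    rw [sub_eq_zero] at h
    exact hx (h ▸ left_mem_segment ℝ u w)
  refine ⟨fun z => Complex.log ((z - x) / (u - x)) + Complex.log (u - x), ?_, ?_⟩
  · refine ContinuousOn.add (ContinuousOn.clog (by fun_prop) ?_) continuousOn_const
    intro z hz
    by_contra hs
    rw [Complex.mem_slitPlane_iff_not_le_zero, not_not] at hs
    rw [Complex.le_def] at hs
    obtain ⟨hre, him⟩ := hs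
    simp only [Complex.zero_re, Complex.zero_im] at hre him
    set r : ℝ := ((z - x) / (u - x)).re with hr
    have hz' : z - x = r * (u - x) := by
      have : (z - x) / (u - x) = r := Complex.ext (by simp [hr]) (by simp [him])
      rw [← this, div_mul_cancel₀ _ hux]
    refine hx ((convex_segment u w).segment_subset (left_mem_segment ℝ u w) hz ?_)
    have h1r : (0 : ℝ) < 1 - r := by linarith
    refine ⟨-r / (1 - r), 1 / (1 - r), by apply div_nonneg <;> linarith, by positivity, by
      field_simp; ring, ?_⟩
    have hc : (1 - r : ℂ) ≠ 0 := by
      have : ((1 - r : ℝ) : ℂ) ≠ 0 := Complex.ofReal_ne_zero.2 h1r.ne'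
      simpa using this
    simp only [Complex.real_smul]
    push_cast
    field_simp
    linear_combination hz'
  · intro z hz
    have hzx : z - x ≠ 0 := by
      intro h
      rw [sub_eq_zero] at h
      exact hx (h ▸ hz)
    rw [Complex.exp_add, Complex.exp_log (div_ne_zero hzx hux), Complex.exp_log hux,
      div_mul_cancel₀ _ hux]

/-- The quotient (z - y)/(z - x) = 1 + (x - y)/(z - x) stays in the unit disc about 1, where the
principal logarithm is continuous. -/
theorem HasLog.of_dist_lt {S : Set ℂ} {x y : ℂ} (h : HasLog S x)
    (hxy : ∀ z ∈ S, dist x y < dist z x) : HasLog S y := by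
  obtain ⟨f, hf, hfe⟩ := h
  have hne : ∀ z ∈ S, z - x ≠ 0 := fun z hz => by
    rw [← hfe z hz]; exact Complex.exp_ne_zero _
  have hslit : ∀ z ∈ S, 1 + (x - y) / (z - x) ∈ Complex.slitPlane := by
    intro z hz
    refine Complex.mem_slitPlane_of_norm_lt_one ?_
    rw [norm_div, div_lt_one (norm_pos_iff.2 (hne z hz)), ← dist_eq_norm, ← dist_eq_norm]
    exact hxy z hz
  refine ⟨fun z => f z + Complex.log (1 + (x - y) / (z - x)), ?_, ?_⟩
  · refine hf.add (ContinuousOn.clog ?_ hslit)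
    exact continuousOn_const.add (continuousOn_const.div (by fun_prop) hne)
  · intro z hz
    rw [Complex.exp_add, hfe z hz, Complex.exp_log (Complex.slitPlane_ne_zero (hslit z hz))]
    field_simp [hne z hz]
    ring

/-- Here z - x = -x (1 - z/x), and 1 - z/x stays in the unit disc about 1. -/
theorem hasLog_of_norm_lt {S : Set ℂ} {x : ℂ} (h : ∀ z ∈ S, ‖z‖ < ‖x‖) : HasLog S x := by
  rcases S.eq_empty_or_nonempty with rfl | ⟨w, hw⟩
  · exact ⟨fun _ => 0, continuousOn_empty _, by simp⟩
  have hx : x ≠ 0 := norm_pos_iff.1 ((norm_nonneg w).trans_lt (h w hw))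
  have hslit : ∀ z ∈ S, 1 + -(z / x) ∈ Complex.slitPlane := by
    intro z hz
    refine Complex.mem_slitPlane_of_norm_lt_one ?_
    rw [norm_neg, norm_div, div_lt_one (norm_pos_iff.2 hx)]
    exact h z hz
  refine ⟨fun z => Complex.log (1 + -(z / x)) + Complex.log (-x), ?_, ?_⟩
  · exact (ContinuousOn.clog (by fun_prop) hslit).add continuousOn_const
  · intro z hz
    rw [Complex.exp_add, Complex.exp_log (Complex.slitPlane_ne_zero (hslit z hz)),
      Complex.exp_log (neg_ne_zero.2 hx)]
    field_simp
    ring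

/-- A base point may be moved by less than its distance to S. So within C the points with a
logarithm form a relatively open and closed set. -/
theorem IsPreconnected.hasLog {S C : Set ℂ} (hC : IsPreconnected C) (hS : IsClosed S)
    (hd : Disjoint C S) {x y : ℂ} (hx : x ∈ C) (hy : y ∈ C) (hlog : HasLog S x) : HasLog S y := by
  rcases S.eq_empty_or_nonempty with rfl | hne
  · exact ⟨fun _ => 0, continuousOn_empty _, by simp⟩
  have hpos : ∀ z ∈ C, 0 < infDist z S := fun z hz =>
    (hS.notMem_iff_infDist_pos hne).1 fun h => hd.le_bot ⟨hz, h⟩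
  have hloc : ∀ z w, dist z w < infDist z S → HasLog S z → HasLog S w := by
    intro z w hzw hl
    refine hl.of_dist_lt fun v hv => hzw.trans_le ?_
    rw [dist_comm]
    exact infDist_le_dist_of_mem hv
  have hU : IsOpen {z | HasLog S z} := by
    rw [Metric.isOpen_iff]
    intro z hz
    refine ⟨infDist z S, (hS.notMem_iff_infDist_pos hne).1 hz.notMem, fun w hw => ?_⟩
    exact hloc z w (by rwa [dist_comm]) hz
  refine hC.subset_of_closure_inter_subset hU ⟨x, hx, hlog⟩ ?_ hy
  rintro z ⟨hz, hzC⟩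
  obtain ⟨w, hw, hzw⟩ := Metric.mem_closure_iff.1 hz (infDist z S / 2) (half_pos (hpos z hzC))
  refine hloc w z ?_ hw
  have := infDist_le_infDist_add_dist (s := S) (x := z) (y := w)
  rw [dist_comm]
  linarith

/-- A nowhere vanishing continuous function on the plane cannot agree with `z - x` far away. -/
theorem not_continuous_ne_zero_extension {g : ℂ → ℂ} (hg : Continuous g) (h0 : ∀ z, g z ≠ 0)
    {x : ℂ} {R : ℝ} (hR : 0 < R) (h : ∀ z, dist z x = R → g z = z - x) : False := by
  -- The plane is simply connected, so g lifts through the exponential covering. On the circle the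
  -- lift equals log R + i t up to a constant, which grows by 2πi in one turn, whereas F takes equal
  -- values at equal points.
  obtain ⟨F, ⟨-, hF⟩, -⟩ := Complex.isCoveringMapOn_exp.existsUnique_continuousMap_lifts
    (⟨g, hg⟩ : C(ℂ, ℂ)) (a₀ := 0) (Complex.exp_log (h0 0)) (fun a => h0 a)
  have hF' : ∀ z, Complex.exp (F z) = g z := fun z => congrFun hF z
  -- The angle is the real part of a complex parameter, because `IsPreconnected.eq_of_exp_eq`
  -- compares functions on ℂ.
  set c : ℂ → ℂ := fun t => x + R * Complex.exp (t.re * Complex.I) with hc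
  have hcc : Continuous c := by fun_prop
  have hdist : ∀ t, dist (c t) x = R := by
    intro t
    simp only [hc, dist_eq_norm, add_sub_cancel_left, norm_mul, Complex.norm_exp_ofReal_mul_I,
      Complex.norm_real, mul_one]
    exact abs_of_pos hR
  have hRe : Complex.exp (Real.log R) = R := by
    rw [← Complex.ofReal_exp, Real.exp_log hR]
  have key := isPreconnected_univ.eq_of_exp_eq (f := fun t => F (c t))
    (g := fun t => Real.log R + t.re * Complex.I)
    (F.continuous.comp hcc).continuousOn (by fun_prop) (fun t _ => by
      rw [hF', h _ (hdist t), Complex.exp_add, hRe]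
      simp [hc]) (mem_univ 0) (mem_univ ((2 * Real.pi : ℝ) : ℂ))
  have hper : c 0 = c ((2 * Real.pi : ℝ) : ℂ) := by
    simp only [hc, Complex.ofReal_re, Complex.zero_re]
    push_cast
    rw [Complex.exp_two_pi_mul_I]
    simp
  simp only [← hper, Complex.ofReal_re, Complex.zero_re] at key
  have h2 : ((2 * Real.pi : ℝ) : ℂ) * Complex.I = 0 := by
    have h3 : ((0 : ℝ) : ℂ) * Complex.I = 0 := by simp
    linear_combination key + h3
  have h3 := Complex.ofReal_ne_zero.2 Real.two_pi_pos.ne'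
  exact (mul_ne_zero h3 Complex.I_ne_zero) h2

/-- Extend the logarithm to the plane by Tietze. Its exponential on the bounded component of x,
together with z - x elsewhere, is continuous because both agree on S, which contains the frontier.
It never vanishes and equals z - x far away, which is impossible. -/
theorem HasLog.notMem_enclosedRegion {S : Set ℂ} (hS : IsCompact S) {x : ℂ} (h : HasLog S x) :
    x ∉ enclosedRegion S := by
  classical
  intro hx
  obtain ⟨f, hf, hfe⟩ := h
  obtain ⟨F, hF⟩ := ContinuousMap.exists_restrict_eq hS.isClosed
    (⟨fun z : S => f z, continuousOn_iff_continuous_domRestrict.1 hf⟩ : C(S, ℂ))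
  have hF' : ∀ z ∈ S, F z = f z := fun z hz => congrArg (fun k : C(S, ℂ) => k ⟨z, hz⟩) hF
  set C := connectedComponentIn Sᶜ x with hC
  have hxC : x ∈ C := mem_connectedComponentIn hx.1
  have hCo : IsOpen C := hS.isClosed.isOpen_compl.connectedComponentIn
  have hfr : frontier C ⊆ S := by
    intro z hz
    by_contra hzS
    rw [hCo.frontier_eq] at hz
    exact hz.2 (mem_of_mem_closure_connectedComponentIn hS.isClosed.isOpen_compl hz.1 hzS)
  have hcont : Continuous (C.piecewise (fun z => Complex.exp (F z)) (fun z => z - x)) :=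
    Continuous.piecewise
      (fun z hz => by rw [hF' z (hfr hz)]; exact hfe z (hfr hz))
      (Complex.continuous_exp.comp F.continuous) (by fun_prop)
  obtain ⟨R, hR0, hR⟩ := hx.2.exists_pos_norm_le
  refine not_continuous_ne_zero_extension hcont (x := x) (R := R + ‖x‖ + 1) ?_
    (by positivity) ?_
  · intro z
    by_cases hz : z ∈ C
    · rw [piecewise_eq_of_mem _ _ _ hz]
      exact Complex.exp_ne_zero _
    · rw [piecewise_eq_of_notMem _ _ _ hz, sub_ne_zero]
      rintro rfl
      exact hz hxC
  · intro z hz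
    refine piecewise_eq_of_notMem _ _ _ fun hzC => ?_
    have h1 := hR z hzC
    have h2 : dist z x ≤ ‖z‖ + ‖x‖ := by rw [dist_eq_norm]; exact norm_sub_le _ _
    linarith

/-- Far away a logarithm exists trivially, and it is carried along the unbounded component to x. -/
theorem hasLog_of_notMem_enclosedRegion {S : Set ℂ} (hS : IsCompact S) {x : ℂ} (hx : x ∉ S)
    (h : x ∉ enclosedRegion S) : HasLog S x := by
  obtain ⟨R, hR0, hR⟩ := hS.isBounded.exists_pos_norm_le
  obtain ⟨y, hy, hyR⟩ : ∃ y ∈ connectedComponentIn Sᶜ x, R < ‖y‖ := by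
    by_contra! hcon
    exact h ⟨hx, isBounded_iff_forall_norm_le.2 ⟨R, hcon⟩⟩
  refine isPreconnected_connectedComponentIn.hasLog hS.isClosed ?_ hy
    (mem_connectedComponentIn hx) (hasLog_of_norm_lt fun z hz => (hR z hz).trans_lt hyR)
  rw [Set.disjoint_left]
  exact fun z hz => connectedComponentIn_subset _ _ hz

/-- A compact set encloses exactly those points about which it has no continuous logarithm. -/
theorem mem_enclosedRegion_iff {S : Set ℂ} (hS : IsCompact S) {x : ℂ} (hx : x ∉ S) :
    x ∈ enclosedRegion S ↔ ¬ HasLog S x :=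
  ⟨fun h hl => hl.notMem_enclosedRegion hS h,
    fun h => by
      by_contra hc
      exact h (hasLog_of_notMem_enclosedRegion hS hx hc)⟩

/-! ### Segments -/

theorem isCompact_segment' (a b : ℂ) : IsCompact (segment ℝ a b) := by
  rw [segment_eq_image_lineMap]
  exact isCompact_Icc.image AffineMap.lineMap_continuous

theorem segment_subset_left {a b x : ℂ} (h : x ∈ segment ℝ a b) :
    segment ℝ a x ⊆ segment ℝ a b :=
  (convex_segment a b).segment_subset (left_mem_segment ℝ a b) h

theorem segment_subset_right {a b x : ℂ} (h : x ∈ segment ℝ a b) :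
    segment ℝ x b ⊆ segment ℝ a b :=
  (convex_segment a b).segment_subset h (right_mem_segment ℝ a b)

theorem segment_union_segment {a b x : ℂ} (h : x ∈ segment ℝ a b) :
    segment ℝ a x ∪ segment ℝ x b = segment ℝ a b := by
  refine Subset.antisymm (union_subset (segment_subset_left h) (segment_subset_right h)) ?_
  intro y hy
  rw [segment_eq_image_lineMap] at h hy
  obtain ⟨t, ht, rfl⟩ := h
  obtain ⟨s, hs, rfl⟩ := hy
  rcases le_total s t with hst | hst
  · left
    rw [mem_segment_iff_wbtw]
    simpa using (Wbtw.of_le_of_le hs.1 hst).map (AffineMap.lineMap a b : ℝ →ᵃ[ℝ] ℂ)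
  · right
    rw [mem_segment_iff_wbtw]
    simpa using (Wbtw.of_le_of_le hst hs.2).map (AffineMap.lineMap a b : ℝ →ᵃ[ℝ] ℂ)

theorem segment_inter_segment {a b x : ℂ} (h : x ∈ segment ℝ a b) :
    segment ℝ a x ∩ segment ℝ x b = {x} := by
  refine Subset.antisymm ?_ ?_
  · rintro y ⟨h1, h2⟩
    rw [mem_segment_iff_wbtw] at h h1 h2
    exact ((wbtw_swap_left_iff ℝ b).1 ⟨h.trans_left_right h1, h2⟩)
  · rintro y rfl
    exact ⟨right_mem_segment ℝ a y, left_mem_segment ℝ y b⟩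

/-- The point of a closed set which is met first along a segment. -/
theorem exists_segment_inter_eq_singleton {a c : ℂ} {T : Set ℂ} (hT : IsClosed T) (hc : c ∈ T) :
    ∃ z ∈ segment ℝ a c, segment ℝ a z ∩ T = {z} := by
  obtain ⟨z, hz, hmin⟩ := ((isCompact_segment' a c).inter_right hT).exists_isMinOn
    ⟨c, right_mem_segment ℝ a c, hc⟩ (f := fun z => dist a z) (by fun_prop)
  refine ⟨z, hz.1, Subset.antisymm ?_ (by
    rintro _ rfl; exact ⟨right_mem_segment ℝ _ _, hz.2⟩)⟩
  rintro y ⟨hy1, hy2⟩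
  have h1 := dist_add_dist_of_mem_segment hy1
  have h2 : dist a z ≤ dist a y := hmin ⟨segment_subset_left hz.1 hy1, hy2⟩
  exact dist_le_zero.1 (by linarith)

/-! ### Polygonal arcs -/

/-- `PolyArc S a b`: the set `S` is traced by a (possibly constant) polygonal path without
self-intersections from `a` to `b`. -/
inductive PolyArc : Set ℂ → ℂ → ℂ → Prop
  | single (a : ℂ) : PolyArc {a} a a
  | cons {S : Set ℂ} {a c b : ℂ} (hne : a ≠ c) (h : PolyArc S c b)
      (hS : segment ℝ a c ∩ S = {c}) : PolyArc (segment ℝ a c ∪ S) a b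

namespace PolyArc

variable {S T M N : Set ℂ} {a b c u w x y : ℂ}

theorem left_mem (h : PolyArc S a b) : a ∈ S := by
  cases h with
  | single => rfl
  | cons => exact Or.inl (left_mem_segment ℝ _ _)

theorem right_mem (h : PolyArc S a b) : b ∈ S := by
  induction h with
  | single => rfl
  | cons _ _ _ ih => exact Or.inr ih

theorem isCompact (h : PolyArc S a b) : IsCompact S := by
  induction h with
  | single => exact isCompact_singleton
  | cons _ _ _ ih => exact (isCompact_segment' _ _).union ih

theorem isClosed (h : PolyArc S a b) : IsClosed S := h.isCompact.isClosed

theorem isPreconnected (h : PolyArc S a b) : IsPreconnected S := by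
  induction h with
  | single => exact isPreconnected_singleton
  | cons _ h' _ ih =>
    exact IsPreconnected.union _ (right_mem_segment ℝ _ _) h'.left_mem
      (convex_segment _ _).isPreconnected ih

theorem eq_singleton (h : PolyArc S a a) : S = {a} := by
  cases h with
  | single => rfl
  | @cons S _ c _ hne h' hS =>
    have : a ∈ ({c} : Set ℂ) := by rw [← hS]; exact ⟨left_mem_segment ℝ _ _, h'.right_mem⟩
    exact absurd this hne

theorem segment (a b : ℂ) : PolyArc (segment ℝ a b) a b := by
  by_cases h : a = b
  · subst h
    rw [segment_same]
    exact single a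
  · have h1 := cons h (single b) (by
      rw [inter_eq_right, singleton_subset_iff]; exact right_mem_segment ℝ _ _)
    rwa [union_eq_left.2 (singleton_subset_iff.2 (right_mem_segment ℝ a b))] at h1

theorem trans (hS : PolyArc S a b) (hT : PolyArc T b c) (hST : S ∩ T = {b}) :
    PolyArc (S ∪ T) a c := by
  induction hS with
  | single a =>
    rwa [union_eq_right.2 (singleton_subset_iff.2 hT.left_mem)]
  | @cons S a d b hne h hS ih =>
    have h1 : S ∩ T = {b} := by
      refine Subset.antisymm (fun x hx => ?_) (singleton_subset_iff.2 ⟨h.right_mem, hT.left_mem⟩)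
      rw [← hST]
      exact ⟨Or.inr hx.1, hx.2⟩
    rw [union_assoc]
    refine cons hne (ih hT h1) (Subset.antisymm ?_ ?_)
    · rintro x ⟨hx1, hx2 | hx2⟩
      · rw [← hS]; exact ⟨hx1, hx2⟩
      · have hxb : x = b := by
          have : x ∈ ({b} : Set ℂ) := by rw [← hST]; exact ⟨Or.inl hx1, hx2⟩
          exact this
        rw [← hS]
        exact ⟨hx1, hxb ▸ h.right_mem⟩
    · rintro _ rfl
      exact ⟨right_mem_segment ℝ _ _, Or.inl h.left_mem⟩

theorem symm (h : PolyArc S a b) : PolyArc S b a := by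
  induction h with
  | single a => exact single a
  | @cons S a c b hne h hS ih =>
    have := ih.trans (segment c a) (by rw [segment_symm, inter_comm]; exact hS)
    rwa [union_comm, segment_symm] at this

/-- `PolySplit S₁ S₂ S a x b`: the point `x` divides the arc `S` from `a` to `b` into the arcs
`S₁` and `S₂`. -/
structure _root_.PolySplit (S₁ S₂ S : Set ℂ) (a x b : ℂ) : Prop where
  left : PolyArc S₁ a x
  right : PolyArc S₂ x b
  union : S₁ ∪ S₂ = S
  inter : S₁ ∩ S₂ = {x}

theorem _root_.PolySplit.symm {S₁ S₂ S : Set ℂ} {a x b : ℂ} (h : PolySplit S₁ S₂ S a x b) :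
    PolySplit S₂ S₁ S b x a :=
  ⟨h.right.symm, h.left.symm, by rw [union_comm, h.union], by rw [inter_comm, h.inter]⟩

theorem _root_.PolySplit.subset_left {S₁ S₂ S : Set ℂ} {a x b : ℂ}
    (h : PolySplit S₁ S₂ S a x b) : S₁ ⊆ S := h.union ▸ subset_union_left

theorem _root_.PolySplit.subset_right {S₁ S₂ S : Set ℂ} {a x b : ℂ}
    (h : PolySplit S₁ S₂ S a x b) : S₂ ⊆ S := h.union ▸ subset_union_right

theorem _root_.PolySplit.eq_of_mem {S₁ S₂ S : Set ℂ} {a x b y : ℂ}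
    (h : PolySplit S₁ S₂ S a x b) (h1 : y ∈ S₁) (h2 : y ∈ S₂) : y = x := by
  have : y ∈ ({x} : Set ℂ) := h.inter ▸ ⟨h1, h2⟩
  exact this

theorem exists_split (h : PolyArc S a b) (hx : x ∈ S) : ∃ S₁ S₂, PolySplit S₁ S₂ S a x b := by
  induction h with
  | single a =>
    obtain rfl : x = a := hx
    exact ⟨{x}, {x}, single x, single x, union_self _, inter_self _⟩
  | @cons S a c b hne h hS ih =>
    by_cases hxS : x ∈ S
    · obtain ⟨S₁, S₂, hs⟩ := ih hxS
      refine ⟨_, S₂, cons hne hs.left ?_, hs.right, ?_, ?_⟩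
      · refine Subset.antisymm (fun y hy => ?_) ?_
        · rw [← hS]; exact ⟨hy.1, hs.subset_left hy.2⟩
        · rintro _ rfl
          exact ⟨right_mem_segment ℝ _ _, hs.left.left_mem⟩
      · rw [union_assoc, hs.union]
      · refine Subset.antisymm ?_ ?_
        · rintro y ⟨hy | hy, hy2⟩
          · have hyc : y = c := by
              have : y ∈ ({c} : Set ℂ) := by rw [← hS]; exact ⟨hy, hs.subset_right hy2⟩
              exact this
            exact hs.eq_of_mem (hyc ▸ hs.left.left_mem) hy2
          · exact hs.eq_of_mem hy hy2
        · rintro _ rfl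
          exact ⟨Or.inr hs.left.right_mem, hs.right.left_mem⟩
    · have hxs : x ∈ _root_.segment ℝ a c := hx.resolve_right hxS
      have hxc : x ≠ c := by
        rintro rfl
        exact hxS h.left_mem
      have hdis : _root_.segment ℝ a x ∩ S ⊆ ∅ := by
        rintro y ⟨hy1, hy2⟩
        have hyc : y = c := by
          have : y ∈ ({c} : Set ℂ) := by rw [← hS]; exact ⟨segment_subset_left hxs hy1, hy2⟩
          exact this
        subst hyc
        have : y ∈ ({x} : Set ℂ) := by
          rw [← segment_inter_segment hxs]
          exact ⟨hy1, right_mem_segment ℝ _ _⟩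
        exact hxc this.symm
      refine ⟨_, _, segment a x, cons hxc h ?_, ?_, ?_⟩
      · refine Subset.antisymm (fun y hy => ?_) ?_
        · rw [← hS]; exact ⟨segment_subset_right hxs hy.1, hy.2⟩
        · rintro _ rfl
          exact ⟨right_mem_segment ℝ _ _, h.left_mem⟩
      · rw [← union_assoc, segment_union_segment hxs]
      · rw [inter_union_distrib_left, segment_inter_segment hxs, subset_empty_iff.1 hdis,
          union_empty]

/-- An arc is irreducible between its endpoints. -/
theorem eq_of_isPreconnected (h : PolyArc S a b) (hM : IsPreconnected M) (hMS : M ⊆ S)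
    (ha : a ∈ M) (hb : b ∈ M) : M = S := by
  refine Subset.antisymm hMS fun y hy => ?_
  obtain ⟨S₁, S₂, hs⟩ := h.exists_split hy
  -- M meets both closed halves of the arc at y, hence also their intersection {y}.
  obtain ⟨z, hz, hz'⟩ := isPreconnected_closed_iff.1 hM S₁ S₂ hs.left.isClosed hs.right.isClosed
    (hs.union ▸ hMS) ⟨a, ha, hs.left.left_mem⟩ ⟨b, hb, hs.right.right_mem⟩
  rw [hs.inter] at hz'
  exact hz' ▸ hz

/-- Each y in S₁ separates a from x within S, so the connected set M passes through it and S₁ ⊆ M.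
The arc M is irreducible between its ends, so equality holds. -/
theorem _root_.PolySplit.eq_left {S₁ S₂ : Set ℂ} (hs : PolySplit S₁ S₂ S a x b)
    (hM : PolyArc M a x) (hMS : M ⊆ S) : M = S₁ := by
  refine (hM.eq_of_isPreconnected hs.left.isPreconnected (fun y hy => ?_) hs.left.left_mem
    hs.left.right_mem).symm
  obtain ⟨U, V, ht⟩ := hs.left.exists_split hy
  obtain ⟨z, hz, hz1, hz2⟩ := isPreconnected_closed_iff.1 hM.isPreconnected U (V ∪ S₂)
    ht.left.isClosed (ht.right.isClosed.union hs.right.isClosed)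
    (by rw [← union_assoc, ht.union, hs.union]; exact hMS)
    ⟨a, hM.left_mem, ht.left.left_mem⟩ ⟨x, hM.right_mem, Or.inl ht.right.right_mem⟩
  have : z = y := by
    rcases hz2 with hz2 | hz2
    · exact ht.eq_of_mem hz1 hz2
    · obtain rfl := hs.eq_of_mem (ht.subset_left hz1) hz2
      exact ht.eq_of_mem hz1 ht.right.right_mem
  exact this ▸ hz

theorem _root_.PolySplit.eq_right {S₁ S₂ : Set ℂ} (hs : PolySplit S₁ S₂ S a x b)
    (hM : PolyArc M x b) (hMS : M ⊆ S) : M = S₂ :=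
  hs.symm.eq_left hM.symm hMS

/-- The sub-arc of an arc between two of its points. -/
theorem exists_subarc (h : PolyArc S a b) (hu : u ∈ S) (hw : w ∈ S) :
    ∃ N ⊆ S, PolyArc N u w ∧ ∀ M ⊆ S, PolyArc M u w → M = N := by
  -- This treats the case in which w comes after u; reversing the arc gives the other. The middle
  -- piece is unique because each of its points separates u from w within S.
  have key : ∀ {a b u w : ℂ} {S S₁ S₂ : Set ℂ}, PolySplit S₁ S₂ S a u b → w ∈ S₂ →
      ∃ N ⊆ S, PolyArc N u w ∧ ∀ M ⊆ S, PolyArc M u w → M = N := by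
    intro a b u w S S₁ S₂ hs hw
    obtain ⟨N, S₃, ht⟩ := hs.right.exists_split hw
    refine ⟨N, ht.subset_left.trans hs.subset_right, ht.left, fun M hMS hM => ?_⟩
    have hsplit : PolySplit (S₁ ∪ N) S₃ S a w b := by
      refine ⟨hs.left.trans ht.left ?_, ht.right, ?_, ?_⟩
      · refine Subset.antisymm (fun y hy => hs.eq_of_mem hy.1 (ht.subset_left hy.2)) ?_
        rintro _ rfl
        exact ⟨hs.left.right_mem, ht.left.left_mem⟩
      · rw [union_assoc, ht.union, hs.union]
      · refine Subset.antisymm ?_ ?_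
        · rintro y ⟨hy | hy, hy2⟩
          · obtain rfl := hs.eq_of_mem hy (ht.subset_right hy2)
            exact ht.eq_of_mem ht.left.left_mem hy2
          · exact ht.eq_of_mem hy hy2
        · rintro _ rfl
          exact ⟨Or.inr ht.left.right_mem, ht.right.left_mem⟩
    refine (hM.eq_of_isPreconnected ht.left.isPreconnected (fun y hy => ?_) ht.left.left_mem
      ht.left.right_mem).symm
    obtain ⟨U, V, hr⟩ := ht.left.exists_split hy
    obtain ⟨z, hz, hz1, hz2⟩ := isPreconnected_closed_iff.1 hM.isPreconnected (S₁ ∪ U) (V ∪ S₃)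
      (hs.left.isClosed.union hr.left.isClosed) (hr.right.isClosed.union ht.right.isClosed)
      (by
        have : S₁ ∪ U ∪ (V ∪ S₃) = S := by
          rw [← hs.union, ← ht.union, ← hr.union]
          simp only [union_assoc]
        rw [this]; exact hMS)
      ⟨u, hM.left_mem, Or.inr hr.left.left_mem⟩ ⟨w, hM.right_mem, Or.inl hr.right.right_mem⟩
    have : z = y := by
      rcases hz1 with hz1 | hz1 <;> rcases hz2 with hz2 | hz2
      · obtain rfl := hs.eq_of_mem hz1 (ht.subset_left (hr.subset_right hz2))
        exact hr.eq_of_mem hr.left.left_mem hz2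
      · obtain rfl := hs.eq_of_mem hz1 (ht.subset_right hz2)
        obtain rfl := ht.eq_of_mem ht.left.left_mem hz2
        have h1 := ht.left.eq_singleton
        rw [h1] at hy
        exact hy.symm
      · exact hr.eq_of_mem hz1 hz2
      · obtain rfl := ht.eq_of_mem (hr.subset_left hz1) hz2
        exact hr.eq_of_mem hz1 hr.right.right_mem
    exact this ▸ hz
  obtain ⟨S₁, S₂, hs⟩ := h.exists_split hu
  rcases (hs.union ▸ hw : w ∈ S₁ ∪ S₂) with hw | hw
  · exact key hs.symm hw
  · exact key hs hw

theorem subarc_unique (h : PolyArc S a b) (hM : PolyArc M u w) (hMS : M ⊆ S)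
    (hN : PolyArc N u w) (hNS : N ⊆ S) : M = N := by
  obtain ⟨K, -, -, hK⟩ := h.exists_subarc (hMS hM.left_mem) (hMS hM.right_mem)
  rw [hK M hMS hM, hK N hNS hN]

/-- Sub-arc up to the first point in a closed set. -/
theorem exists_first (h : PolyArc S a b) (hT : IsClosed T) (hb : b ∈ T) :
    ∃ x S₁ S₂, PolySplit S₁ S₂ S a x b ∧ S₁ ∩ T = {x} := by
  have key : ∃ x, ∃ S₁ ⊆ S, PolyArc S₁ a x ∧ S₁ ∩ T = {x} := by
    induction h with
    | single a => exact ⟨a, {a}, subset_rfl, single a, inter_eq_left.2 (singleton_subset_iff.2 hb)⟩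
    | @cons S a c b hne h hS ih =>
      by_cases hex : ∃ d ∈ _root_.segment ℝ a c, d ∈ T
      · obtain ⟨d, hd, hdT⟩ := hex
        obtain ⟨z, hz, hzT⟩ := exists_segment_inter_eq_singleton (a := a) hT hdT
        exact ⟨z, _, ((segment_subset_left hz).trans (segment_subset_left hd)).trans
          subset_union_left, segment a z, hzT⟩
      · push Not at hex
        obtain ⟨x, S₁, hS₁, harc, hx⟩ := ih hb
        refine ⟨x, _, union_subset_union_right _ hS₁, cons hne harc ?_, ?_⟩
        · refine Subset.antisymm (fun y hy => ?_) ?_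
          · rw [← hS]; exact ⟨hy.1, hS₁ hy.2⟩
          · rintro _ rfl
            exact ⟨right_mem_segment ℝ _ _, harc.left_mem⟩
        · rw [union_inter_distrib_right, hx]
          refine union_eq_right.2 ?_
          rintro y ⟨hy1, hy2⟩
          exact absurd hy2 (hex y hy1)
  obtain ⟨x, S₁, hS₁, harc, hx⟩ := key
  obtain ⟨U, V, hs⟩ := h.exists_split (hS₁ harc.right_mem)
  rw [hs.eq_left harc hS₁] at hx
  exact ⟨x, U, V, hs, hx⟩

/-- Near its initial point an arc is a segment. -/
theorem exists_germ (h : PolyArc S a b) (hab : a ≠ b) :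
    ∃ c, c ≠ a ∧ _root_.segment ℝ a c ⊆ S ∧ ∃ r > 0, ball a r ∩ S ⊆ _root_.segment ℝ a c := by
  cases h with
  | single => exact absurd rfl hab
  | @cons S _ c _ hne h hS =>
    have haS : a ∉ S := by
      intro ha
      have : a ∈ ({c} : Set ℂ) := by rw [← hS]; exact ⟨left_mem_segment ℝ _ _, ha⟩
      exact hne this
    obtain ⟨r, hr, hball⟩ := Metric.isOpen_iff.1 h.isClosed.isOpen_compl a haS
    refine ⟨c, hne.symm, subset_union_left, r, hr, ?_⟩
    rintro y ⟨hy, hy' | hy'⟩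
    · exact hy'
    · exact absurd hy' (hball hy)

theorem isPreconnected_diff_right (h : PolyArc S a b) : IsPreconnected (S \ {b}) := by
  refine isPreconnected_of_forall a fun y hy => ?_
  obtain ⟨S₁, S₂, hs⟩ := h.exists_split hy.1
  refine ⟨S₁, fun z hz => ⟨hs.subset_left hz, ?_⟩, hs.left.left_mem, hs.left.right_mem,
    hs.left.isPreconnected⟩
  rintro rfl
  exact hy.2 (hs.eq_of_mem hz hs.right.right_mem).symm

theorem hasLog (h : PolyArc S a b) (hx : x ∉ S) : HasLog S x := by
  induction h with
  | single a =>
    have := hasLog_segment (u := a) (w := a) (x := x) (by rwa [segment_same])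
    rwa [segment_same] at this
  | cons hne h hS ih =>
    refine (hasLog_segment fun h => hx (Or.inl h)).union (ih fun h => hx (Or.inr h))
      (isCompact_segment' _ _).isClosed h.isClosed ?_
    rw [hS]
    exact isPreconnected_singleton

theorem enclosedRegion_eq_empty (h : PolyArc S a b) : enclosedRegion S = ∅ :=
  eq_empty_of_forall_notMem fun _ hx => (h.hasLog hx.1).notMem_enclosedRegion h.isCompact hx

theorem isPreconnected_compl (h : PolyArc S a b) : IsPreconnected Sᶜ := by
  have := isPreconnected_unenclosed h.isCompact.isBounded
  rwa [h.enclosedRegion_eq_empty, union_empty] at this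

end PolyArc

/-! ### Length of arcs -/

/-- The one-dimensional Hausdorff measure of a set, as a real number. -/
noncomputable def arcLength (S : Set ℂ) : ℝ := (Measure.hausdorffMeasure 1 S).toReal

theorem arcLength_segment (a b : ℂ) : arcLength (segment ℝ a b) = dist a b := by
  rw [arcLength, hausdorffMeasure_segment, edist_dist, ENNReal.toReal_ofReal dist_nonneg]

theorem hausdorffMeasure_singleton' (x : ℂ) : Measure.hausdorffMeasure 1 ({x} : Set ℂ) = 0 := by
  have := hausdorffMeasure_segment x x
  rwa [segment_same, edist_self] at this

theorem PolyArc.hausdorffMeasure_ne_top {S : Set ℂ} {a b : ℂ} (h : PolyArc S a b) :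
    Measure.hausdorffMeasure 1 S ≠ ⊤ := by
  induction h with
  | single a => rw [hausdorffMeasure_singleton']; exact ENNReal.zero_ne_top
  | cons _ _ _ ih =>
    refine measure_union_ne_top ?_ ih
    rw [hausdorffMeasure_segment]
    exact edist_ne_top _ _

/-- Measuring the carrier makes length independent of the vertices chosen, and a common point has
measure zero. -/
theorem arcLength_union {S T : Set ℂ} {a b c d x : ℂ} (hS : PolyArc S a b) (hT : PolyArc T c d)
    (h : S ∩ T = {x}) : arcLength (S ∪ T) = arcLength S + arcLength T := by
  rw [arcLength, measure_union₀ hT.isClosed.measurableSet.nullMeasurableSet,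
    ENNReal.toReal_add hS.hausdorffMeasure_ne_top hT.hausdorffMeasure_ne_top]
  · rfl
  · rw [AEDisjoint, h, hausdorffMeasure_singleton']

theorem arcLength_mono {S T : Set ℂ} {a b : ℂ} (hT : PolyArc T a b) (h : S ⊆ T) :
    arcLength S ≤ arcLength T :=
  ENNReal.toReal_mono hT.hausdorffMeasure_ne_top (measure_mono h)

theorem arcLength_singleton (x : ℂ) : arcLength {x} = 0 := by
  rw [arcLength, hausdorffMeasure_singleton', ENNReal.toReal_zero]

/-! ### Polygonal chains and arcs -/

namespace PolyChain

/-- Prepend a vertex to a chain. -/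
def cons (a : ℂ) (γ : PolyChain) : PolyChain := ⟨γ.numEdges + 1, Fin.cons a γ.vertex⟩

theorem cons_induction {motive : PolyChain → Prop} (single : ∀ a, motive ⟨0, fun _ => a⟩)
    (cons : ∀ a γ, motive γ → motive (γ.cons a)) (γ : PolyChain) : motive γ := by
  obtain ⟨n, v⟩ := γ
  induction n with
  | zero =>
    have : v = fun _ => v 0 := funext fun t => congrArg v (Subsingleton.elim (α := Fin 1) _ _)
    rw [this]
    exact single _
  | succ n ih =>
    have := cons (v 0) ⟨n, Fin.tail v⟩ (ih _)
    simp only [PolyChain.cons, Fin.cons_self_tail] at this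
    exact this

theorem source_cons (a : ℂ) (γ : PolyChain) : (γ.cons a).source = a := rfl

theorem target_cons (a : ℂ) (γ : PolyChain) : (γ.cons a).target = γ.target := rfl

theorem edge_cons_zero (a : ℂ) (γ : PolyChain) :
    (γ.cons a).edge (0 : Fin (γ.numEdges + 1)) = segment ℝ a γ.source := rfl

theorem edge_cons_succ (a : ℂ) (γ : PolyChain) (t : Fin γ.numEdges) :
    (γ.cons a).edge t.succ = γ.edge t := rfl

theorem edge_subset_carrier (γ : PolyChain) (t : Fin γ.numEdges) : γ.edge t ⊆ γ.carrier :=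
  (subset_iUnion _ t).trans subset_union_right

theorem vertex_mem_carrier (γ : PolyChain) (t : Fin (γ.numEdges + 1)) :
    γ.vertex t ∈ γ.carrier := Or.inl ⟨t, rfl⟩

theorem carrier_cons (a : ℂ) (γ : PolyChain) :
    (γ.cons a).carrier = segment ℝ a γ.source ∪ γ.carrier := by
  ext x
  constructor
  · rintro (⟨t, rfl⟩ | hx)
    · refine Fin.cases ?_ (fun t => ?_) t
      · exact Or.inl (left_mem_segment ℝ _ _)
      · exact Or.inr (γ.vertex_mem_carrier t)
    · obtain ⟨t, ht⟩ := mem_iUnion.1 hx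
      revert ht
      refine Fin.cases (fun h => Or.inl h) (fun t h => Or.inr (γ.edge_subset_carrier t h)) t
  · rintro (hx | ⟨t, rfl⟩ | hx)
    · exact (γ.cons a).edge_subset_carrier (0 : Fin (γ.numEdges + 1)) hx
    · exact Or.inl ⟨t.succ, rfl⟩
    · obtain ⟨t, ht⟩ := mem_iUnion.1 hx
      exact (γ.cons a).edge_subset_carrier t.succ ht

theorem length_cons (a : ℂ) (γ : PolyChain) :
    (γ.cons a).length = dist a γ.source + γ.length :=
  Fin.sum_univ_succ _

theorem carrier_single (a : ℂ) : (⟨0, fun _ => a⟩ : PolyChain).carrier = {a} := by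
  simp [carrier]

theorem length_single (a : ℂ) : (⟨0, fun _ => a⟩ : PolyChain).length = 0 := rfl

theorem exists_append (γ δ : PolyChain) (h : γ.target = δ.source) :
    ∃ ε : PolyChain, ε.source = γ.source ∧ ε.target = δ.target ∧
      ε.carrier = γ.carrier ∪ δ.carrier ∧ ε.length = γ.length + δ.length := by
  induction γ using cons_induction with
  | single a =>
    refine ⟨δ, h.symm, rfl, ?_, ?_⟩
    · rw [carrier_single, eq_comm, union_eq_right, singleton_subset_iff]
      have : a = δ.source := h
      rw [this]
      exact δ.vertex_mem_carrier 0
    · rw [length_single, zero_add]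
  | cons a γ ih =>
    obtain ⟨ε, h1, h2, h3, h4⟩ := ih h
    refine ⟨ε.cons a, rfl, h2, ?_, ?_⟩
    · rw [carrier_cons, carrier_cons, h1, h3, union_assoc]
    · rw [length_cons, length_cons, h1, h4, add_assoc]

theorem vertex_castSucc_mem_edge (γ : PolyChain) (t : Fin γ.numEdges) :
    γ.vertex t.castSucc ∈ γ.edge t := left_mem_segment ℝ _ _

theorem vertex_succ_mem_edge (γ : PolyChain) (t : Fin γ.numEdges) :
    γ.vertex t.succ ∈ γ.edge t := right_mem_segment ℝ _ _

theorem IsSimple.eq_of_vertex_mem_edge {γ : PolyChain} (h : γ.IsSimple)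
    {i : Fin (γ.numEdges + 1)} {t : Fin γ.numEdges} (hi : γ.vertex i ∈ γ.edge t) :
    i = t.castSucc ∨ i = t.succ := by
  have hcase : (∃ s : Fin γ.numEdges, i = s.castSucc) ∨ i = Fin.last _ :=
    Fin.lastCases (Or.inr rfl) (fun s => Or.inl ⟨s, rfl⟩) i
  rcases hcase with ⟨s, rfl⟩ | rfl
  · rcases lt_trichotomy (s : ℕ) t with hst | hst | hst
    · rcases Nat.lt_or_ge (s + 1) t with hlt | hge
      · exact absurd hi ((Set.disjoint_left.1 (h.disjoint s t hlt)) (γ.vertex_castSucc_mem_edge s))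
      · have hmem : γ.vertex s.castSucc ∈ ({γ.vertex t.castSucc} : Set ℂ) := by
          rw [← h.consecutive s t (by omega)]
          exact ⟨γ.vertex_castSucc_mem_edge s, hi⟩
        exact Or.inl (h.injective hmem)
    · exact Or.inl (by rw [Fin.ext hst])
    · rcases Nat.lt_or_ge (t + 1) s with hlt | hge
      · exact absurd (γ.vertex_castSucc_mem_edge s) ((Set.disjoint_left.1 (h.disjoint t s hlt)) hi)
      · right
        ext
        simp only [Fin.val_castSucc, Fin.val_succ]
        omega
  · obtain ⟨n, v⟩ := γ
    simp only at *
    cases n with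
    | zero => exact t.elim0
    | succ n =>
      by_cases htl : t = Fin.last n
      · subst htl; exact Or.inr rfl
      · have htn : (t : ℕ) < n := lt_of_le_of_ne (Nat.lt_succ_iff.1 t.2) fun hh => htl (Fin.ext hh)
        have hlast := PolyChain.vertex_succ_mem_edge ⟨n + 1, v⟩ (Fin.last n)
        rcases Nat.lt_or_ge (t + 1) n with hlt | hge
        · exact absurd hlast ((Set.disjoint_left.1 (h.disjoint t (Fin.last n) (by simpa using hlt)))
            hi)
        · have hmem : v (Fin.last (n + 1)) ∈ ({v (Fin.last n).castSucc} : Set ℂ) := by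
            rw [← h.consecutive t (Fin.last n) (by simp; omega)]
            exact ⟨hi, hlast⟩
          have := congrArg Fin.val (h.injective hmem)
          simp at this

theorem IsSimple.cons {γ : PolyChain} (h : γ.IsSimple) {a : ℂ} (hne : a ≠ γ.source)
    (hs : segment ℝ a γ.source ∩ γ.carrier = {γ.source}) : (γ.cons a).IsSimple := by
  have hmem : ∀ {x}, x ∈ segment ℝ a γ.source → x ∈ γ.carrier → x = γ.source := by
    intro x h1 h2
    have : x ∈ ({γ.source} : Set ℂ) := hs ▸ ⟨h1, h2⟩
    exact this
  have ha : a ∉ γ.carrier := fun h => hne (hmem (left_mem_segment ℝ _ _) h)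
  refine ⟨?_, ?_, ?_⟩
  · refine Fin.cons_injective_iff.2 ⟨?_, h.injective⟩
    rintro ⟨t, ht⟩
    exact ha (ht ▸ γ.vertex_mem_carrier t)
  · intro s t
    refine Fin.cases ?_ (fun s => ?_) s <;> refine Fin.cases ?_ (fun t => ?_) t
    · intro hst; simp at hst
    · intro hst
      have ht0 : t.castSucc = 0 := by
        ext
        simp only [Fin.val_succ, Fin.val_zero] at hst
        simp only [Fin.val_castSucc, Fin.val_zero]
        omega
      change segment ℝ a γ.source ∩ γ.edge t = {γ.vertex t.castSucc}
      rw [ht0]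
      refine Subset.antisymm (fun x hx => hmem hx.1 (γ.edge_subset_carrier t hx.2)) ?_
      rintro _ rfl
      refine ⟨right_mem_segment ℝ _ _, ?_⟩
      have := γ.vertex_castSucc_mem_edge t
      rwa [ht0] at this
    · intro hst; simp at hst
    · intro hst
      exact h.consecutive s t (by simpa using hst)
  · intro s t
    refine Fin.cases ?_ (fun s => ?_) s <;> refine Fin.cases ?_ (fun t => ?_) t
    · intro hst; simp at hst
    · intro hst
      rw [edge_cons_succ, edge_cons_zero, Set.disjoint_left]
      intro x hx hx2
      obtain rfl := hmem hx (γ.edge_subset_carrier t hx2)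
      rcases h.eq_of_vertex_mem_edge (i := 0) hx2 with h0 | h0
      · have := congrArg Fin.val h0
        simp at this
        simp at hst
        omega
      · have := congrArg Fin.val h0
        simp at this
    · intro hst; simp at hst
    · intro hst
      exact h.disjoint s t (by simpa using hst)

end PolyChain

/-- The way back from sets to chains, needed to produce competitors for shortest paths and paths of
positive length. -/
theorem PolyArc.exists_polyChain {S : Set ℂ} {a b : ℂ} (h : PolyArc S a b) :
    ∃ γ : PolyChain, γ.IsSimple ∧ γ.source = a ∧ γ.target = b ∧ γ.carrier = S ∧
      γ.length = arcLength S := by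
  induction h with
  | single a =>
    refine ⟨⟨0, fun _ => a⟩, ⟨fun x y _ => Subsingleton.elim (α := Fin 1) x y, fun s => s.elim0,
      fun s => s.elim0⟩, rfl, rfl, PolyChain.carrier_single a, ?_⟩
    rw [PolyChain.length_single, arcLength_singleton]
  | @cons S a c b hne h hS ih =>
    obtain ⟨γ, h1, h2, h3, h4, h5⟩ := ih
    subst h2
    refine ⟨γ.cons a, h1.cons hne (by rw [h4]; exact hS), rfl, h3, ?_, ?_⟩
    · rw [PolyChain.carrier_cons, h4]
    · rw [PolyChain.length_cons, h5, arcLength_union (PolyArc.segment _ _) h hS, arcLength_segment]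

theorem PolyArc.arcLength_pos {S : Set ℂ} {a b : ℂ} (h : PolyArc S a b) (hab : a ≠ b) :
    0 < arcLength S := by
  obtain ⟨c, hc, hcS, -⟩ := h.exists_germ hab
  have := arcLength_mono h hcS
  rw [arcLength_segment] at this
  exact (dist_pos.2 hc.symm).trans_le this

theorem PolyArc.isPathOfPositiveLength {S : Set ℂ} {a b : ℂ} (h : PolyArc S a b) (hab : a ≠ b) :
    IsPathOfPositiveLength S := by
  obtain ⟨γ, h1, -, -, h4, h5⟩ := h.exists_polyChain
  exact ⟨γ, h1, h5 ▸ h.arcLength_pos hab, h4⟩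

/-- Removing loops from a chain leaves an arc, which is shorter unless nothing was removed. -/
theorem PolyChain.exists_polyArc (γ : PolyChain) :
    ∃ S ⊆ γ.carrier, PolyArc S γ.source γ.target ∧
      (S = γ.carrier ∧ arcLength S = γ.length ∨ arcLength S < γ.length) := by
  induction γ using PolyChain.cons_induction with
  | single a =>
    refine ⟨{a}, by rw [PolyChain.carrier_single], PolyArc.single a, Or.inl ⟨?_, ?_⟩⟩
    · rw [PolyChain.carrier_single]
    · rw [PolyChain.length_single, arcLength_singleton]
  | cons a γ ih =>
    obtain ⟨S, hS, harc, hlen⟩ := ih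
    have hle : arcLength S ≤ γ.length := by
      rcases hlen with h | h
      · exact h.2.le
      · exact h.le
    rw [PolyChain.carrier_cons, PolyChain.length_cons, PolyChain.source_cons,
      PolyChain.target_cons]
    by_cases hac : a = γ.source
    · refine ⟨S, hS.trans subset_union_right, hac ▸ harc, ?_⟩
      rw [hac, dist_self, zero_add, segment_same, union_eq_right.2]
      · exact hlen
      · exact singleton_subset_iff.2 (γ.vertex_mem_carrier 0)
    -- z is where the new edge first meets the arc. If z is not the source, the loop from z along
    -- the edge and back along the arc is dropped; the length saved is at least that of the edge
    -- beyond z.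
    · obtain ⟨z, hz, hzS⟩ := exists_segment_inter_eq_singleton (a := a) harc.isClosed harc.left_mem
      have hzmem : z ∈ S := (hzS.symm ▸ mem_singleton z : z ∈ segment ℝ a z ∩ S).2
      by_cases hzc : z = γ.source
      · subst hzc
        refine ⟨_, union_subset_union_right _ hS, PolyArc.cons hac harc hzS, ?_⟩
        rw [arcLength_union (PolyArc.segment _ _) harc hzS, arcLength_segment]
        rcases hlen with h | h
        · left; rw [h.1, ← h.2, h.1]; exact ⟨rfl, rfl⟩
        · right; linarith
      · obtain ⟨S₁, S₂, hs⟩ := harc.exists_split hzmem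
        have hint : segment ℝ a z ∩ S₂ = {z} := by
          refine Subset.antisymm (fun y hy => ?_) ?_
          · rw [← hzS]; exact ⟨hy.1, hs.subset_right hy.2⟩
          · rintro _ rfl; exact ⟨right_mem_segment ℝ _ _, hs.right.left_mem⟩
        refine ⟨_, union_subset_union (segment_subset_left hz) (hs.subset_right.trans hS),
          (PolyArc.segment a z).trans hs.right hint, Or.inr ?_⟩
        rw [arcLength_union (PolyArc.segment _ _) hs.right hint, arcLength_segment]
        have h1 := arcLength_mono harc hs.subset_right
        have h2 := dist_add_dist_of_mem_segment hz
        have h3 := dist_pos.2 hzc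
        linarith

/-- If loop removal took anything away, the result would be a strictly shorter competitor. -/
theorem PolyChain.IsShortest.polyArc {γ : PolyChain} {K : Set ℂ} {a b : ℂ}
    (h : γ.IsShortest K a b) : PolyArc γ.carrier a b ∧ γ.length = arcLength γ.carrier := by
  obtain ⟨S, hS, harc, hlen⟩ := γ.exists_polyArc
  rw [h.source_eq, h.target_eq] at harc
  rcases hlen with ⟨rfl, h2⟩ | hlt
  · exact ⟨harc, h2.symm⟩
  · obtain ⟨δ, -, h2, h3, h4, h5⟩ := harc.exists_polyChain
    have := h.minimal δ h2 h3 (h4 ▸ hS.trans h.subset)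
    linarith

/-! ### Simple polygons from arcs -/

/-- The vertices of a chain tracing S, read cyclically, are the vertices of the polygon: `ZMod (N +
1)` unfolds to `Fin (N + 1)`, and the closing segment is the edge after the last vertex. -/
theorem PolyArc.exists_simplePolygon_of_segment {S : Set ℂ} {a c : ℂ} (h : PolyArc S a c)
    (hac : a ≠ c) (hS : _root_.segment ℝ c a ∩ S = {a, c}) :
    ∃ Q : SimplePolygon, Q.boundary = S ∪ _root_.segment ℝ a c := by
  obtain ⟨γ, hγ, rfl, rfl, rfl, -⟩ := h.exists_polyChain
  obtain ⟨N, v⟩ := γ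
  have hcl : ∀ {x}, x ∈ _root_.segment ℝ (v (Fin.last N)) (v 0) →
      x ∈ (⟨N, v⟩ : PolyChain).carrier → x = v 0 ∨ x = v (Fin.last N) := by
    intro x h1 h2
    exact hS.subset ⟨h1, h2⟩
  -- With a single edge the chain would coincide with the closing segment and contain its midpoint.
  have hN : 2 ≤ N := by
    by_contra! hlt
    have hN01 : N = 0 ∨ N = 1 := by omega
    rcases hN01 with rfl | rfl
    · exact hac rfl
    · have hm : midpoint ℝ (v (Fin.last 1)) (v 0) ∈ _root_.segment ℝ (v (Fin.last 1)) (v 0) :=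
        midpoint_mem_segment _ _
      have hm' : midpoint ℝ (v (Fin.last 1)) (v 0) ∈ (⟨1, v⟩ : PolyChain).carrier := by
        refine PolyChain.edge_subset_carrier ⟨1, v⟩ (0 : Fin 1) ?_
        have : PolyChain.edge ⟨1, v⟩ (0 : Fin 1) = _root_.segment ℝ (v 0) (v (Fin.last 1)) := rfl
        rw [this, segment_symm]
        exact hm
      rcases hcl hm hm' with h1 | h1
      · rw [midpoint_eq_right_iff] at h1
        exact hac h1.symm
      · rw [midpoint_eq_left_iff] at h1
        exact hac h1.symm
  set E : Fin (N + 1) → Set ℂ := fun k => _root_.segment ℝ (v k) (v (k + 1)) with hE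
  have hE1 : ∀ t : Fin N, E t.castSucc = PolyChain.edge ⟨N, v⟩ t := by
    intro t
    simp only [hE, PolyChain.edge, Fin.coeSucc_eq_succ]
  have hE2 : E (Fin.last N) = _root_.segment ℝ (v (Fin.last N)) (v 0) := by
    simp only [hE, Fin.last_add_one]
  have hcase : ∀ k : Fin (N + 1), (∃ t : Fin N, k = t.castSucc) ∨ k = Fin.last N := fun k =>
    Fin.lastCases (Or.inr rfl) (fun s => Or.inl ⟨s, rfl⟩) k
  have h0 : ∀ t : Fin N, v 0 ∈ PolyChain.edge ⟨N, v⟩ t → (t : ℕ) = 0 := by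
    intro t ht
    rcases hγ.eq_of_vertex_mem_edge ht with h0 | h0
    · simpa using (congrArg Fin.val h0).symm
    · simpa using (congrArg Fin.val h0).symm
  have hl : ∀ t : Fin N, v (Fin.last N) ∈ PolyChain.edge ⟨N, v⟩ t → (t : ℕ) + 1 = N := by
    intro t ht
    rcases hγ.eq_of_vertex_mem_edge ht with h0 | h0
    · have := (congrArg Fin.val h0).symm
      simp at this
      have := t.2
      omega
    · simpa using (congrArg Fin.val h0).symm
  have hclosing : ∀ t : Fin N, ∀ x ∈ PolyChain.edge ⟨N, v⟩ t, x ∈ E (Fin.last N) →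
      (x = v 0 ∧ (t : ℕ) = 0) ∨ (x = v (Fin.last N) ∧ (t : ℕ) + 1 = N) := by
    intro t x hx hx2
    rw [hE2] at hx2
    rcases hcl hx2 (PolyChain.edge_subset_carrier ⟨N, v⟩ t hx) with rfl | rfl
    · exact Or.inl ⟨rfl, h0 t hx⟩
    · exact Or.inr ⟨rfl, hl t hx⟩
  have hcons : ∀ k, E k ∩ E (k + 1) = {v (k + 1)} := by
    intro k
    refine Subset.antisymm ?_ ?_
    · rintro x ⟨hx1, hx2⟩
      rcases hcase k with ⟨t, rfl⟩ | rfl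
      · rw [hE1] at hx1
        rw [Fin.coeSucc_eq_succ] at hx2 ⊢
        rcases hcase t.succ with ⟨t', ht'⟩ | ht'
        · rw [ht', hE1] at hx2
          rw [ht']
          have := congrArg Fin.val ht'
          simp at this
          have h3 := hγ.consecutive t t' (by simp; omega)
          exact h3 ▸ ⟨hx1, hx2⟩
        · rw [ht'] at hx2 ⊢
          have := congrArg Fin.val ht'
          simp at this
          rcases hclosing t x hx1 hx2 with h | h
          · omega
          · exact h.1
      · rw [Fin.last_add_one] at hx2 ⊢
        have hz : (0 : Fin (N + 1)) = (⟨0, by omega⟩ : Fin N).castSucc := rfl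
        rw [hz, hE1] at hx2
        rcases hclosing _ x hx2 hx1 with h | h
        · exact h.1
        · simp at h
          omega
    · rintro _ rfl
      exact ⟨right_mem_segment ℝ _ _, left_mem_segment ℝ _ _⟩
  have hdisj : ∀ k l, l ≠ k → l ≠ k + 1 → k ≠ l + 1 → Disjoint (E k) (E l) := by
    have hwlog : ∀ (t : Fin N), Fin.last N ≠ t.castSucc + 1 → t.castSucc ≠ Fin.last N + 1 →
        Disjoint (E t.castSucc) (E (Fin.last N)) := by
      intro t h2 h3
      rw [Set.disjoint_left]
      intro x hx1 hx2
      rw [hE1] at hx1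
      rcases hclosing t x hx1 hx2 with h | h
      · apply h3
        rw [Fin.last_add_one]
        exact Fin.ext h.2
      · apply h2
        rw [Fin.coeSucc_eq_succ]
        ext
        simp only [Fin.val_last, Fin.val_succ]
        omega
    intro k l h1 h2 h3
    rcases hcase k with ⟨t, rfl⟩ | rfl <;> rcases hcase l with ⟨t', rfl⟩ | rfl
    · rw [hE1, hE1]
      rw [Fin.coeSucc_eq_succ] at h2 h3
      have g1 : (t' : ℕ) ≠ t := fun h => h1 (by rw [Fin.ext h])
      have g2 : (t' : ℕ) ≠ t + 1 := fun h => h2 (Fin.ext (by simpa using h))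
      have g3 : (t : ℕ) ≠ t' + 1 := fun h => h3 (Fin.ext (by simpa using h))
      rcases Nat.lt_or_ge (t + 1) t' with h | h
      · exact hγ.disjoint t t' h
      · exact (hγ.disjoint t' t (by omega)).symm
    · exact hwlog t h2 h3
    · exact (hwlog t' h3 h2).symm
    · exact absurd rfl h1
  refine ⟨⟨N + 1, by omega, v, hγ.injective, fun k => ?_, hdisj⟩, ?_⟩
  · have hk : (k + 2 : ZMod (N + 1)) = k + 1 + 1 := by ring
    rw [hk]
    exact hcons k
  · change (⋃ k, E k) = _
    ext x
    rw [mem_iUnion]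
    constructor
    · rintro ⟨k, hk⟩
      rcases hcase k with ⟨t, rfl⟩ | rfl
      · rw [hE1] at hk
        exact Or.inl (PolyChain.edge_subset_carrier _ _ hk)
      · rw [hE2, segment_symm] at hk
        exact Or.inr hk
    · rintro ((⟨t, rfl⟩ | hx) | hx)
      · exact ⟨t, left_mem_segment ℝ _ _⟩
      · obtain ⟨t, ht⟩ := mem_iUnion.1 hx
        exact ⟨t.castSucc, (hE1 t).symm ▸ ht⟩
      · refine ⟨Fin.last N, ?_⟩
        rw [hE2, segment_symm]
        exact hx

/-- Two arcs with the same endpoints and otherwise disjoint form a simple polygon. -/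
theorem PolyArc.exists_simplePolygon {S T : Set ℂ} {a b : ℂ} (hS : PolyArc S a b)
    (hT : PolyArc T a b) (hab : a ≠ b) (h : S ∩ T = {a, b}) :
    ∃ Q : SimplePolygon, Q.boundary = S ∪ T := by
  cases hT with
  | single => exact absurd rfl hab
  | @cons T _ c _ hne hT hcT =>
    have haT : a ∉ T := by
      intro ha
      have : a ∈ ({c} : Set ℂ) := by rw [← hcT]; exact ⟨left_mem_segment ℝ _ _, ha⟩
      exact hne this
    have hST : S ∩ T = {b} := by
      refine Subset.antisymm ?_ ?_
      · rintro x ⟨h1, h2⟩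
        have : x ∈ ({a, b} : Set ℂ) := h ▸ ⟨h1, Or.inr h2⟩
        rcases this with rfl | h3
        · exact absurd h2 haT
        · exact h3
      · rintro _ rfl
        exact ⟨hS.right_mem, hT.right_mem⟩
    -- The first segment of T is kept as the closing edge; the rest of T is appended to S.
    have harc := hS.trans hT.symm hST
    obtain ⟨Q, hQ⟩ := harc.exists_simplePolygon_of_segment hne (by
      refine Subset.antisymm ?_ ?_
      · rintro x ⟨hx, hx1 | hx1⟩
        · rw [segment_symm] at hx
          have : x ∈ ({a, b} : Set ℂ) := h ▸ ⟨hx1, Or.inl hx⟩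
          rcases this with rfl | rfl
          · exact Or.inl rfl
          · refine Or.inr ?_
            rw [← hcT]
            exact ⟨hx, hT.right_mem⟩
        · rw [segment_symm] at hx
          refine Or.inr ?_
          rw [← hcT]
          exact ⟨hx, hx1⟩
      · rintro x (rfl | rfl)
        · exact ⟨right_mem_segment ℝ _ _, Or.inl hS.left_mem⟩
        · exact ⟨left_mem_segment ℝ _ _, Or.inr hT.left_mem⟩)
    refine ⟨Q, ?_⟩
    rw [hQ, union_assoc, union_comm T]

/-! ### Oriented area -/

/-- The oriented area of the parallelogram spanned by two vectors. -/
def cross (p q : ℂ) : ℝ := p.re * q.im - p.im * q.re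

theorem cross_add_right (p q r : ℂ) : cross p (q + r) = cross p q + cross p r := by
  simp [cross]; ring

theorem cross_sub_right (p q r : ℂ) : cross p (q - r) = cross p q - cross p r := by
  simp [cross]; ring

theorem cross_mul_right (p q : ℂ) (t : ℝ) : cross p (t * q) = t * cross p q := by
  simp [cross]; ring

theorem cross_mul_left (p q : ℂ) (t : ℝ) : cross (t * p) q = t * cross p q := by
  simp [cross]; ring

theorem cross_swap (p q : ℂ) : cross q p = -cross p q := by
  simp [cross]; ring

theorem cross_same (p : ℂ) : cross p p = 0 := by
  simp [cross]; ring

theorem cross_I_mul (p : ℂ) : cross p (Complex.I * p) = ‖p‖ ^ 2 := by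
  simp [cross, Complex.sq_norm, Complex.normSq_apply]

theorem continuous_cross_right (p : ℂ) : Continuous (cross p) := by
  unfold cross; fun_prop

theorem isLinearMap_cross (p : ℂ) : IsLinearMap ℝ (cross p) :=
  ⟨cross_add_right p, fun t q => by rw [Complex.real_smul, cross_mul_right, smul_eq_mul]⟩

theorem exists_eq_mul_of_cross_eq_zero {p q : ℂ} (hp : p ≠ 0) (h : cross p q = 0) :
    ∃ t : ℝ, q = t * p := by
  have hn : p.re * p.re + p.im * p.im ≠ 0 := by
    rw [← Complex.normSq_apply]
    exact (Complex.normSq_pos.2 hp).ne'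
  refine ⟨(p.re * q.re + p.im * q.im) / (p.re * p.re + p.im * p.im), ?_⟩
  simp only [cross] at h
  apply Complex.ext
  · simp only [Complex.mul_re, Complex.ofReal_re, Complex.ofReal_im, zero_mul, sub_zero]
    rw [div_mul_eq_mul_div, eq_div_iff hn]
    linear_combination -p.im * h
  · simp only [Complex.mul_im, Complex.ofReal_re, Complex.ofReal_im, zero_mul, add_zero]
    rw [div_mul_eq_mul_div, eq_div_iff hn]
    linear_combination p.re * h

/-- The coordinates of a vector with respect to two independent vectors. -/
theorem exists_coord_of_cross_ne_zero {p q : ℂ} (h : cross p q ≠ 0) (z : ℂ) :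
    z = (cross z q / cross p q : ℝ) * p + (cross p z / cross p q : ℝ) * q := by
  apply Complex.ext
  · simp only [Complex.add_re, Complex.mul_re, Complex.ofReal_re, Complex.ofReal_im, zero_mul,
      sub_zero]
    field_simp
    simp only [cross]
    ring
  · simp only [Complex.add_im, Complex.mul_im, Complex.ofReal_re, Complex.ofReal_im, zero_mul,
      add_zero]
    field_simp
    simp only [cross]
    ring

theorem segment_add_mul (p d : ℂ) {s t : ℝ} (hst : s ≤ t) :
    segment ℝ (p + s * d) (p + t * d) = (fun r : ℝ => p + r * d) '' Icc s t := by
  ext x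
  constructor
  · rintro ⟨α, β, hα, hβ, hab, rfl⟩
    refine ⟨α * s + β * t, ⟨?_, ?_⟩, ?_⟩
    · obtain rfl : α = 1 - β := by linarith
      nlinarith [mul_nonneg hβ (sub_nonneg.2 hst)]
    · obtain rfl : β = 1 - α := by linarith
      nlinarith [mul_nonneg hα (sub_nonneg.2 hst)]
    · have : (α : ℂ) + β = 1 := by exact_mod_cast hab
      simp only [Complex.real_smul]
      push_cast
      linear_combination -p * this
  · rintro ⟨r, ⟨h1, h2⟩, rfl⟩
    rcases hst.eq_or_lt with rfl | hlt
    · obtain rfl : r = s := le_antisymm h2 h1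
      simp
    · have hts : 0 < t - s := by linarith
      refine ⟨(t - r) / (t - s), (r - s) / (t - s), div_nonneg (by linarith) hts.le,
        div_nonneg (by linarith) hts.le, by field_simp; ring, ?_⟩
      have hc : (t - s : ℂ) ≠ 0 := by
        have : ((t - s : ℝ) : ℂ) ≠ 0 := Complex.ofReal_ne_zero.2 hts.ne'
        simpa using this
      simp only [Complex.real_smul]
      push_cast
      field_simp
      ring

theorem segment_eq_image_add_mul (a b : ℂ) :
    segment ℝ a b = (fun r : ℝ => a + r * (b - a)) '' Icc 0 1 := by
  have := segment_add_mul a (b - a) (zero_le_one (α := ℝ))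
  simpa using this

theorem add_mul_injective {p d : ℂ} (hd : d ≠ 0) {s t : ℝ} (h : p + s * d = p + t * d) :
    s = t := by
  have h1 : (s : ℂ) * d = t * d := by linear_combination h
  exact_mod_cast mul_right_cancel₀ hd h1

namespace SimplePolygon

variable (P : SimplePolygon)

instance : NeZero P.n := ⟨by have := P.three_le; omega⟩

/-! ### Sides and boundary paths of a simple polygon -/

/-- The side of the polygon which starts at a given vertex. -/
def side (k : ZMod P.n) : Set ℂ := segment ℝ (P.vertex k) (P.vertex (k + 1))

/-- The boundary path which starts at vertex `s` and has `l` sides. -/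
def subpath (s l : ℕ) : PolyChain := ⟨l, fun t => P.vertex ((s + t : ℕ) : ZMod P.n)⟩

variable {P}

theorem natCast_inj_of_lt {s i j : ℕ} (hi : i < P.n) (hj : j < P.n)
    (h : ((s + i : ℕ) : ZMod P.n) = ((s + j : ℕ) : ZMod P.n)) : i = j := by
  rw [ZMod.natCast_eq_natCast_iff] at h
  have h1 := Nat.ModEq.add_left_cancel' s h
  rwa [Nat.ModEq, Nat.mod_eq_of_lt hi, Nat.mod_eq_of_lt hj] at h1

theorem natCast_add_n (s : ℕ) : ((s + P.n : ℕ) : ZMod P.n) = s := by simp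

theorem exists_natCast_eq (s : ℕ) (k : ZMod P.n) : ∃ j < P.n, k = ((s + j : ℕ) : ZMod P.n) :=
  ⟨(k - s).val, ZMod.val_lt _, by push_cast; rw [ZMod.natCast_zmod_val]; ring⟩

theorem add_one_ne_self (k : ZMod P.n) : k + 1 ≠ k := by
  intro h
  have h1 : (1 : ZMod P.n) = 0 := by linear_combination h
  have h2 : ((0 + 1 : ℕ) : ZMod P.n) = ((0 + 0 : ℕ) : ZMod P.n) := by simpa using h1
  have h3 := P.three_le
  have := natCast_inj_of_lt (by omega) (by omega) h2
  omega

theorem vertex_ne (k : ZMod P.n) : P.vertex (k + 1) ≠ P.vertex k :=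
  fun h => add_one_ne_self k (P.injective h)

theorem side_inter {k l : ZMod P.n} (hkl : l ≠ k) {x : ℂ} (hk : x ∈ P.side k)
    (hl : x ∈ P.side l) : (l = k + 1 ∧ x = P.vertex l) ∨ (k = l + 1 ∧ x = P.vertex k) := by
  have hcons : ∀ k, ∀ x ∈ P.side k, x ∈ P.side (k + 1) → x = P.vertex (k + 1) := by
    intro k x h1 h2
    have h := P.consecutive k
    have h2' : (k + 2 : ZMod P.n) = k + 1 + 1 := by ring
    rw [h2'] at h
    exact h.subset ⟨h1, h2⟩
  by_cases h1 : l = k + 1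
  · subst h1
    exact Or.inl ⟨rfl, hcons k x hk hl⟩
  by_cases h2 : k = l + 1
  · subst h2
    exact Or.inr ⟨rfl, hcons l x hl hk⟩
  exact absurd hl (Set.disjoint_left.1 (P.disjoint k l hkl h1 h2) hk)

theorem vertex_mem_side (k : ZMod P.n) : P.vertex k ∈ P.side k := left_mem_segment ℝ _ _

theorem vertex_succ_mem_side (k : ZMod P.n) : P.vertex (k + 1) ∈ P.side k :=
  right_mem_segment ℝ _ _

theorem side_subset_boundary (k : ZMod P.n) : P.side k ⊆ P.boundary :=
  subset_iUnion (fun k => segment ℝ (P.vertex k) (P.vertex (k + 1))) k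

theorem mem_boundary {x : ℂ} : x ∈ P.boundary ↔ ∃ k, x ∈ P.side k := mem_iUnion

theorem boundary_subset_region : P.boundary ⊆ P.region := subset_union_left

theorem isCompact_boundary : IsCompact P.boundary :=
  isCompact_iUnion fun _ => isCompact_segment' _ _

theorem subpath_succ (s l : ℕ) :
    P.subpath s (l + 1) = (P.subpath (s + 1) l).cons (P.vertex (s : ZMod P.n)) := by
  simp only [subpath, PolyChain.cons]
  congr 1
  funext t
  refine Fin.cases ?_ (fun t => ?_) t
  · simp
  · rw [Fin.cons_succ]
    congr 1
    rw [Fin.val_succ]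
    push_cast
    ring

theorem source_subpath (s l : ℕ) : (P.subpath s l).source = P.vertex (s : ZMod P.n) := by
  simp [subpath, PolyChain.source]

theorem target_subpath (s l : ℕ) :
    (P.subpath s l).target = P.vertex ((s + l : ℕ) : ZMod P.n) := rfl

theorem carrier_subpath_zero (s : ℕ) :
    (P.subpath s 0).carrier = {P.vertex (s : ZMod P.n)} := by
  have : P.subpath s 0 = ⟨0, fun _ => P.vertex (s : ZMod P.n)⟩ := by
    simp only [subpath]
    congr 1
    funext t
    rw [Subsingleton.elim (α := Fin 1) t 0]
    simp
  rw [this, PolyChain.carrier_single]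

theorem carrier_subpath_succ (s l : ℕ) :
    (P.subpath s (l + 1)).carrier = P.side s ∪ (P.subpath (s + 1) l).carrier := by
  rw [subpath_succ, PolyChain.carrier_cons, source_subpath, side]
  push_cast
  rfl

theorem mem_carrier_subpath {s l : ℕ} {x : ℂ} : x ∈ (P.subpath s l).carrier ↔
    x = P.vertex (s : ZMod P.n) ∨ ∃ k < l, x ∈ P.side ((s + k : ℕ) : ZMod P.n) := by
  induction l generalizing s with
  | zero => rw [carrier_subpath_zero]; simp
  | succ l ih =>
    rw [carrier_subpath_succ, mem_union, ih]
    constructor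
    · rintro (h | h | ⟨k, hk, h⟩)
      · exact Or.inr ⟨0, by omega, by simpa using h⟩
      · refine Or.inr ⟨0, by omega, ?_⟩
        rw [h]
        push_cast
        rw [add_zero]
        exact vertex_succ_mem_side _
      · refine Or.inr ⟨k + 1, by omega, ?_⟩
        rwa [show s + (k + 1) = s + 1 + k by ring]
    · rintro (h | ⟨k, hk, h⟩)
      · exact Or.inl (h ▸ vertex_mem_side _)
      · cases k with
        | zero => exact Or.inl (by simpa using h)
        | succ k =>
          refine Or.inr (Or.inr ⟨k, by omega, ?_⟩)
          rwa [show s + (k + 1) = s + 1 + k by ring] at h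

theorem carrier_subpath_subset_boundary (s l : ℕ) :
    (P.subpath s l).carrier ⊆ P.boundary := by
  intro x hx
  rcases mem_carrier_subpath.1 hx with rfl | ⟨k, -, hk⟩
  · exact side_subset_boundary _ (vertex_mem_side _)
  · exact side_subset_boundary _ hk

theorem polyArc_subpath {s l : ℕ} (hl : l < P.n) :
    PolyArc (P.subpath s l).carrier (P.vertex (s : ZMod P.n))
      (P.vertex ((s + l : ℕ) : ZMod P.n)) := by
  induction l generalizing s with
  | zero =>
    rw [carrier_subpath_zero, add_zero]
    exact PolyArc.single _
  | succ l ih =>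
    have h := ih (s := s + 1) (by omega)
    rw [carrier_subpath_succ, show s + (l + 1) = s + 1 + l by ring]
    have hs1 : ((s + 1 : ℕ) : ZMod P.n) = (s : ZMod P.n) + 1 := by push_cast; rfl
    rw [hs1] at h
    refine PolyArc.cons (vertex_ne _).symm h ?_
    refine Subset.antisymm ?_ ?_
    · rintro x ⟨h1, h2⟩
      rcases mem_carrier_subpath.1 h2 with rfl | ⟨k, hk, h3⟩
      · rw [hs1]; rfl
      · have hne : ((s + 1 + k : ℕ) : ZMod P.n) ≠ s := by
          intro h
          have := natCast_inj_of_lt (P := P) (s := s) (i := 1 + k) (j := 0) (by omega) (by omega)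
            (by rw [← add_assoc, h]; simp)
          omega
        rcases side_inter hne h1 h3 with ⟨h4, h5⟩ | ⟨h4, -⟩
        · rw [h5, h4]; rfl
        -- A later side adjacent to side s from behind would complete a full turn, but the path has
        -- fewer than n sides.
        · exfalso
          have := natCast_inj_of_lt (P := P) (s := s) (i := 1 + k + 1) (j := 0) (by omega)
            (by omega) (by
              push_cast at h4 ⊢
              linear_combination -h4)
          omega
    · rintro _ rfl
      exact ⟨right_mem_segment ℝ _ _, h.left_mem⟩

theorem carrier_subpath_inter {s l : ℕ} (hl : l < P.n) :
    (P.subpath s l).carrier ∩ (P.subpath (s + l) (P.n - l)).carrier ⊆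
      {P.vertex (s : ZMod P.n), P.vertex ((s + l : ℕ) : ZMod P.n)} := by
  rintro x ⟨h1, h2⟩
  rcases mem_carrier_subpath.1 h1 with rfl | ⟨i, hi, h1⟩
  · exact Or.inl rfl
  rcases mem_carrier_subpath.1 h2 with rfl | ⟨j, hj, h2⟩
  · exact Or.inr rfl
  have hne : ((s + l + j : ℕ) : ZMod P.n) ≠ ((s + i : ℕ) : ZMod P.n) := by
    intro h
    rw [add_assoc] at h
    have := natCast_inj_of_lt (P := P) (by omega) (by omega) h
    omega
  rcases side_inter hne h1 h2 with ⟨h4, h5⟩ | ⟨h4, h5⟩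
  · right
    have := natCast_inj_of_lt (P := P) (s := s) (i := l + j) (j := i + 1) (by omega) (by omega) (by
      push_cast at h4 ⊢
      linear_combination h4)
    obtain rfl : j = 0 := by omega
    rw [h5]; rfl
  · left
    have h6 : ((s + i : ℕ) : ZMod P.n) = ((s + (l + j + 1) : ℕ) : ZMod P.n) := by
      push_cast at h4 ⊢
      linear_combination h4
    -- The two paths can also touch across the index wrap, when l + j + 1 = n; the common vertex is
    -- then the starting one.
    by_cases hlt : l + j + 1 < P.n
    · have := natCast_inj_of_lt (P := P) (by omega) hlt h6
      omega
    · have hn : l + j + 1 = P.n := by omega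
      rw [hn, natCast_add_n] at h6
      rw [h5, h6]

theorem carrier_subpath_union {s l : ℕ} (hl : l < P.n) :
    (P.subpath s l).carrier ∪ (P.subpath (s + l) (P.n - l)).carrier = P.boundary := by
  refine Subset.antisymm (union_subset (carrier_subpath_subset_boundary _ _)
    (carrier_subpath_subset_boundary _ _)) ?_
  intro x hx
  obtain ⟨k, hk⟩ := mem_boundary.1 hx
  obtain ⟨j, hj, rfl⟩ := exists_natCast_eq s k
  rcases Nat.lt_or_ge j l with h | h
  · exact Or.inl (mem_carrier_subpath.2 (Or.inr ⟨j, h, hk⟩))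
  · refine Or.inr (mem_carrier_subpath.2 (Or.inr ⟨j - l, by omega, ?_⟩))
    rwa [show s + l + (j - l) = s + j by omega]

theorem carrier_subpath_mono {s l s' l' : ℕ} (h1 : s ≤ s') (h2 : s' + l' ≤ s + l) :
    (P.subpath s' l').carrier ⊆ (P.subpath s l).carrier := by
  intro x hx
  rcases mem_carrier_subpath.1 hx with rfl | ⟨i, hi, h⟩
  · rcases Nat.lt_or_ge s' (s + l) with h3 | h3
    · refine mem_carrier_subpath.2 (Or.inr ⟨s' - s, by omega, ?_⟩)
      rw [show s + (s' - s) = s' by omega]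
      exact vertex_mem_side _
    · obtain rfl : s' = s + l := by omega
      exact PolyChain.vertex_mem_carrier (P.subpath s l) (Fin.last l)
  · refine mem_carrier_subpath.2 (Or.inr ⟨s' - s + i, by omega, ?_⟩)
    rwa [show s + (s' - s + i) = s' + i by omega]

theorem subpath_add_n (s l : ℕ) : P.subpath (s + P.n) l = P.subpath s l := by
  simp only [subpath]
  congr 1
  funext t
  congr 1
  push_cast
  simp

/-! ### The two sides of an edge -/

theorem isOpen_compl_region : IsOpen P.regionᶜ := isOpen_unenclosed isCompact_boundary.isClosed

theorem isPreconnected_compl_region : IsPreconnected P.regionᶜ :=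
  isPreconnected_unenclosed isCompact_boundary.isBounded

theorem isOpen_inside : IsOpen P.inside := isOpen_enclosedRegion isCompact_boundary.isClosed

/-- Near an inner point of a side, the polygon looks like a half plane. -/
theorem exists_half_ball (hP : P.IsCounterclockwise) (k : ZMod P.n) {t : ℝ} (ht : t ∈ Ioo (0 : ℝ) 1)
    {d z : ℂ} (hd : d = P.vertex (k + 1) - P.vertex k) (hz : z = P.vertex k + t * d) :
    ∃ r > 0, ∀ w ∈ ball z r, (0 < cross d (w - z) → w ∈ P.inside) ∧
      (cross d (w - z) < 0 → w ∉ P.region) ∧ (cross d (w - z) = 0 → w ∈ P.side k) ∧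
      (w ∈ P.boundary → cross d (w - z) = 0) := by
  have hd0 : d ≠ 0 := by rw [hd]; exact sub_ne_zero.2 (vertex_ne k)
  have hdn : 0 < ‖d‖ := norm_pos_iff.2 hd0
  have hk1 : P.vertex (k + 1) = P.vertex k + (1 : ℝ) * d := by rw [hd]; push_cast; ring
  have hk0 : P.vertex k = P.vertex k + (0 : ℝ) * d := by push_cast; ring
  have hside : P.side k = (fun r : ℝ => P.vertex k + r * d) '' Icc 0 1 := by
    rw [side, segment_eq_image_add_mul, ← hd]
  -- The rest of the boundary is an arc A from vertex k + 1 back to vertex k. It stays at positive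
  -- distance from z, so near z only the side itself is seen.
  obtain ⟨s, hs⟩ : ∃ s : ℕ, (s : ZMod P.n) = k := ⟨k.val, ZMod.natCast_zmod_val k⟩
  have hn := P.three_le
  set A := (P.subpath (s + 1) (P.n - 1)).carrier with hA
  have hAarc : PolyArc A (P.vertex (k + 1)) (P.vertex k) := by
    have h := polyArc_subpath (P := P) (s := s + 1) (l := P.n - 1) (by omega)
    rw [show s + 1 + (P.n - 1) = s + P.n by omega, natCast_add_n] at h
    push_cast at h
    rwa [hs] at h
  have hbd : P.boundary = P.side k ∪ A := by
    have h := carrier_subpath_union (P := P) (s := s) (l := 1) (by omega)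
    rw [← h, carrier_subpath_succ, carrier_subpath_zero, hs]
    rw [union_assoc]
    congr 1
    refine (union_eq_right.2 (singleton_subset_iff.2 ?_))
    push_cast
    rw [hs]
    exact hAarc.left_mem
  have hsA : ∀ x ∈ P.side k, x ∈ A → x = P.vertex k ∨ x = P.vertex (k + 1) := by
    intro x hx hxA
    have h := carrier_subpath_inter (P := P) (s := s) (l := 1) (by omega)
    rw [carrier_subpath_succ, hs] at h
    have := h ⟨Or.inl hx, hxA⟩
    push_cast at this
    rwa [hs] at this
  have hzs : z ∈ P.side k := by rw [hside]; exact ⟨t, ⟨ht.1.le, ht.2.le⟩, hz.symm⟩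
  have hzA : z ∉ A := by
    intro h
    rcases hsA z hzs h with h | h
    · rw [hk0, hz] at h
      exact ht.1.ne' (add_mul_injective hd0 h)
    · rw [hk1, hz] at h
      exact ht.2.ne (add_mul_injective hd0 h)
  obtain ⟨r₀, hr₀, hball⟩ := Metric.isOpen_iff.1 hAarc.isClosed.isOpen_compl z hzA
  obtain ⟨r, hr, hr1, hr2, hr3⟩ : ∃ r > 0, r ≤ r₀ ∧ r ≤ t * ‖d‖ ∧ r ≤ (1 - t) * ‖d‖ := by
    refine ⟨min r₀ (min (t * ‖d‖) ((1 - t) * ‖d‖)), ?_, min_le_left _ _, ?_, ?_⟩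
    · have h1 := ht.1
      have h2 : 0 < 1 - t := by linarith [ht.2]
      positivity
    · exact (min_le_right _ _).trans (min_le_left _ _)
    · exact (min_le_right _ _).trans (min_le_right _ _)
  have hline : ∀ w, cross d (w - z) = 0 → ∃ q : ℝ, w = P.vertex k + q * d ∧
      dist w z = |q - t| * ‖d‖ := by
    intro w hw
    obtain ⟨q, hq⟩ := exists_eq_mul_of_cross_eq_zero hd0 hw
    refine ⟨q + t, ?_, ?_⟩
    · push_cast
      linear_combination hq + hz
    · rw [dist_eq_norm, hq, norm_mul, Complex.norm_real, Real.norm_eq_abs]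
      ring_nf
  have hzero : ∀ w ∈ ball z r, cross d (w - z) = 0 → w ∈ P.side k := by
    intro w hw hc
    obtain ⟨q, rfl, hq⟩ := hline w hc
    rw [mem_ball, hq] at hw
    rw [hside]
    have h1 : |q - t| < t := lt_of_mul_lt_mul_right (hw.trans_le hr2) hdn.le
    have h2 : |q - t| < 1 - t := lt_of_mul_lt_mul_right (hw.trans_le hr3) hdn.le
    rw [abs_lt] at h1 h2
    exact ⟨q, ⟨by linarith, by linarith⟩, rfl⟩
  have hbdc : ∀ w ∈ ball z r, w ∈ P.boundary → cross d (w - z) = 0 := by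
    intro w hw hwb
    rw [hbd] at hwb
    rcases hwb with h | h
    · rw [hside] at h
      obtain ⟨q, -, rfl⟩ := h
      have : P.vertex k + q * d - z = ((q - t : ℝ) : ℂ) * d := by
        rw [hz]; push_cast; ring
      simp only [this, cross_mul_right, cross_same, mul_zero]
    · exact absurd h (hball (ball_subset_ball hr1 hw))
  have hconvp : IsPreconnected (ball z r ∩ {w | cross d z < cross d w}) :=
    ((convex_ball z r).inter (convex_halfSpace_gt (isLinearMap_cross d) _)).isPreconnected
  have hconvm : IsPreconnected (ball z r ∩ {w | cross d w < cross d z}) :=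
    ((convex_ball z r).inter (convex_halfSpace_lt (isLinearMap_cross d) _)).isPreconnected
  -- The orientation supplies one inside point to the left of z, and the left half disc is connected
  -- and misses the boundary.
  have hpos : ∀ w ∈ ball z r, 0 < cross d (w - z) → w ∈ P.inside := by
    have hev := hP k t ht
    have hlim : Filter.Tendsto (fun ε : ℝ => z + ε * (Complex.I * d)) (nhdsWithin 0 (Ioi 0))
        (nhds z) := by
      have : Continuous (fun ε : ℝ => z + ε * (Complex.I * d)) := by fun_prop
      have h := this.tendsto 0
      simp only [Complex.ofReal_zero, zero_mul, add_zero] at h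
      exact h.mono_left nhdsWithin_le_nhds
    obtain ⟨ε, ⟨h1, h2⟩, h3⟩ := ((hev.and (hlim.eventually (ball_mem_nhds z hr))).and
      self_mem_nhdsWithin).exists
    have hlm : AffineMap.lineMap (P.vertex k) (P.vertex (k + 1)) t = z := by
      rw [AffineMap.lineMap_apply, hz, hd]
      simp [add_comm]
    rw [hlm, ← hd] at h1
    intro w hw hwc
    refine hconvp.mem_enclosedRegion ?_ ⟨h2, ?_⟩ ⟨hw, ?_⟩ h1
    · rw [Set.disjoint_left]
      rintro x ⟨hx, hxc⟩ hxb
      have := hbdc x hx hxb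
      rw [cross_sub_right] at this
      exact absurd hxc (by simp only [mem_ofPred_eq]; linarith)
    · simp only [mem_ofPred_eq, cross_add_right, cross_mul_right, cross_I_mul]
      have : 0 < ε * ‖d‖ ^ 2 := mul_pos h3 (by positivity)
      linarith
    · rw [cross_sub_right] at hwc
      simp only [mem_ofPred_eq]
      linarith
  refine ⟨r, hr, fun w hw => ⟨hpos w hw, ?_, hzero w hw, hbdc w hw⟩⟩
  -- If some point to the right were in the region, both half discs would be, hence the whole disc.
  -- Deleting a small piece of the side about z then leaves an arc R, and the exterior of P is open
  -- and closed relative to the connected complement of R. The exterior would therefore contain z,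
  -- which lies on the boundary.
  intro hwc hwreg
  have hmdisj : Disjoint (ball z r ∩ {w | cross d w < cross d z}) P.boundary := by
    rw [Set.disjoint_left]
    rintro x ⟨hx, hxc⟩ hxb
    have := hbdc x hx hxb
    rw [cross_sub_right] at this
    exact absurd hxc (by simp only [mem_ofPred_eq]; linarith)
  have hwin : w ∈ P.inside := by
    rcases hwreg with h | h
    · have := hbdc w hw h
      linarith
    · exact h
  have hall : ball z r ⊆ P.region := by
    intro o ho
    rcases lt_trichotomy (cross d (o - z)) 0 with h | h | h
    · refine Or.inr (hconvm.mem_enclosedRegion hmdisj ⟨hw, ?_⟩ ⟨ho, ?_⟩ hwin)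
      · rw [cross_sub_right] at hwc
        simp only [mem_ofPred_eq]
        linarith
      · rw [cross_sub_right] at h
        simp only [mem_ofPred_eq]
        linarith
    · exact Or.inl (side_subset_boundary k (hzero o ho h))
    · exact Or.inr (hpos o ho h)
  -- The gap with parameters in (t - δ, t + δ) must lie within the side and within the disc.
  obtain ⟨δ, hδ, hδ1, hδ2, hδ3⟩ : ∃ δ > 0, δ < t ∧ δ < 1 - t ∧ δ * ‖d‖ < r := by
    refine ⟨min (min (t / 2) ((1 - t) / 2)) (r / (2 * ‖d‖)), ?_, ?_, ?_, ?_⟩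
    · have h1 := ht.1
      have h2 : 0 < 1 - t := by linarith [ht.2]
      positivity
    · exact ((min_le_left _ _).trans (min_le_left _ _)).trans_lt (by linarith [ht.1])
    · exact ((min_le_left _ _).trans (min_le_right _ _)).trans_lt (by linarith [ht.2])
    · refine (mul_le_mul_of_nonneg_right (min_le_right _ _) hdn.le).trans_lt ?_
      rw [div_mul_eq_mul_div, div_lt_iff₀ (by positivity)]
      nlinarith
  set B := (fun r : ℝ => P.vertex k + r * d) '' Icc 0 (t - δ) with hB
  set C := (fun r : ℝ => P.vertex k + r * d) '' Icc (t + δ) 1 with hC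
  have hBarc : PolyArc B (P.vertex k) (P.vertex k + ((t - δ : ℝ) : ℂ) * d) := by
    have h := PolyArc.segment (P.vertex k + (0 : ℝ) * d) (P.vertex k + ((t - δ : ℝ) : ℂ) * d)
    rwa [segment_add_mul _ _ (by linarith), ← hk0] at h
  have hCarc : PolyArc C (P.vertex k + ((t + δ : ℝ) : ℂ) * d) (P.vertex (k + 1)) := by
    have h := PolyArc.segment (P.vertex k + ((t + δ : ℝ) : ℂ) * d) (P.vertex k + (1 : ℝ) * d)
    rwa [segment_add_mul _ _ (by linarith), ← hk1] at h
  have hBs : B ⊆ P.side k := by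
    rw [hside]
    exact image_mono (Icc_subset_Icc_right (by linarith))
  have hCs : C ⊆ P.side k := by
    rw [hside]
    exact image_mono (Icc_subset_Icc_left (by linarith [ht.1]))
  have hR1 : PolyArc (C ∪ A) (P.vertex k + ((t + δ : ℝ) : ℂ) * d) (P.vertex k) := by
    refine hCarc.trans hAarc (Subset.antisymm ?_ ?_)
    · rintro x ⟨h1, h2⟩
      rcases hsA x (hCs h1) h2 with h | h
      · obtain ⟨q, hq, rfl⟩ := h1
        rw [hk0] at h
        have := add_mul_injective hd0 (by simpa using h : P.vertex k + q * d = P.vertex k + (0 : ℝ) * d)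
        have := hq.1
        linarith [ht.1]
      · exact h
    · rintro _ rfl
      exact ⟨hCarc.right_mem, hAarc.left_mem⟩
  have hR : PolyArc (C ∪ A ∪ B) (P.vertex k + ((t + δ : ℝ) : ℂ) * d)
      (P.vertex k + ((t - δ : ℝ) : ℂ) * d) := by
    refine hR1.trans hBarc (Subset.antisymm ?_ ?_)
    · rintro x ⟨h1 | h1, h2⟩
      · obtain ⟨q, hq, rfl⟩ := h1
        obtain ⟨q', hq', h⟩ := h2
        have := add_mul_injective hd0 h
        linarith [hq.1, hq'.2]
      · rcases hsA x (hBs h2) h1 with h | h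
        · exact h
        · obtain ⟨q, hq, rfl⟩ := h2
          rw [hk1] at h
          have := add_mul_injective hd0 h
          linarith [hq.2, ht.2]
    · rintro _ rfl
      exact ⟨Or.inr hAarc.right_mem, hBarc.left_mem⟩
  have hRbd : C ∪ A ∪ B ⊆ P.boundary := by
    rw [hbd]
    exact union_subset (union_subset (hCs.trans subset_union_left) subset_union_right)
      (hBs.trans subset_union_left)
  have hzR : z ∉ C ∪ A ∪ B := by
    rintro ((h | h) | h)
    · obtain ⟨q, hq, h⟩ := h
      rw [hz] at h
      have := add_mul_injective hd0 h
      linarith [hq.1]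
    · exact hzA h
    · obtain ⟨q, hq, h⟩ := h
      rw [hz] at h
      have := add_mul_injective hd0 h
      linarith [hq.2]
  have hne : (P.regionᶜ).Nonempty := by
    rw [nonempty_iff_ne_empty]
    intro h
    refine not_isBounded_unenclosed (S := P.boundary) isCompact_boundary.isBounded ?_
    change Bornology.IsBounded P.regionᶜ
    rw [h]
    exact Bornology.isBounded_empty
  obtain ⟨o, ho⟩ := hne
  have := hR.isPreconnected_compl.subset_of_closure_inter_subset isOpen_compl_region
    ⟨o, fun h => ho (Or.inl (hRbd h)), ho⟩ ?_ hzR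
  · exact this (Or.inl (side_subset_boundary k hzs))
  · rintro y ⟨hy, hyR⟩ hyreg
    have hopen : ∃ W, IsOpen W ∧ y ∈ W ∧ W ⊆ P.region := by
      rcases hyreg with h | h
      · refine ⟨ball z r, isOpen_ball, ?_, hall⟩
        rw [hbd] at h
        rcases h with h | h
        · rw [hside] at h
          obtain ⟨q, hq, rfl⟩ := h
          have h1 : t - δ < q := by
            by_contra! hle
            exact hyR (Or.inr ⟨q, ⟨hq.1, hle⟩, rfl⟩)
          have h2 : q < t + δ := by
            by_contra! hle
            exact hyR (Or.inl (Or.inl ⟨q, ⟨hle, hq.2⟩, rfl⟩))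
          have h3 : P.vertex k + q * d - z = ((q - t : ℝ) : ℂ) * d := by
            rw [hz]; push_cast; ring
          simp only [mem_ball, dist_eq_norm, h3, norm_mul, Complex.norm_real, Real.norm_eq_abs]
          refine lt_of_le_of_lt (mul_le_mul_of_nonneg_right ?_ hdn.le) hδ3
          rw [abs_le]
          constructor <;> linarith
        · exact absurd (Or.inl (Or.inr h)) hyR
      · exact ⟨P.inside, isOpen_inside, h, subset_union_right⟩
    obtain ⟨W, hW, hyW, hWr⟩ := hopen
    obtain ⟨x, hxW, hx⟩ := mem_closure_iff.1 hy W hW hyW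
    exact hx (hWr hxW)

/-! ### Sets within a polygon -/

/-- The polygon has no holes: its exterior is connected, unbounded and disjoint from D, so D
encloses no point of it. -/
theorem enclosedRegion_subset_region {D : Set ℂ} (hD : D ⊆ P.region) :
    enclosedRegion D ⊆ P.region := by
  intro x hx
  by_contra hxr
  refine not_isBounded_unenclosed (S := P.boundary) isCompact_boundary.isBounded (hx.2.subset ?_)
  exact isPreconnected_compl_region.subset_connectedComponentIn hxr
    fun y hy hyD => hy (hD hyD)

/-- A closed set within a polygon does not enclose boundary points of the polygon. -/
theorem disjoint_boundary_enclosedRegion (hP : P.IsCounterclockwise) {D : Set ℂ}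
    (hDc : IsClosed D) (hD : D ⊆ P.region) : Disjoint P.boundary (enclosedRegion D) := by
  rw [Set.disjoint_left]
  intro y hy hyD
  obtain ⟨k, hk⟩ := mem_boundary.1 hy
  -- The enclosed region is open, so the boundary point may be moved to an inner point of its side
  -- and then pushed across the side, out of P. But nothing outside P is enclosed.
  obtain ⟨z, hzD, hz⟩ := mem_closure_iff.1 (segment_subset_closure_openSegment hk) _
    (isOpen_enclosedRegion hDc) hyD
  rw [openSegment_eq_image_lineMap] at hz
  obtain ⟨t, ht, rfl⟩ := hz
  set d := P.vertex (k + 1) - P.vertex k with hd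
  have hd0 : d ≠ 0 := sub_ne_zero.2 (vertex_ne k)
  have hz : AffineMap.lineMap (P.vertex k) (P.vertex (k + 1)) t = P.vertex k + t * d := by
    rw [AffineMap.lineMap_apply, hd]
    simp [add_comm]
  rw [hz] at hzD
  obtain ⟨r, hr, hball⟩ := exists_half_ball hP k ht hd rfl
  set z := P.vertex k + t * d with hz'
  obtain ⟨r', hr', hball'⟩ := Metric.isOpen_iff.1 (isOpen_enclosedRegion hDc) z hzD
  have hlim : Filter.Tendsto (fun ε : ℝ => z - ε * (Complex.I * d)) (nhdsWithin 0 (Ioi 0))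
      (nhds z) := by
    have : Continuous (fun ε : ℝ => z - ε * (Complex.I * d)) := by fun_prop
    have h := this.tendsto 0
    simp only [Complex.ofReal_zero, zero_mul, sub_zero] at h
    exact h.mono_left nhdsWithin_le_nhds
  obtain ⟨ε, ⟨h1, h2⟩, h3⟩ := (((hlim.eventually (ball_mem_nhds z hr)).and
    (hlim.eventually (ball_mem_nhds z hr'))).and self_mem_nhdsWithin).exists
  refine (hball _ h1).2.1 ?_ (enclosedRegion_subset_region hD (hball' h2))
  have : z - ε * (Complex.I * d) - z = ((-ε : ℝ) : ℂ) * (Complex.I * d) := by push_cast; ring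
  rw [this, cross_mul_right, cross_I_mul]
  have : 0 < ε * ‖d‖ ^ 2 := mul_pos h3 (by have := norm_pos_iff.2 hd0; positivity)
  linarith

/-- An arc within a polygon separates the two boundary paths between its endpoints. -/
theorem nonempty_inter_of_crossing (hP : P.IsCounterclockwise) {α₁ α₂ σ T : Set ℂ} {a b : ℂ}
    (h₁ : IsCompact α₁) (h₂ : IsCompact α₂) (hunion : α₁ ∪ α₂ = P.boundary)
    (hinter : α₁ ∩ α₂ ⊆ {a, b}) (hσ : PolyArc σ a b) (hσP : σ ⊆ P.region)
    (hT : IsPreconnected T) (hTP : T ⊆ P.region) {x y : ℂ} (hxT : x ∈ T) (hx : x ∈ α₁)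
    (hyT : y ∈ T) (hy : y ∈ α₂) : (T ∩ σ).Nonempty := by
  by_contra hempty
  have hTσ : ∀ z ∈ T, z ∉ σ := fun z hz hzσ => hempty ⟨z, hz, hzσ⟩
  have hα₁ : α₁ ⊆ P.boundary := hunion ▸ subset_union_left
  have hα₂ : α₂ ⊆ P.boundary := hunion ▸ subset_union_right
  -- The three arcs form a theta curve. Since σ does not separate the plane, the regions enclosed by
  -- α₁ ∪ σ and α₂ ∪ σ are disjoint. If T missed σ, it would be covered by the open sets of points
  -- unenclosed by one of these curves, and both sets would meet T.
  have hcap : (α₁ ∪ σ) ∩ (α₂ ∪ σ) = σ := by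
    rw [← inter_union_distrib_right, union_eq_right]
    intro z hz
    rcases hinter hz with rfl | rfl
    · exact hσ.left_mem
    · exact hσ.right_mem
  have hc₁ : IsCompact (α₁ ∪ σ) := h₁.union hσ.isCompact
  have hc₂ : IsCompact (α₂ ∪ σ) := h₂.union hσ.isCompact
  have hE₁ := disjoint_boundary_enclosedRegion hP hc₁.isClosed
    (union_subset (hα₁.trans boundary_subset_region) hσP)
  have hE₂ := disjoint_boundary_enclosedRegion hP hc₂.isClosed
    (union_subset (hα₂.trans boundary_subset_region) hσP)
  have hdis : Disjoint (enclosedRegion (α₁ ∪ σ)) (enclosedRegion (α₂ ∪ σ)) := by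
    refine disjoint_enclosedRegion hc₁.isClosed hc₂.isClosed hc₁.isBounded ?_ ?_ ?_
    · rw [Set.disjoint_left]
      rintro z (hz | hz) hze
      · exact hE₂.le_bot ⟨hα₁ hz, hze⟩
      · exact hze.1 (Or.inr hz)
    · rw [Set.disjoint_left]
      rintro z (hz | hz) hze
      · exact hE₁.le_bot ⟨hα₂ hz, hze⟩
      · exact hze.1 (Or.inr hz)
    · rw [hcap]
      exact hσ.isPreconnected_compl
  have hmem₁ : ∀ z ∈ T, z ∈ α₁ → z ∈ (α₂ ∪ σ ∪ enclosedRegion (α₂ ∪ σ))ᶜ := by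
    rintro z hzT hz ((h | h) | h)
    · rcases hinter ⟨hz, h⟩ with rfl | rfl
      · exact hTσ _ hzT hσ.left_mem
      · exact hTσ _ hzT hσ.right_mem
    · exact hTσ z hzT h
    · exact hE₂.le_bot ⟨hα₁ hz, h⟩
  have hmem₂ : ∀ z ∈ T, z ∈ α₂ → z ∈ (α₁ ∪ σ ∪ enclosedRegion (α₁ ∪ σ))ᶜ := by
    rintro z hzT hz ((h | h) | h)
    · rcases hinter ⟨h, hz⟩ with rfl | rfl
      · exact hTσ _ hzT hσ.left_mem
      · exact hTσ _ hzT hσ.right_mem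
    · exact hTσ z hzT h
    · exact hE₁.le_bot ⟨hα₂ hz, h⟩
  obtain ⟨z, hzT, hz1, hz2⟩ := hT _ _ (isOpen_unenclosed hc₂.isClosed)
    (isOpen_unenclosed hc₁.isClosed) (by
      intro z hz
      by_cases hzb : z ∈ P.boundary
      · rw [← hunion] at hzb
        rcases hzb with h | h
        · exact Or.inl (hmem₁ z hz h)
        · exact Or.inr (hmem₂ z hz h)
      · have hz1 : z ∉ α₁ ∪ σ := by
          rintro (h | h)
          · exact hzb (hα₁ h)
          · exact hTσ z hz h
        have hz2 : z ∉ α₂ ∪ σ := by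
          rintro (h | h)
          · exact hzb (hα₂ h)
          · exact hTσ z hz h
        by_cases hze : z ∈ enclosedRegion (α₁ ∪ σ)
        · left
          rintro (h | h)
          · exact hz2 h
          · exact hdis.le_bot ⟨hze, h⟩
        · right
          rintro (h | h)
          · exact hz1 h
          · exact hze h) ⟨x, hxT, hmem₁ x hxT hx⟩ ⟨y, hyT, hmem₂ y hyT hy⟩
  -- By connectedness some z in T is unenclosed by both curves. The two logarithms glue along σ to
  -- one on ∂P, which puts z outside P.
  have l1 := hasLog_of_notMem_enclosedRegion hc₁ (fun h => hz2 (Or.inl h)) (fun h => hz2 (Or.inr h))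
  have l2 := hasLog_of_notMem_enclosedRegion hc₂ (fun h => hz1 (Or.inl h)) (fun h => hz1 (Or.inr h))
  have hlog := l1.union l2 hc₁.isClosed hc₂.isClosed (by rw [hcap]; exact hσ.isPreconnected)
  have hlogP : HasLog P.boundary z := hlog.mono (by
    rw [← hunion]
    exact union_subset (subset_union_left.trans subset_union_left)
      (subset_union_left.trans subset_union_right))
  rcases hTP hzT with h | h
  · exact hlogP.notMem h
  · exact hlogP.notMem_enclosedRegion isCompact_boundary h

end SimplePolygon

/-! ### Triangles -/

/-- The closed triangle with vertices `v`, `v + p`, `v + q`. -/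
def tri (v p q : ℂ) : Set ℂ :=
  {z | ∃ s t : ℝ, 0 ≤ s ∧ 0 ≤ t ∧ s + t ≤ 1 ∧ z = v + s * p + t * q}

theorem mem_segment_add_iff {v p z : ℂ} :
    z ∈ segment ℝ v (v + p) ↔ ∃ s : ℝ, 0 ≤ s ∧ s ≤ 1 ∧ z = v + s * p := by
  rw [segment_eq_image_add_mul, add_sub_cancel_left]
  constructor
  · rintro ⟨s, ⟨h1, h2⟩, rfl⟩
    exact ⟨s, h1, h2, rfl⟩
  · rintro ⟨s, h1, h2, rfl⟩
    exact ⟨s, ⟨h1, h2⟩, rfl⟩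

theorem segment_subset_tri (v p q : ℂ) : segment ℝ (v + p) (v + q) ⊆ tri v p q := by
  rintro z ⟨α, β, hα, hβ, hab, rfl⟩
  refine ⟨α, β, hα, hβ, hab.le, ?_⟩
  have : (α : ℂ) + β = 1 := by exact_mod_cast hab
  simp only [Complex.real_smul]
  linear_combination v * this

theorem mul_add_mul_injective {p q : ℂ} (h : cross p q ≠ 0) {s t s' t' : ℝ}
    (heq : (s : ℂ) * p + t * q = s' * p + t' * q) : s = s' ∧ t = t' := by
  have h1 : cross p (s * p + t * q) = cross p (s' * p + t' * q) := by rw [heq]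
  have h2 : cross q (s * p + t * q) = cross q (s' * p + t' * q) := by rw [heq]
  simp only [cross_add_right, cross_mul_right, cross_same, cross_swap p q] at h1 h2
  constructor
  · refine mul_right_cancel₀ h ?_
    linarith
  · refine mul_right_cancel₀ h ?_
    linarith

/-- Scale two vectors at a point down into a prescribed ball. -/
theorem exists_shrink (v p q : ℂ) {r : ℝ} (hr : 0 < r) : ∃ ε : ℝ, 0 < ε ∧ ε ≤ 1 ∧
    segment ℝ v (v + ε * p) ⊆ segment ℝ v (v + p) ∩ ball v r ∧
    segment ℝ v (v + ε * q) ⊆ segment ℝ v (v + q) ∩ ball v r ∧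
    tri v (ε * p) (ε * q) ⊆ tri v p q ∩ ball v r := by
  have hden : 0 < ‖p‖ + ‖q‖ + 1 := by positivity
  obtain ⟨ε, hε0, hε1, hεr⟩ : ∃ ε : ℝ, 0 < ε ∧ ε ≤ 1 ∧ ε * (‖p‖ + ‖q‖) < r := by
    refine ⟨min 1 (r / (‖p‖ + ‖q‖ + 1)), by positivity, min_le_left _ _, ?_⟩
    have h1 : min 1 (r / (‖p‖ + ‖q‖ + 1)) * (‖p‖ + ‖q‖ + 1) ≤ r := by
      rw [← le_div_iff₀ hden]
      exact min_le_right _ _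
    have h2 : 0 < min 1 (r / (‖p‖ + ‖q‖ + 1)) := by positivity
    nlinarith
  have hball : ∀ s t : ℝ, 0 ≤ s → s ≤ 1 → 0 ≤ t → t ≤ 1 →
      v + s * (ε * p) + t * (ε * q) ∈ ball v r := by
    intro s t hs hs1 ht ht1
    rw [mem_ball, dist_eq_norm]
    have h1 : v + s * (ε * p) + t * (ε * q) - v = s * (ε * p) + t * (ε * q) := by ring
    rw [h1]
    refine (norm_add_le _ _).trans_lt (lt_of_le_of_lt ?_ hεr)
    simp only [norm_mul, Complex.norm_real, Real.norm_eq_abs, abs_of_pos hε0, abs_of_nonneg hs,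
      abs_of_nonneg ht]
    have h2 : s * (ε * ‖p‖) ≤ 1 * (ε * ‖p‖) := by gcongr
    have h3 : t * (ε * ‖q‖) ≤ 1 * (ε * ‖q‖) := by gcongr
    linarith
  refine ⟨ε, hε0, hε1, ?_, ?_, ?_⟩
  · intro z hz
    obtain ⟨s, h0, h1, rfl⟩ := mem_segment_add_iff.1 hz
    refine ⟨mem_segment_add_iff.2 ⟨s * ε, by positivity, mul_le_one₀ h1 hε0.le hε1, ?_⟩, ?_⟩
    · push_cast; ring
    · simpa using hball s 0 h0 h1 le_rfl zero_le_one
  · intro z hz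
    obtain ⟨s, h0, h1, rfl⟩ := mem_segment_add_iff.1 hz
    refine ⟨mem_segment_add_iff.2 ⟨s * ε, by positivity, mul_le_one₀ h1 hε0.le hε1, ?_⟩, ?_⟩
    · push_cast; ring
    · simpa using hball 0 s le_rfl zero_le_one h0 h1
  · rintro z ⟨s, t, hs, ht, hst, rfl⟩
    refine ⟨⟨s * ε, t * ε, by positivity, by positivity, ?_, ?_⟩,
      hball s t hs (by linarith) ht (by linarith)⟩
    · nlinarith
    · push_cast; ring

theorem cross_mul_mul (p q : ℂ) (ε : ℝ) : cross (ε * p) (ε * q) = ε ^ 2 * cross p q := by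
  rw [cross_mul_left, cross_mul_right]; ring

/-- The open triangle is enclosed by the sides of the triangle. -/
theorem mem_enclosedRegion_triangle {v p q : ℂ} (h : cross p q ≠ 0) {s t : ℝ} (hs : 0 < s)
    (ht : 0 < t) (hst : s + t < 1) : v + s * p + t * q ∈ enclosedRegion
      (segment ℝ v (v + p) ∪ segment ℝ v (v + q) ∪ segment ℝ (v + p) (v + q)) := by
  set T := segment ℝ v (v + p) ∪ segment ℝ v (v + q) ∪ segment ℝ (v + p) (v + q) with hT
  set σ : ℂ → ℝ := fun z => -cross q (z - v) / cross p q with hσ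
  set τ : ℂ → ℝ := fun z => cross p (z - v) / cross p q with hτ
  have hcoord : ∀ z, z = v + σ z * p + τ z * q := by
    intro z
    have := exists_coord_of_cross_ne_zero h (z - v)
    rw [cross_swap q (z - v)] at this
    linear_combination this
  have hσc : Continuous σ :=
    (((continuous_cross_right q).comp (continuous_id.sub continuous_const)).neg).div_const _
  have hτc : Continuous τ :=
    ((continuous_cross_right p).comp (continuous_id.sub continuous_const)).div_const _
  have hσv : ∀ s t : ℝ, σ (v + s * p + t * q) = s ∧ τ (v + s * p + t * q) = t := by
    intro s t
    have := hcoord (v + s * p + t * q)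
    exact mul_add_mul_injective h (by linear_combination -this)
  -- Δ is the open triangle in the coordinates σ, τ. A limit point of Δ outside Δ lies on a side, so
  -- the component of a point of Δ off the sides cannot leave Δ.
  set Δ : Set ℂ := {z | 0 < σ z ∧ 0 < τ z ∧ σ z + τ z < 1} with hΔ
  have hΔo : IsOpen Δ := (isOpen_lt continuous_const hσc).inter
    ((isOpen_lt continuous_const hτc).inter (isOpen_lt (hσc.add hτc) continuous_const))
  have hcl : closure Δ ⊆ {z | 0 ≤ σ z ∧ 0 ≤ τ z ∧ σ z + τ z ≤ 1} := by
    refine closure_minimal (fun z hz => ⟨hz.1.le, hz.2.1.le, hz.2.2.le⟩) ?_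
    exact (isClosed_le continuous_const hσc).inter
      ((isClosed_le continuous_const hτc).inter (isClosed_le (hσc.add hτc) continuous_const))
  have hx : v + s * p + t * q ∈ Δ := by
    obtain ⟨h1, h2⟩ := hσv s t
    exact ⟨by rw [h1]; exact hs, by rw [h2]; exact ht, by rw [h1, h2]; exact hst⟩
  have hΔT : ∀ z ∈ T, z ∉ Δ := by
    rintro z ((hz | hz) | hz) ⟨h1, h2, h3⟩
    · obtain ⟨a, -, -, rfl⟩ := mem_segment_add_iff.1 hz
      have := (hσv a 0).2
      simp only [Complex.ofReal_zero, zero_mul, add_zero] at this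
      linarith
    · obtain ⟨a, -, -, rfl⟩ := mem_segment_add_iff.1 hz
      have := (hσv 0 a).1
      simp only [Complex.ofReal_zero, zero_mul, add_zero] at this
      linarith
    · obtain ⟨α, β, -, -, hab, rfl⟩ := hz
      have he : α • (v + p) + β • (v + q) = v + α * p + β * q := by
        have : (α : ℂ) + β = 1 := by exact_mod_cast hab
        simp only [Complex.real_smul]
        linear_combination v * this
      obtain ⟨h4, h5⟩ := hσv α β
      rw [he, h4, h5] at h3
      linarith
  have hsub : connectedComponentIn Tᶜ (v + s * p + t * q) ⊆ Δ := by
    have hxT : v + s * p + t * q ∈ Tᶜ := fun h => hΔT _ h hx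
    refine isPreconnected_connectedComponentIn.subset_of_closure_inter_subset hΔo
      ⟨_, mem_connectedComponentIn hxT, hx⟩ ?_
    rintro z ⟨hz1, hz2⟩
    have hzT : z ∉ T := connectedComponentIn_subset _ _ hz2
    obtain ⟨h1, h2, h3⟩ := hcl hz1
    refine ⟨lt_of_le_of_ne h1 fun h => hzT ?_, lt_of_le_of_ne h2 fun h => hzT ?_,
      lt_of_le_of_ne h3 fun h => hzT ?_⟩
    · refine Or.inl (Or.inr (mem_segment_add_iff.2 ⟨τ z, h2, by linarith, ?_⟩))
      have := hcoord z
      rw [← h] at this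
      simpa using this
    · refine Or.inl (Or.inl (mem_segment_add_iff.2 ⟨σ z, h1, by linarith, ?_⟩))
      have := hcoord z
      rw [← h] at this
      simpa using this
    · refine Or.inr ⟨σ z, τ z, h1, h2, h, ?_⟩
      have h4 := hcoord z
      have h5 : (σ z : ℂ) + τ z = 1 := by exact_mod_cast h
      simp only [Complex.real_smul]
      linear_combination v * h5 - h4
  refine ⟨fun h => hΔT _ h hx, (Metric.isBounded_ball (x := v) (r := ‖p‖ + ‖q‖ + 1)).subset
    (hsub.trans ?_)⟩
  rintro z ⟨h1, h2, h3⟩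
  rw [mem_ball, dist_eq_norm, hcoord z]
  have h4 : v + σ z * p + τ z * q - v = σ z * p + τ z * q := by ring
  rw [h4]
  refine (norm_add_le _ _).trans_lt ?_
  simp only [norm_mul, Complex.norm_real, Real.norm_eq_abs, abs_of_pos h1, abs_of_pos h2]
  have h5 : σ z * ‖p‖ ≤ 1 * ‖p‖ := by gcongr; linarith
  have h6 : τ z * ‖q‖ ≤ 1 * ‖q‖ := by gcongr; linarith
  linarith

/-! ### Taut sets -/

/-- A subset `S` of `K` is taut if no corner of `S` can be cut off within `K`. -/
def Taut (K S : Set ℂ) : Prop :=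
  ∀ v p q, segment ℝ v (v + p) ⊆ S → segment ℝ v (v + q) ⊆ S → tri v p q ⊆ K → cross p q = 0

theorem Taut.mono {K S T : Set ℂ} (h : Taut K T) (hST : S ⊆ T) : Taut K S :=
  fun v p q hp hq => h v p q (hp.trans hST) (hq.trans hST)

/-- Tautness is local, since a corner can be shrunk towards its apex without changing the sign of
its area. -/
theorem Taut.of_eventually {K S : Set ℂ} (h : ∀ v ∈ S, ∃ T r, 0 < r ∧ S ∩ ball v r ⊆ T ∧ Taut K T) :
    Taut K S := by
  intro v p q hp hq htri
  obtain ⟨T, r, hr, hT, htaut⟩ := h v (hp (left_mem_segment ℝ _ _))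
  obtain ⟨ε, hε, -, h1, h2, h3⟩ := exists_shrink v p q hr
  have := htaut v _ _ (fun z hz => hT ⟨hp (h1 hz).1, (h1 hz).2⟩)
    (fun z hz => hT ⟨hq (h2 hz).1, (h2 hz).2⟩) (fun z hz => htri (h3 hz).1)
  rw [cross_mul_mul] at this
  exact (mul_eq_zero.1 this).resolve_left (by positivity)

/-- As A and C are disjoint closed sets, near each point at most one of them is present. -/
theorem Taut.union {K A M C : Set ℂ} (hA : IsClosed A) (hC : IsClosed C) (hAC : Disjoint A C)
    (h1 : Taut K (A ∪ M)) (h2 : Taut K (M ∪ C)) : Taut K (A ∪ M ∪ C) := by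
  refine Taut.of_eventually fun v _ => ?_
  by_cases hv : v ∈ C
  · obtain ⟨r, hr, hball⟩ := Metric.isOpen_iff.1 hA.isOpen_compl v
      fun h => hAC.le_bot ⟨h, hv⟩
    refine ⟨M ∪ C, r, hr, ?_, h2⟩
    rintro z ⟨(hz | hz) | hz, hzb⟩
    · exact absurd hz (hball hzb)
    · exact Or.inl hz
    · exact Or.inr hz
  · obtain ⟨r, hr, hball⟩ := Metric.isOpen_iff.1 hC.isOpen_compl v hv
    refine ⟨A ∪ M, r, hr, ?_, h1⟩
    rintro z ⟨hz | hz, hzb⟩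
    · exact hz
    · exact absurd hz (hball hzb)

theorem PolySplit.exists_middle {S S₁ S₂ : Set ℂ} {a b u w : ℂ} (hs : PolySplit S₁ S₂ S a u b)
    (hw : w ∈ S₂) : ∃ N S₃, PolyArc N u w ∧ N ⊆ S ∧ PolyArc S₃ w b ∧ S₃ ⊆ S ∧
      arcLength S = arcLength S₁ + arcLength N + arcLength S₃ := by
  obtain ⟨N, S₃, ht⟩ := hs.right.exists_split hw
  refine ⟨N, S₃, ht.left, ht.subset_left.trans hs.subset_right, ht.right,
    ht.subset_right.trans hs.subset_right, ?_⟩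
  rw [← hs.union, arcLength_union hs.left hs.right hs.inter, ← ht.union,
    arcLength_union ht.left ht.right ht.inter, add_assoc]

/-- A shortest path is taut. -/
theorem PolyChain.IsShortest.taut {γ : PolyChain} {K : Set ℂ} {a b : ℂ}
    (h : γ.IsShortest K a b) : Taut K γ.carrier := by
  obtain ⟨harc, hlen⟩ := h.polyArc
  intro v p q hp hq htri
  by_contra hcr
  have hint : segment ℝ (v + p) v ∩ segment ℝ v (v + q) = {v} := by
    refine Subset.antisymm ?_ ?_
    · rintro z ⟨h1, h2⟩
      rw [segment_symm] at h1
      obtain ⟨s, -, -, rfl⟩ := mem_segment_add_iff.1 h1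
      obtain ⟨t, -, -, h3⟩ := mem_segment_add_iff.1 h2
      have := (mul_add_mul_injective hcr (s := s) (t := 0) (s' := 0) (t' := t) (by
        push_cast; linear_combination h3)).1
      simp [this]
    · rintro _ rfl
      exact ⟨right_mem_segment ℝ _ _, left_mem_segment ℝ _ _⟩
  -- The two legs form an arc. By uniqueness of subarcs it is the stretch of the path between v + p
  -- and v + q, so it may be replaced by the third side of the triangle, which lies in K.
  have hT := (PolyArc.segment (v + p) v).trans (PolyArc.segment v (v + q)) hint
  have hTS : segment ℝ (v + p) v ∪ segment ℝ v (v + q) ⊆ γ.carrier :=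
    union_subset (by rw [segment_symm]; exact hp) hq
  have hTl := arcLength_union (PolyArc.segment (v + p) v) (PolyArc.segment v (v + q)) hint
  rw [arcLength_segment, arcLength_segment] at hTl
  have key : ∀ {X Y : Set ℂ} {e f : ℂ}, PolyArc X a e → X ⊆ γ.carrier → PolyArc Y f b →
      Y ⊆ γ.carrier → segment ℝ e f ⊆ K → arcLength γ.carrier ≤ arcLength X + dist e f + arcLength Y := by
    intro X Y e f hX hXS hY hYS hef
    obtain ⟨γ₁, -, g1, g2, g3, g4⟩ := hX.exists_polyChain
    obtain ⟨γ₂, -, g5, g6, g7, g8⟩ := (PolyArc.segment e f).exists_polyChain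
    obtain ⟨γ₃, -, g9, g10, g11, g12⟩ := hY.exists_polyChain
    obtain ⟨δ, d1, d2, d3, d4⟩ := γ₁.exists_append γ₂ (by rw [g2, g5])
    obtain ⟨δ', e1, e2, e3, e4⟩ := δ.exists_append γ₃ (by rw [d2, g6, g9])
    have := h.minimal δ' (by rw [e1, d1, g1]) (by rw [e2, g10]) (by
      rw [e3, d3, g3, g7, g11]
      exact union_subset (union_subset (hXS.trans h.subset) hef) (hYS.trans h.subset))
    rw [e4, d4, g4, g8, g12, arcLength_segment] at this
    linarith
  have hsegK := (segment_subset_tri v p q).trans htri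
  have hle : dist (v + p) v + dist v (v + q) ≤ dist (v + p) (v + q) := by
    obtain ⟨S₁, S₂, hs⟩ := harc.exists_split (hp (right_mem_segment ℝ _ _))
    rcases (hs.union ▸ hq (right_mem_segment ℝ _ _) : v + q ∈ S₁ ∪ S₂) with hw | hw
    · obtain ⟨N, S₃, n1, n2, n3, n4, n5⟩ := hs.symm.exists_middle hw
      obtain rfl := harc.subarc_unique n1 n2 hT hTS
      have := key n3.symm n4 hs.right hs.subset_right (by rw [segment_symm]; exact hsegK)
      rw [dist_comm (v + q)] at this
      linarith
    · obtain ⟨N, S₃, n1, n2, n3, n4, n5⟩ := hs.exists_middle hw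
      obtain rfl := harc.subarc_unique n1 n2 hT hTS
      have := key hs.left hs.subset_left n3 n4 hsegK
      linarith
  -- Minimality forces equality in the triangle inequality, so v would lie on the third side of a
  -- nondegenerate triangle.
  have hw := dist_add_dist_eq_iff.1 (le_antisymm hle (dist_triangle _ _ _))
  rw [← mem_segment_iff_wbtw] at hw
  obtain ⟨α, β, hα, hβ, hab, hv⟩ := hw
  have hsum : (α : ℂ) + β = 1 := by exact_mod_cast hab
  simp only [Complex.real_smul] at hv
  obtain ⟨h1, h2⟩ := mul_add_mul_injective hcr (s := α) (t := β) (s' := 0) (t' := 0) (by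
    push_cast; linear_combination hv - v * hsum)
  linarith

/-! ### Uniqueness of taut arcs -/

/-- If both arcs lay on the line through a and b, each would contain the midpoint of ab by the
intermediate value theorem. -/
theorem exists_cross_ne_zero {S T : Set ℂ} {a b : ℂ} (hS : PolyArc S a b) (hT : PolyArc T a b)
    (hab : a ≠ b) (h : S ∩ T = {a, b}) : ∃ y ∈ S ∪ T, cross (b - a) (y - a) ≠ 0 := by
  by_contra! hcon
  have hd : b - a ≠ 0 := sub_ne_zero.2 hab.symm
  have key : ∀ {W : Set ℂ}, PolyArc W a b → W ⊆ S ∪ T → midpoint ℝ a b ∈ W := by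
    intro W hW hWs
    obtain ⟨z, hz, hz2⟩ := hW.isPreconnected.intermediate_value hW.left_mem hW.right_mem
      (f := fun z => ((z - a) / (b - a)).re) (by fun_prop)
      (show (1 / 2 : ℝ) ∈ _ by
        simp only [sub_self, zero_div, Complex.zero_re, div_self hd, Complex.one_re]
        constructor <;> norm_num)
    obtain ⟨t, ht⟩ := exists_eq_mul_of_cross_eq_zero hd (hcon z (hWs hz))
    simp only [ht, mul_div_assoc, div_self hd, mul_one, Complex.ofReal_re] at hz2
    have : midpoint ℝ a b = z := by
      rw [midpoint_eq_smul_add]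
      simp only [Complex.real_smul]
      rw [hz2] at ht
      push_cast at ht ⊢
      norm_num at ht ⊢
      linear_combination -ht
    rwa [this]
  have : midpoint ℝ a b ∈ ({a, b} : Set ℂ) :=
    h ▸ ⟨key hS subset_union_left, key hT subset_union_right⟩
  rcases this with h1 | h1
  · exact hab ((midpoint_eq_left_iff ℝ).1 h1)
  · exact hab ((midpoint_eq_right_iff ℝ).1 h1)

/-- Around the point of a closed curve which is farthest from some centre, the curve can be cut
short within the region it encloses. -/
theorem not_taut_of_isMaxOn {S T K : Set ℂ} {a b v o : ℂ} (hS : PolyArc S a b) (hT : PolyArc T a b)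
    (h : S ∩ T = {a, b}) (hK : enclosedRegion (S ∪ T) ⊆ K) (hSK : S ⊆ K) (htaut : Taut K S)
    (hv : v ∈ S) (hva : v ≠ a) (hvb : v ≠ b) (hmax : ∀ z ∈ S ∪ T, dist z o ≤ dist v o) : False := by
  have hvT : v ∉ T := by
    intro hvT
    have : v ∈ ({a, b} : Set ℂ) := h ▸ ⟨hv, hvT⟩
    rcases this with h1 | h1
    · exact hva h1
    · exact hvb h1
  obtain ⟨S₁, S₂, hs⟩ := hS.exists_split hv
  obtain ⟨c₁, hc₁, hc₁S, r₁, hr₁, hball₁⟩ := hs.left.symm.exists_germ hva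
  obtain ⟨c₂, hc₂, hc₂S, r₂, hr₂, hball₂⟩ := hs.right.exists_germ hvb
  obtain ⟨r₃, hr₃, hball₃⟩ := Metric.isOpen_iff.1 hT.isClosed.isOpen_compl v hvT
  -- the linear functional in the direction of `v - o`
  set e := v - o with he
  set G : ℂ → ℝ := fun p => p.re * e.re + p.im * e.im with hG
  have hGadd : ∀ (s t : ℝ) (p q : ℂ), G (s * p + t * q) = s * G p + t * G q := by
    intro s t p q
    simp [hG]; ring
  -- The curve lies in the closed disc about o through v, hence apart from v strictly on the inner
  -- side of the tangent at v.
  have hGneg : ∀ z ∈ S ∪ T, z ≠ v → G (z - v) < 0 := by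
    intro z hz hzv
    have h1 := hmax z hz
    rw [dist_eq_norm, dist_eq_norm] at h1
    have h2 : ‖z - o‖ ^ 2 ≤ ‖v - o‖ ^ 2 := by gcongr
    have h3 : 0 < ‖z - v‖ ^ 2 := by have := norm_pos_iff.2 (sub_ne_zero.2 hzv); positivity
    rw [Complex.sq_norm, Complex.normSq_apply] at h2 h3
    rw [Complex.sq_norm, Complex.normSq_apply] at h2
    simp only [hG, he, Complex.sub_re, Complex.sub_im] at *
    nlinarith
  set p₀ := c₁ - v with hp₀
  set q₀ := c₂ - v with hq₀
  have hc₁' : c₁ = v + p₀ := by rw [hp₀]; ring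
  have hc₂' : c₂ = v + q₀ := by rw [hq₀]; ring
  have hp₀0 : p₀ ≠ 0 := sub_ne_zero.2 hc₁
  have hGp₀ : G p₀ < 0 :=
    hGneg c₁ (Or.inl (hs.subset_left (hc₁S (right_mem_segment ℝ _ _)))) hc₁
  have hGq₀ : G q₀ < 0 :=
    hGneg c₂ (Or.inl (hs.subset_right (hc₂S (right_mem_segment ℝ _ _)))) hc₂
  -- Both germs point to the inner side of the tangent. If parallel they would have the same
  -- direction, and the two parts of S would overlap.
  have hcr₀ : cross p₀ q₀ ≠ 0 := by
    intro hcr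
    obtain ⟨t, ht⟩ := exists_eq_mul_of_cross_eq_zero hp₀0 hcr
    have hGt : G q₀ = t * G p₀ := by
      have := hGadd t 0 p₀ 0
      rw [ht]
      simpa using this
    have ht0 : 0 < t := by
      by_contra! hle
      nlinarith
    have hmem : v + (min 1 t : ℝ) * p₀ ∈ S₁ ∩ S₂ := by
      constructor
      · refine hc₁S ?_
        rw [hc₁']
        exact mem_segment_add_iff.2 ⟨min 1 t, by positivity, min_le_left _ _, rfl⟩
      · refine hc₂S ?_
        rw [hc₂']
        refine mem_segment_add_iff.2 ⟨min 1 t / t, by positivity, ?_, ?_⟩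
        · rw [div_le_one ht0]
          exact min_le_right _ _
        · have : (t : ℂ) ≠ 0 := Complex.ofReal_ne_zero.2 ht0.ne'
          rw [ht]
          push_cast
          field_simp
    have h1 := hs.eq_of_mem hmem.1 hmem.2
    have h2 : ((min 1 t : ℝ) : ℂ) * p₀ = 0 := by linear_combination h1
    rcases mul_eq_zero.1 h2 with h3 | h3
    · have : 0 < min 1 t := by positivity
      exact this.ne' (Complex.ofReal_eq_zero.1 h3)
    · exact hp₀0 h3
  obtain ⟨ε, hε, -, hs1, hs2, hs3⟩ := exists_shrink v p₀ q₀ (lt_min hr₁ (lt_min hr₂ hr₃))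
  set p := (ε : ℂ) * p₀ with hp
  set q := (ε : ℂ) * q₀ with hq
  have hcr : cross p q ≠ 0 := by
    rw [hp, hq, cross_mul_mul]
    positivity
  have hGp : G p < 0 := by
    have := hGadd ε 0 p₀ 0
    simp only [Complex.ofReal_zero, zero_mul, add_zero] at this
    rw [hp, this]
    nlinarith
  have hGq : G q < 0 := by
    have := hGadd ε 0 q₀ 0
    simp only [Complex.ofReal_zero, zero_mul, add_zero] at this
    rw [hq, this]
    nlinarith
  have hupS : segment ℝ v (v + p) ⊆ S₁ := by
    intro z hz
    refine hc₁S ?_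
    rw [hc₁']
    exact (hs1 hz).1
  have huqS : segment ℝ v (v + q) ⊆ S₂ := by
    intro z hz
    refine hc₂S ?_
    rw [hc₂']
    exact (hs2 hz).1
  -- near `v`, the curve consists of the two legs of the triangle
  have hlegs : ∀ s t : ℝ, 0 ≤ s → 0 ≤ t → s + t ≤ 1 → v + s * p + t * q ∈ S ∪ T →
      (v + s * p + t * q ∈ S₁ ∧ t = 0) ∨ (v + s * p + t * q ∈ S₂ ∧ s = 0) := by
    intro s t hs0 ht0 hst hmem
    have hb := (hs3 ⟨s, t, hs0, ht0, hst, rfl⟩).2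
    rw [← hs.union] at hmem
    rcases hmem with (hm | hm) | hm
    · left
      refine ⟨hm, ?_⟩
      have := hball₁ ⟨ball_subset_ball (min_le_left _ _) hb, hm⟩
      rw [hc₁'] at this
      obtain ⟨s', -, -, h'⟩ := mem_segment_add_iff.1 this
      have := (mul_add_mul_injective hcr₀ (s := s * ε) (t := t * ε) (s' := s') (t' := 0) (by
        push_cast; linear_combination h')).2
      exact (mul_eq_zero.1 this).resolve_right hε.ne'
    · right
      refine ⟨hm, ?_⟩
      have := hball₂ ⟨ball_subset_ball ((min_le_right _ _).trans (min_le_left _ _)) hb, hm⟩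
      rw [hc₂'] at this
      obtain ⟨s', -, -, h'⟩ := mem_segment_add_iff.1 this
      have := (mul_add_mul_injective hcr₀ (s := s * ε) (t := t * ε) (s' := 0) (t' := s') (by
        push_cast; linear_combination h')).1
      exact (mul_eq_zero.1 this).resolve_right hε.ne'
    · exact absurd hm (hball₃ (ball_subset_ball ((min_le_right _ _).trans (min_le_right _ _)) hb))
  -- the rest of the curve
  obtain ⟨A, A', hA⟩ := hs.left.exists_split (hupS (right_mem_segment ℝ _ _))
  obtain rfl := hA.eq_right (PolyArc.segment (v + p) v) (by rw [segment_symm]; exact hupS)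
  obtain ⟨C', C, hC⟩ := hs.right.exists_split (huqS (right_mem_segment ℝ _ _))
  obtain rfl := hC.eq_left (PolyArc.segment v (v + q)) huqS
  set R := A ∪ T ∪ C with hR
  have hRc : IsCompact R := (hA.left.isCompact.union hT.isCompact).union hC.right.isCompact
  have hRconn : IsPreconnected R := by
    refine IsPreconnected.union b (Or.inr hT.right_mem) hC.right.right_mem ?_
      hC.right.isPreconnected
    exact IsPreconnected.union a hA.left.left_mem hT.left_mem hA.left.isPreconnected
      hT.isPreconnected
  have hRS : R ⊆ S ∪ T := by
    refine union_subset (union_subset ?_ subset_union_right) ?_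
    · exact (hA.subset_left.trans hs.subset_left).trans subset_union_left
    · exact (hC.subset_right.trans hs.subset_right).trans subset_union_left
  have hST : S ∪ T = R ∪ (segment ℝ (v + p) v ∪ segment ℝ v (v + q)) := by
    rw [hR, ← hs.union, ← hA.union, ← hC.union]
    ext z
    simp only [mem_union]
    tauto
  have hRtri : ∀ s t : ℝ, 0 ≤ s → 0 ≤ t → s + t ≤ 1 → v + s * p + t * q ∈ R → s + t = 1 := by
    intro s t hs0 ht0 hst hmem
    rcases hlegs s t hs0 ht0 hst (hRS hmem) with ⟨h1, rfl⟩ | ⟨h1, rfl⟩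
    · have hseg : v + s * p + (0 : ℝ) * q ∈ segment ℝ (v + p) v := by
        rw [segment_symm]
        exact mem_segment_add_iff.2 ⟨s, hs0, by linarith, by push_cast; ring⟩
      have hA' : v + s * p + (0 : ℝ) * q = v + p ∨ v + s * p + (0 : ℝ) * q = v := by
        rcases hmem with (hm | hm) | hm
        · exact Or.inl (hA.eq_of_mem hm hseg)
        · exfalso
          have hb := (hs3 ⟨s, 0, hs0, le_rfl, hst, rfl⟩).2
          exact hball₃ (ball_subset_ball ((min_le_right _ _).trans (min_le_right _ _)) hb) hm
        · exact Or.inr (hs.eq_of_mem h1 (hC.subset_right hm))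
      rcases hA' with h2 | h2
      · have := (mul_add_mul_injective hcr (s := s) (t := 0) (s' := 1) (t' := 0) (by
          push_cast at h2 ⊢; linear_combination h2)).1
        linarith
      · rw [h2] at hmem
        exfalso
        rcases hmem with (hm | hm) | hm
        · have h3 := hA.eq_of_mem hm (right_mem_segment ℝ _ _)
          have h4 : p = 0 := by linear_combination -h3
          rw [h4] at hGp
          simp [hG] at hGp
        · exact hvT hm
        · have h3 := hC.eq_of_mem (left_mem_segment ℝ _ _) hm
          have h4 : q = 0 := by linear_combination -h3
          rw [h4] at hGq
          simp [hG] at hGq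
    · have hseg : v + (0 : ℝ) * p + t * q ∈ segment ℝ v (v + q) :=
        mem_segment_add_iff.2 ⟨t, ht0, by linarith, by push_cast; ring⟩
      have hA' : v + (0 : ℝ) * p + t * q = v + q ∨ v + (0 : ℝ) * p + t * q = v := by
        rcases hmem with (hm | hm) | hm
        · exact Or.inr (hs.eq_of_mem (hA.subset_left hm) h1)
        · exfalso
          have hb := (hs3 ⟨0, t, le_rfl, ht0, hst, rfl⟩).2
          exact hball₃ (ball_subset_ball ((min_le_right _ _).trans (min_le_right _ _)) hb) hm
        · exact Or.inl (hC.eq_of_mem hseg hm)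
      rcases hA' with h2 | h2
      · have := (mul_add_mul_injective hcr (s := 0) (t := t) (s' := 0) (t' := 1) (by
          push_cast at h2 ⊢; linear_combination h2)).2
        linarith
      · rw [h2] at hmem
        exfalso
        rcases hmem with (hm | hm) | hm
        · have h3 := hA.eq_of_mem hm (right_mem_segment ℝ _ _)
          have h4 : p = 0 := by linear_combination -h3
          rw [h4] at hGp
          simp [hG] at hGp
        · exact hvT hm
        · have h3 := hC.eq_of_mem (left_mem_segment ℝ _ _) hm
          have h4 : q = 0 := by linear_combination -h3
          rw [h4] at hGq
          simp [hG] at hGq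
  have hRG : ∀ z ∈ R ∪ segment ℝ (v + p) (v + q), G (z - v) ≤ 0 := by
    rintro z (hz | hz)
    · by_cases hzv : z = v
      · simp [hzv, hG]
      · exact (hGneg z (hRS hz) hzv).le
    · obtain ⟨α, β, hα, hβ, hab, rfl⟩ := hz
      have hsum : (α : ℂ) + β = 1 := by exact_mod_cast hab
      have : α • (v + p) + β • (v + q) - v = α * p + β * q := by
        simp only [Complex.real_smul]
        linear_combination v * hsum
      rw [this, hGadd]
      nlinarith
  have hopen : ∀ s t : ℝ, 0 < s → 0 < t → s + t < 1 →
      v + s * p + t * q ∈ enclosedRegion (S ∪ T) := by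
    intro s t hs0 ht0 hst
    have hSTc : IsCompact (S ∪ T) := hS.isCompact.union hT.isCompact
    have hnot : v + s * p + t * q ∉ S ∪ T := by
      intro hm
      rcases hlegs s t hs0.le ht0.le hst.le hm with h1 | h1
      · exact ht0.ne' h1.2
      · exact hs0.ne' h1.2
    rw [mem_enclosedRegion_iff hSTc hnot]
    intro hlog
    have hRsc : IsCompact (R ∪ segment ℝ (v + p) (v + q)) := hRc.union (isCompact_segment' _ _)
    -- This is the ray from the given point of the triangle through v to infinity. It misses R and
    -- the third side, so R with the third side does not enclose the point. If the curve did not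
    -- either, the two logarithms would glue along the connected set R and restrict to the sides of
    -- the triangle, which do enclose the point.
    set C₀ : Set ℂ := (fun l : ℝ => v + l * (s * p + t * q)) '' Iic 1 with hC₀
    have hC₀c : IsPreconnected C₀ := isPreconnected_Iic.image _ (by fun_prop)
    have hxC : v + s * p + t * q ∈ C₀ := ⟨1, mem_Iic.2 le_rfl, by push_cast; ring⟩
    have hdisj : Disjoint C₀ (R ∪ segment ℝ (v + p) (v + q)) := by
      rw [Set.disjoint_left]
      rintro _ ⟨l, hl, rfl⟩ hmem
      have hl1 : l ≤ 1 := hl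
      have heq : v + l * (s * p + t * q) = v + ((l * s : ℝ) : ℂ) * p + ((l * t : ℝ) : ℂ) * q := by
        push_cast; ring
      rcases lt_or_ge l 0 with hneg | hpos
      · have h1 := hRG _ hmem
        simp only [add_sub_cancel_left] at h1
        have h2 := hGadd (l * s) (l * t) p q
        have h3 : ((l * s : ℝ) : ℂ) * p + ((l * t : ℝ) : ℂ) * q = l * (s * p + t * q) := by
          push_cast; ring
        rw [h3] at h2
        rw [h2] at h1
        nlinarith [mul_pos (mul_pos (neg_pos.2 hneg) hs0) (neg_pos.2 hGp),
          mul_pos (mul_pos (neg_pos.2 hneg) ht0) (neg_pos.2 hGq)]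
      · have hlt : l * s + l * t < 1 := by nlinarith
        simp only [heq] at hmem
        rcases hmem with hm | hm
        · have := hRtri _ _ (mul_nonneg hpos hs0.le) (mul_nonneg hpos ht0.le) hlt.le hm
          linarith
        · obtain ⟨α, β, hα, hβ, hab, hm⟩ := hm
          have hsum : (α : ℂ) + β = 1 := by exact_mod_cast hab
          simp only [Complex.real_smul] at hm
          obtain ⟨h1, h2⟩ := mul_add_mul_injective hcr (s := α) (t := β) (s' := l * s)
            (t' := l * t) (by linear_combination hm - v * hsum)
          linarith
    have hlogR : HasLog (R ∪ segment ℝ (v + p) (v + q)) (v + s * p + t * q) := by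
      refine hasLog_of_notMem_enclosedRegion hRsc
        (fun hm => hdisj.le_bot ⟨hxC, hm⟩) fun henc => ?_
      have hsub : C₀ ⊆ connectedComponentIn (R ∪ segment ℝ (v + p) (v + q))ᶜ (v + s * p + t * q) :=
        hC₀c.subset_connectedComponentIn hxC fun z hz hzR => hdisj.le_bot ⟨hz, hzR⟩
      obtain ⟨ρ, hρ⟩ := ((henc.2.subset hsub)).exists_norm_le
      have hw0 : (s : ℂ) * p + t * q ≠ 0 := by
        intro h0
        have := (mul_add_mul_injective hcr (s := s) (t := t) (s' := 0) (t' := 0) (by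
          push_cast; linear_combination h0)).1
        linarith
      have hwn := norm_pos_iff.2 hw0
      set m : ℝ := (‖v‖ + |ρ| + 1) / ‖(s : ℂ) * p + t * q‖ with hm
      have hm0 : 0 < m := by positivity
      have h1 := hρ (v + ((-m : ℝ) : ℂ) * (s * p + t * q)) ⟨-m, mem_Iic.2 (by linarith), rfl⟩
      have h2 : ‖((-m : ℝ) : ℂ) * (s * p + t * q)‖ = ‖v‖ + |ρ| + 1 := by
        rw [norm_mul, Complex.norm_real, Real.norm_eq_abs, abs_neg, abs_of_pos hm0, hm]
        field_simp
      have h3 : ‖((-m : ℝ) : ℂ) * (s * p + t * q)‖ ≤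
          ‖v + ((-m : ℝ) : ℂ) * (s * p + t * q)‖ + ‖v‖ := by
        have := norm_sub_le (v + ((-m : ℝ) : ℂ) * (s * p + t * q)) v
        rwa [add_sub_cancel_left] at this
      linarith [le_abs_self ρ]
    have hcap : (S ∪ T) ∩ (R ∪ segment ℝ (v + p) (v + q)) = R := by
      refine Subset.antisymm ?_ fun z hz => ⟨hRS hz, Or.inl hz⟩
      rintro z ⟨hz, hz' | ⟨α, β, hα, hβ, hab, rfl⟩⟩
      · exact hz'
      · have hsum : (α : ℂ) + β = 1 := by exact_mod_cast hab
        have heq : α • (v + p) + β • (v + q) = v + α * p + β * q := by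
          simp only [Complex.real_smul]
          linear_combination v * hsum
        rw [heq] at hz ⊢
        rcases hlegs α β hα hβ hab.le hz with ⟨-, h0⟩ | ⟨-, h0⟩
        · have h1 : α = 1 := by linarith
          rw [h0, h1]
          push_cast
          rw [zero_mul, add_zero, one_mul]
          exact Or.inl (Or.inl hA.left.right_mem)
        · have h1 : β = 1 := by linarith
          rw [h0, h1]
          push_cast
          rw [zero_mul, add_zero, one_mul]
          exact Or.inr hC.right.left_mem
    have hall := hlog.union hlogR hSTc.isClosed hRsc.isClosed (by rw [hcap]; exact hRconn)
    refine (hall.mono ?_).notMem_enclosedRegion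
      (((isCompact_segment' _ _).union (isCompact_segment' _ _)).union (isCompact_segment' _ _))
      (mem_enclosedRegion_triangle hcr hs0 ht0 hst)
    refine union_subset (union_subset ?_ ?_) (subset_union_right.trans subset_union_right)
    · exact ((hupS.trans hs.subset_left).trans subset_union_left).trans subset_union_left
    · exact ((huqS.trans hs.subset_right).trans subset_union_left).trans subset_union_left
  -- Only the open triangle is known to be enclosed. In the half-size triangle, every point lies in
  -- it or on a leg, hence in K.
  have hhalf : ∀ x : ℂ, segment ℝ v (v + ((1 / 2 : ℝ) : ℂ) * x) ⊆ segment ℝ v (v + x) := by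
    intro x z hz
    obtain ⟨s, h1, h2, rfl⟩ := mem_segment_add_iff.1 hz
    exact mem_segment_add_iff.2 ⟨s * (1 / 2), by positivity, by linarith, by push_cast; ring⟩
  have hfin := htaut v (((1 / 2 : ℝ) : ℂ) * p) (((1 / 2 : ℝ) : ℂ) * q)
    ((hhalf p).trans (hupS.trans hs.subset_left)) ((hhalf q).trans (huqS.trans hs.subset_right)) (by
      rintro _ ⟨s, t, hs0, ht0, hst, rfl⟩
      rcases hs0.eq_or_lt with rfl | hs0
      · refine hSK (hs.subset_right (huqS (mem_segment_add_iff.2 ⟨t * (1 / 2), by positivity,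
          by linarith, by push_cast; ring⟩)))
      rcases ht0.eq_or_lt with rfl | ht0
      · refine hSK (hs.subset_left (hupS (mem_segment_add_iff.2 ⟨s * (1 / 2), by positivity,
          by linarith, by push_cast; ring⟩)))
      have := hopen (s * (1 / 2)) (t * (1 / 2)) (by positivity) (by positivity) (by linarith)
      convert hK this using 1
      push_cast
      ring)
  rw [cross_mul_mul] at hfin
  exact hcr ((mul_eq_zero.1 hfin).resolve_left (by norm_num))

/-- There are no taut bigons. -/
theorem not_taut_bigon {S T K : Set ℂ} {a b : ℂ} (hS : PolyArc S a b) (hT : PolyArc T a b)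
    (hab : a ≠ b) (h : S ∩ T = {a, b}) (hK : enclosedRegion (S ∪ T) ⊆ K) (hSK : S ⊆ K)
    (hTK : T ⊆ K) (hSt : Taut K S) (hTt : Taut K T) : False := by
  obtain ⟨y, hy, hcr⟩ := exists_cross_ne_zero hS hT hab h
  set d := b - a with hd
  set l := cross d (y - a) with hl
  set m := (a + b) / 2 with hm
  -- The centre o is on the perpendicular bisector of ab, on the side away from y. This κ makes 2 κ
  -- l² = ‖d‖² + 1, more than ‖a - m‖² = ‖d‖²/4, so y is farther from o than a and b, and the
  -- farthest point is neither end.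
  set κ : ℝ := (‖d‖ ^ 2 + 1) / (2 * l ^ 2) with hκ
  set o := m - ((κ * l : ℝ) : ℂ) * (Complex.I * d) with ho
  have hform : ∀ z, ‖z - o‖ ^ 2 = ‖z - m‖ ^ 2 + 2 * (κ * l) * cross d (z - a)
      + (κ * l) ^ 2 * ‖d‖ ^ 2 := by
    intro z
    have h1 : cross d (z - a) = cross d (z - m) := by
      have : z - a = (z - m) + ((1 / 2 : ℝ) : ℂ) * d := by rw [hm, hd]; push_cast; ring
      rw [this, cross_add_right, cross_mul_right, cross_same]
      ring
    have h2 : z - o = (z - m) + ((κ * l : ℝ) : ℂ) * (Complex.I * d) := by rw [ho]; ring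
    rw [h1, h2]
    generalize z - m = x
    generalize κ * l = k
    simp only [Complex.sq_norm, Complex.normSq_apply, cross, Complex.add_re, Complex.add_im,
      Complex.mul_re, Complex.mul_im, Complex.ofReal_re, Complex.ofReal_im, Complex.I_re,
      Complex.I_im]
    ring
  have hma : ‖a - m‖ ^ 2 = ‖d‖ ^ 2 / 4 := by
    have : a - m = ((-1 / 2 : ℝ) : ℂ) * d := by rw [hm, hd]; push_cast; ring
    rw [this, norm_mul, Complex.norm_real, mul_pow, Real.norm_eq_abs, sq_abs]
    ring
  have hmb : ‖b - m‖ ^ 2 = ‖d‖ ^ 2 / 4 := by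
    have : b - m = ((1 / 2 : ℝ) : ℂ) * d := by rw [hm, hd]; push_cast; ring
    rw [this, norm_mul, Complex.norm_real, mul_pow, Real.norm_eq_abs, sq_abs]
    ring
  have hκl : 2 * (κ * l) * l = ‖d‖ ^ 2 + 1 := by
    rw [hκ]
    field_simp
  have hya : ‖a - o‖ ^ 2 < ‖y - o‖ ^ 2 := by
    rw [hform, hform, hma, ← hl, hκl, sub_self]
    have : cross d 0 = 0 := by simp [cross]
    rw [this]
    nlinarith [sq_nonneg ‖y - m‖, sq_nonneg ‖d‖]
  have hyb : ‖b - o‖ ^ 2 < ‖y - o‖ ^ 2 := by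
    rw [hform, hform, hmb, ← hl, hκl, ← hd, cross_same]
    nlinarith [sq_nonneg ‖y - m‖, sq_nonneg ‖d‖]
  obtain ⟨v, hv, hmax⟩ := (hS.isCompact.union hT.isCompact).exists_isMaxOn ⟨y, hy⟩
    (f := fun z => dist z o) (by fun_prop)
  have hvy : ‖y - o‖ ≤ ‖v - o‖ := by
    have := hmax hy
    simpa only [mem_ofPred_eq, dist_eq_norm] using this
  have hva : v ≠ a := by
    rintro rfl
    have : ‖y - o‖ ^ 2 ≤ ‖v - o‖ ^ 2 := by gcongr
    linarith
  have hvb : v ≠ b := by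
    rintro rfl
    have : ‖y - o‖ ^ 2 ≤ ‖v - o‖ ^ 2 := by gcongr
    linarith
  rcases hv with hv | hv
  · exact not_taut_of_isMaxOn hS hT h hK hSK hSt hv hva hvb fun z hz => hmax hz
  · exact not_taut_of_isMaxOn hT hS (by rw [inter_comm, h]) (by rwa [union_comm]) hTK hTt hv hva hvb
      fun z hz => hmax (by rwa [union_comm])

/-- Taut arcs with the same endpoints in a set without holes agree. -/
theorem PolyArc.eq_of_taut {S T K : Set ℂ} {a b : ℂ} (hK : ∀ D ⊆ K, enclosedRegion D ⊆ K)
    (hS : PolyArc S a b) (hT : PolyArc T a b) (hSK : S ⊆ K) (hTK : T ⊆ K) (hSt : Taut K S)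
    (hTt : Taut K T) : S = T := by
  have key : ∀ {S T : Set ℂ}, PolyArc S a b → PolyArc T a b → S ⊆ K → T ⊆ K → Taut K S →
      Taut K T → S ⊆ T := by
    intro S T hS hT hSK hTK hSt hTt x hx
    by_contra hxT
    obtain ⟨S₁, S₂, hs⟩ := hS.exists_split hx
    -- Going from x along S in both directions up to the first points c and d on T cuts out a piece
    -- of S that forms a bigon with the part of T between c and d.
    obtain ⟨c, M₁, _, h1, h1T⟩ := hs.left.symm.exists_first hT.isClosed hT.left_mem
    obtain ⟨d, M₂, _, h2, h2T⟩ := hs.right.exists_first hT.isClosed hT.right_mem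
    have hcT : c ∈ M₁ ∩ T := by rw [h1T]; rfl
    have hdT : d ∈ M₂ ∩ T := by rw [h2T]; rfl
    have hMM : M₁ ∩ M₂ = {x} := by
      refine Subset.antisymm (fun z hz => hs.eq_of_mem (h1.subset_left hz.1) (h2.subset_left hz.2))
        ?_
      rintro _ rfl
      exact ⟨h1.left.left_mem, h2.left.left_mem⟩
    have hcd : c ≠ d := by
      rintro rfl
      have : c ∈ M₁ ∩ M₂ := ⟨hcT.1, hdT.1⟩
      rw [hMM] at this
      exact hxT (this ▸ hcT.2)
    have hM := h1.left.symm.trans h2.left hMM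
    have hMS : M₁ ∪ M₂ ⊆ S := union_subset (h1.subset_left.trans hs.subset_left)
      (h2.subset_left.trans hs.subset_right)
    obtain ⟨N, hNT, hN, -⟩ := hT.exists_subarc hcT.2 hdT.2
    refine not_taut_bigon hM hN hcd ?_ (hK _ (union_subset (hMS.trans hSK) (hNT.trans hTK)))
      (hMS.trans hSK) (hNT.trans hTK) (hSt.mono hMS) (hTt.mono hNT)
    refine Subset.antisymm ?_ ?_
    · rintro z ⟨hz | hz, hzN⟩
      · exact Or.inl (h1T.subset ⟨hz, hNT hzN⟩)
      · exact Or.inr (h2T.subset ⟨hz, hNT hzN⟩)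
    · rintro z (rfl | rfl)
      · exact ⟨Or.inl hcT.1, hN.left_mem⟩
      · exact ⟨Or.inr hdT.1, hN.right_mem⟩
  exact Subset.antisymm (key hS hT hSK hTK hSt hTt) (key hT hS hTK hSK hTt hSt)

/-! ### Directions at a point of an arc -/

theorem taut_segment (K : Set ℂ) (a b : ℂ) : Taut K (segment ℝ a b) := by
  intro v p q hp hq _
  by_cases hab : b - a = 0
  · have hs : segment ℝ a b = {a} := by rw [sub_eq_zero.1 hab, segment_same]
    rw [hs] at hp
    have h1 : v = a := hp (left_mem_segment ℝ _ _)
    have h2 : v + p = a := hp (right_mem_segment ℝ _ _)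
    have : p = 0 := by linear_combination h2 - h1
    simp [cross, this]
  have hmem : ∀ x ∈ segment ℝ a b, ∃ t : ℝ, a + t * (b - a) = x := fun x hx => by
    rw [segment_eq_image_add_mul] at hx
    obtain ⟨t, -, h⟩ := hx
    exact ⟨t, h⟩
  obtain ⟨s, hs⟩ := hmem _ (hp (left_mem_segment ℝ _ _))
  obtain ⟨t, ht⟩ := hmem _ (hp (right_mem_segment ℝ _ _))
  obtain ⟨t', ht'⟩ := hmem _ (hq (right_mem_segment ℝ _ _))
  have h1 : p = ((t - s : ℝ) : ℂ) * (b - a) := by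
    push_cast; linear_combination hs - ht
  have h2 : q = ((t' - s : ℝ) : ℂ) * (b - a) := by
    push_cast; linear_combination hs - ht'
  rw [h1, h2, cross_mul_left, cross_mul_right, cross_same]
  ring

theorem PolyArc.exists_direction {S : Set ℂ} {a b : ℂ} (h : PolyArc S a b) (hab : a ≠ b) :
    ∃ u, u ≠ 0 ∧ _root_.segment ℝ a (a + u) ⊆ S ∧
      ∃ r > 0, ball a r ∩ S ⊆ _root_.segment ℝ a (a + u) := by
  obtain ⟨c, hc, h1, r, hr, h2⟩ := h.exists_germ hab
  refine ⟨c - a, sub_ne_zero.2 hc, ?_, r, hr, ?_⟩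
  · rwa [add_sub_cancel]
  · rwa [add_sub_cancel]

theorem exists_mem_of_pos_mul {z u : ℂ} (hu : u ≠ 0) {t : ℝ} (ht : 0 < t) :
    ∃ y, y ≠ z ∧ y ∈ segment ℝ z (z + u) ∧ y ∈ segment ℝ z (z + t * u) := by
  refine ⟨z + (min 1 t : ℝ) * u, ?_, mem_segment_add_iff.2 ⟨min 1 t, by positivity,
    min_le_left _ _, rfl⟩, mem_segment_add_iff.2 ⟨min 1 t / t, by positivity, ?_, ?_⟩⟩
  · intro h
    have h2 : ((min 1 t : ℝ) : ℂ) * u = 0 := by linear_combination h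
    have h3 : 0 < min 1 t := by positivity
    exact (mul_ne_zero (Complex.ofReal_ne_zero.2 h3.ne') hu) h2
  · rw [div_le_one ht]
    exact min_le_right _ _
  · have : (t : ℂ) ≠ 0 := Complex.ofReal_ne_zero.2 ht.ne'
    push_cast
    field_simp

/-- Parallel segments which meet only in their common endpoint have opposite directions. -/
theorem exists_neg_mul_of_cross_eq_zero {X Y : Set ℂ} {z u w : ℂ} (hXY : X ∩ Y ⊆ {z})
    (hu : u ≠ 0) (hw : w ≠ 0) (hX : segment ℝ z (z + u) ⊆ X) (hY : segment ℝ z (z + w) ⊆ Y)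
    (h : cross u w = 0) : ∃ t : ℝ, t < 0 ∧ w = t * u := by
  obtain ⟨t, rfl⟩ := exists_eq_mul_of_cross_eq_zero hu h
  refine ⟨t, ?_, rfl⟩
  by_contra! hle
  rcases hle.eq_or_lt with rfl | hlt
  · simp at hw
  · obtain ⟨y, hy, h1, h2⟩ := exists_mem_of_pos_mul (z := z) hu hlt
    exact hy (hXY ⟨hX h1, hY h2⟩)

/-- Segments in the same direction from a point meet again. -/
theorem not_neg_mul_neg_mul {X Y : Set ℂ} {z u x y : ℂ} (hXY : X ∩ Y ⊆ {z}) (hx : x ≠ 0)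
    (hX : segment ℝ z (z + x) ⊆ X) (hY : segment ℝ z (z + y) ⊆ Y)
    {s t : ℝ} (hs : s < 0) (ht : t < 0) (hxs : x = s * u) (hyt : y = t * u) : False := by
  have hsc : (s : ℂ) ≠ 0 := Complex.ofReal_ne_zero.2 hs.ne
  have hyx : y = ((t / s : ℝ) : ℂ) * x := by
    rw [hxs, hyt]
    push_cast
    field_simp
  obtain ⟨w, hw, h1, h2⟩ := exists_mem_of_pos_mul (z := z) hx (div_pos_of_neg_of_neg ht hs)
  rw [← hyx] at h2
  exact hw (hXY ⟨hX h1, hY h2⟩)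

/-- By shrinking, only the part near z of the cone spanned by u and w has to lie in K. -/
theorem Taut.cross_eq_zero_of_ball {K S : Set ℂ} (h : Taut K S) {z u w : ℂ}
    (hu : segment ℝ z (z + u) ⊆ S) (hw : segment ℝ z (z + w) ⊆ S) {r : ℝ} (hr : 0 < r)
    (hK : ∀ s t : ℝ, 0 ≤ s → 0 ≤ t → z + s * u + t * w ∈ ball z r → z + s * u + t * w ∈ K) :
    cross u w = 0 := by
  obtain ⟨ε, hε, -, h1, h2, h3⟩ := exists_shrink z u w hr
  have := h z _ _ (fun x hx => hu (h1 hx).1) (fun x hx => hw (h2 hx).1) (by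
    intro x hx
    have hb := (h3 hx).2
    obtain ⟨s, t, hs, ht, -, rfl⟩ := hx
    have heq : z + s * (ε * u) + t * (ε * w) = z + ((s * ε : ℝ) : ℂ) * u + ((t * ε : ℝ) : ℂ) * w := by
      push_cast; ring
    rw [heq] at hb ⊢
    exact hK _ _ (by positivity) (by positivity) hb)
  rw [cross_mul_mul] at this
  exact (mul_eq_zero.1 this).resolve_left (by positivity)

theorem Taut.cross_eq_zero_of_isOpen {K S W : Set ℂ} (h : Taut K S) (hW : IsOpen W) (hWK : W ⊆ K)
    {z u w : ℂ} (hz : z ∈ W) (hu : segment ℝ z (z + u) ⊆ S) (hw : segment ℝ z (z + w) ⊆ S) :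
    cross u w = 0 := by
  obtain ⟨r, hr, hball⟩ := Metric.isOpen_iff.1 hW z hz
  exact h.cross_eq_zero_of_ball hu hw hr fun s t _ _ hb => hWK (hball hb)

theorem exists_pos_mem_ball (z u : ℂ) {r : ℝ} (hr : 0 < r) :
    ∃ ε : ℝ, 0 < ε ∧ ε ≤ 1 ∧ z + ε * u ∈ ball z r := by
  obtain ⟨ε, h1, h2, h3, -⟩ := exists_shrink z u 0 hr
  exact ⟨ε, h1, h2, (h3 (right_mem_segment ℝ _ _)).2⟩

namespace SimplePolygon

variable {P : SimplePolygon}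

/-- At an inner point of a side, taut sets are straight. -/
theorem cross_eq_zero_of_taut (hP : P.IsCounterclockwise) {k : ZMod P.n} {t : ℝ}
    (ht : t ∈ Ioo (0 : ℝ) 1) {d z : ℂ} (hd : d = P.vertex (k + 1) - P.vertex k)
    (hz : z = P.vertex k + t * d) {S : Set ℂ} (hS : S ⊆ P.region) (htaut : Taut P.region S)
    {u w : ℂ} (hu : segment ℝ z (z + u) ⊆ S) (hw : segment ℝ z (z + w) ⊆ S) :
    0 ≤ cross d u ∧ cross u w = 0 := by
  obtain ⟨r, hr, hball⟩ := exists_half_ball hP k ht hd hz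
  -- No direction of S at z points out of P. Hence the cone spanned by two such directions lies,
  -- near z, in the closed half disc, which belongs to P.
  have hnn : ∀ x, segment ℝ z (z + x) ⊆ S → 0 ≤ cross d x := by
    intro x hx
    obtain ⟨ε, h1, h2, h3⟩ := exists_pos_mem_ball z x hr
    by_contra! hneg
    refine (hball _ h3).2.1 ?_ (hS (hx (mem_segment_add_iff.2 ⟨ε, h1.le, h2, rfl⟩)))
    rw [add_sub_cancel_left, cross_mul_right]
    exact mul_neg_of_pos_of_neg h1 hneg
  refine ⟨hnn u hu, htaut.cross_eq_zero_of_ball hu hw hr fun s t hs ht hb => ?_⟩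
  have hc : cross d (z + s * u + t * w - z) = s * cross d u + t * cross d w := by
    rw [← cross_mul_right, ← cross_mul_right, ← cross_add_right]
    congr 1
    ring
  have h0 : 0 ≤ cross d (z + s * u + t * w - z) := by
    rw [hc]
    exact add_nonneg (mul_nonneg hs (hnn u hu)) (mul_nonneg ht (hnn w hw))
  rcases h0.eq_or_lt with h | h
  · exact Or.inl (side_subset_boundary k ((hball _ hb).2.2.1 h.symm))
  · exact Or.inr ((hball _ hb).1 h)

/-- If the corner between a boundary side and a segment into the polygon is taut, then the other
boundary side fills this corner, or there is no corner. -/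
theorem cross_eq_zero_or_mem_cone {S : Set ℂ} (htaut : Taut P.region S) {z p₁ p₂ u : ℂ} {r : ℝ}
    (hr : 0 < r) (hp₁ : segment ℝ z (z + p₁) ⊆ P.boundary)
    (hbd : ball z r ∩ P.boundary ⊆ segment ℝ z (z + p₁) ∪ segment ℝ z (z + p₂))
    (huK : segment ℝ z (z + u) ⊆ P.region) (hub : segment ℝ z (z + u) ∩ ball z r ∩ P.boundary ⊆ {z})
    (hpS : segment ℝ z (z + p₁) ⊆ S) (huS : segment ℝ z (z + u) ⊆ S) :
    cross p₁ u = 0 ∨ ∃ α γ : ℝ, 0 < α ∧ 0 < γ ∧ p₂ = α * p₁ + γ * u := by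
  by_contra! hcon
  obtain ⟨hcr, hcone⟩ := hcon
  have hu0 : u ≠ 0 := by
    rintro rfl
    simp [cross] at hcr
  obtain ⟨ε, hε, hε1, h1, h2, h3⟩ := exists_shrink z p₁ u hr
  -- W is a small triangle without its leg along p₁. If p₂ does not point into the open cone, W
  -- misses the boundary, so being connected to a point inside along u it is inside. The triangle is
  -- then in P, contrary to tautness.
  set W : Set ℂ := (fun x : ℝ × ℝ => z + x.1 * (ε * p₁) + x.2 * (ε * u)) ''
    {x : ℝ × ℝ | 0 ≤ x.1 ∧ 0 < x.2 ∧ x.1 + x.2 ≤ 1} with hW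
  have hWc : IsPreconnected W := by
    refine IsPreconnected.image (Convex.isPreconnected ?_) _ (by fun_prop)
    rw [convex_iff_forall_pos]
    rintro ⟨s, t⟩ ⟨hs, ht, hst⟩ ⟨s', t'⟩ ⟨hs', ht', hst'⟩ a b ha hb hab
    simp only at hs ht hst hs' ht' hst'
    refine ⟨?_, ?_, ?_⟩ <;> simp only [Prod.smul_mk, Prod.mk_add_mk, smul_eq_mul]
    · positivity
    · positivity
    · nlinarith
  have hWd : Disjoint W P.boundary := by
    rw [Set.disjoint_left]
    rintro _ ⟨⟨s, t⟩, ⟨hs, ht, hst⟩, rfl⟩ hxb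
    simp only at hs ht hst hxb
    have hball := (h3 ⟨s, t, hs, ht.le, hst, rfl⟩).2
    rcases hbd ⟨hball, hxb⟩ with hx | hx
    · obtain ⟨l, -, -, hl⟩ := mem_segment_add_iff.1 hx
      have := (mul_add_mul_injective hcr (s := s * ε) (t := t * ε) (s' := l) (t' := 0) (by
        push_cast; linear_combination hl)).2
      exact (mul_pos ht hε).ne' this
    · obtain ⟨l, hl0, -, hl⟩ := mem_segment_add_iff.1 hx
      rcases hl0.eq_or_lt with rfl | hl0
      · have := (mul_add_mul_injective hcr (s := s * ε) (t := t * ε) (s' := 0) (t' := 0) (by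
          push_cast at hl ⊢; linear_combination hl)).2
        exact (mul_pos ht hε).ne' this
      have hlc : (l : ℂ) ≠ 0 := Complex.ofReal_ne_zero.2 hl0.ne'
      rcases hs.eq_or_lt with rfl | hs
      · have hmem : z + ((t * ε : ℝ) : ℂ) * u ∈ ({z} : Set ℂ) := by
          refine hub ⟨⟨mem_segment_add_iff.2 ⟨t * ε, by positivity, ?_, rfl⟩, ?_⟩, ?_⟩
          · exact mul_le_one₀ (by linarith) hε.le hε1
          · convert hball using 1
            push_cast; ring
          · convert hxb using 1
            push_cast; ring
        have h0 : z + ((t * ε : ℝ) : ℂ) * u = z := hmem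
        have h0 : ((t * ε : ℝ) : ℂ) * u = 0 := by linear_combination h0
        exact mul_ne_zero (Complex.ofReal_ne_zero.2 (mul_pos ht hε).ne') hu0 h0
      · refine hcone (s * ε / l) (t * ε / l) (by positivity) (by positivity) ?_
        push_cast
        field_simp
        linear_combination -hl
  have hWin : W ⊆ P.inside := by
    have hmem : z + ε * u ∈ W := ⟨(0, 1), ⟨le_rfl, one_pos, by norm_num⟩, by push_cast; ring⟩
    have hin : z + ε * u ∈ P.inside := by
      rcases huK (mem_segment_add_iff.2 ⟨ε, hε.le, hε1, rfl⟩) with h | h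
      · exact absurd h (Set.disjoint_left.1 hWd hmem)
      · exact h
    exact fun x hx => hWc.mem_enclosedRegion hWd hmem hx hin
  have := htaut z _ _ (fun x hx => hpS (h1 hx).1) (fun x hx => huS (h2 hx).1) (by
    rintro _ ⟨s, t, hs, ht, hst, rfl⟩
    rcases ht.eq_or_lt with rfl | ht
    · refine Or.inl (hp₁ (h1 (mem_segment_add_iff.2 ⟨s, hs, by linarith, ?_⟩)).1)
      push_cast; ring
    · exact Or.inr (hWin ⟨(s, t), ⟨hs, ht, hst⟩, rfl⟩))
  rw [cross_mul_mul] at this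
  exact hcr ((mul_eq_zero.1 this).resolve_left (by positivity))

/-! ### Outward convex boundary paths are taut -/

/-- At a strict left turn -d/d' has positive imaginary part. Its argument lies strictly between 0
and π and is unchanged by reduction to [0, 2π), so the angle would be less than π. -/
theorem IsReflex.cross_nonpos {k : ZMod P.n} (h : P.IsReflex (k + 1)) :
    cross (P.vertex (k + 1) - P.vertex k) (P.vertex (k + 1 + 1) - P.vertex (k + 1)) ≤ 0 := by
  set d := P.vertex (k + 1) - P.vertex k with hd
  set d' := P.vertex (k + 1 + 1) - P.vertex (k + 1) with hd'
  have hd0 : d' ≠ 0 := sub_ne_zero.2 (vertex_ne _)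
  by_contra! hpos
  have him : 0 < (-d / d').im := by
    rw [Complex.div_im, Complex.neg_re, Complex.neg_im, ← sub_div]
    refine div_pos ?_ (Complex.normSq_pos.2 hd0)
    unfold cross at hpos
    linarith
  have harg0 : 0 ≤ (-d / d').arg := Complex.arg_nonneg_iff.2 him.le
  have hargpi : (-d / d').arg < Real.pi :=
    lt_of_le_of_ne (Complex.arg_le_pi _) fun h => by
      have := (Complex.arg_eq_pi_iff.1 h).2
      linarith
  have hang : P.interiorAngle (k + 1) = (-d / d').arg := by
    rw [interiorAngle, add_sub_cancel_right]
    have : P.vertex k - P.vertex (k + 1) = -d := by rw [hd]; ring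
    rw [this]
    exact (toIcoMod_eq_self Real.two_pi_pos).2 ⟨harg0, by linarith [Real.pi_pos]⟩
  have := h
  rw [IsReflex, hang] at this
  linarith

theorem eq_of_vertex_mem_side {i k : ZMod P.n} (h : P.vertex i ∈ P.side k) :
    i = k ∨ i = k + 1 := by
  by_cases hik : k = i
  · exact Or.inl hik.symm
  rcases side_inter hik (vertex_mem_side i) h with ⟨h1, h2⟩ | ⟨h1, -⟩
  · exact absurd (P.injective h2) (by rw [h1]; exact (add_one_ne_self i).symm)
  · exact Or.inr h1

/-- Near a point only the sides through that point matter. -/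
theorem exists_ball_side (v : ℂ) :
    ∃ r > 0, ∀ k, ∀ x ∈ ball v r, x ∈ P.side k → v ∈ P.side k := by
  have hc : IsClosed (⋃ k ∈ {k | v ∉ P.side k}, P.side k) :=
    (Set.toFinite _).isClosed_biUnion fun k _ => (isCompact_segment' _ _).isClosed
  obtain ⟨r, hr, hball⟩ := Metric.isOpen_iff.1 hc.isOpen_compl v (by
    simp only [mem_compl_iff, mem_iUnion, not_exists]
    exact fun k hk hv => hk hv)
  refine ⟨r, hr, fun k x hx hxk => ?_⟩
  by_contra hv
  exact hball hx (mem_biUnion (show k ∈ {k | v ∉ P.side k} from hv) hxk)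

theorem mem_side_iff {k : ZMod P.n} {x : ℂ} : x ∈ P.side k ↔
    ∃ t : ℝ, 0 ≤ t ∧ t ≤ 1 ∧ x = P.vertex k + t * (P.vertex (k + 1) - P.vertex k) := by
  have := mem_segment_add_iff (v := P.vertex k) (p := P.vertex (k + 1) - P.vertex k) (z := x)
  rwa [add_sub_cancel] at this

theorem exists_mem_side_of_mem_carrier {s l : ℕ} (hl : 0 < l) {x : ℂ}
    (hx : x ∈ (P.subpath s l).carrier) : ∃ i < l, x ∈ P.side ((s + i : ℕ) : ZMod P.n) := by
  rcases mem_carrier_subpath.1 hx with rfl | h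
  · exact ⟨0, hl, vertex_mem_side _⟩
  · exact h

/-- At an inner point of a side all legs are parallel to it. At a vertex a genuine corner has one
leg along each adjacent side, and next to the incoming side the triangle between them lies to the
right, outside P. -/
theorem taut_subpath (hP : P.IsCounterclockwise) {s l : ℕ} (hl : l < P.n)
    (hreflex : ∀ t : ℕ, s < t → t < s + l → P.IsReflex (t : ZMod P.n)) :
    Taut P.region (P.subpath s l).carrier := by
  intro v p q hp hq htri
  have hvS := hp (left_mem_segment ℝ _ _)
  rcases Nat.eq_zero_or_pos l with rfl | hl0
  · rw [carrier_subpath_zero] at hp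
    have h1 : v = _ := hp (left_mem_segment ℝ _ _)
    have h2 : v + p = _ := hp (right_mem_segment ℝ _ _)
    have : p = 0 := by linear_combination h2 - h1
    simp [cross, this]
  obtain ⟨i, hi, hvi⟩ := exists_mem_side_of_mem_carrier hl0 hvS
  obtain ⟨t, ht0, ht1, hvt⟩ := mem_side_iff.1 hvi
  by_cases htI : t ∈ Ioo (0 : ℝ) 1
  · obtain ⟨r, hr, hball⟩ := exists_half_ball hP _ htI rfl hvt
    have hd0 : P.vertex (((s + i : ℕ) : ZMod P.n) + 1) - P.vertex ((s + i : ℕ) : ZMod P.n) ≠ 0 :=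
      sub_ne_zero.2 (vertex_ne _)
    have hpar : ∀ x, segment ℝ v (v + x) ⊆ (P.subpath s l).carrier → ∃ m : ℝ,
        x = m * (P.vertex (((s + i : ℕ) : ZMod P.n) + 1) - P.vertex ((s + i : ℕ) : ZMod P.n)) := by
      intro x hx
      obtain ⟨ε, h1, h2, h3⟩ := exists_pos_mem_ball v x hr
      have h4 := (hball _ h3).2.2.2 (carrier_subpath_subset_boundary _ _
        (hx (mem_segment_add_iff.2 ⟨ε, h1.le, h2, rfl⟩)))
      rw [add_sub_cancel_left, cross_mul_right] at h4
      exact exists_eq_mul_of_cross_eq_zero hd0 ((mul_eq_zero.1 h4).resolve_left h1.ne')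
    obtain ⟨m, hm⟩ := hpar p hp
    obtain ⟨m', hm'⟩ := hpar q hq
    rw [hm, hm', cross_mul_left, cross_mul_right, cross_same]
    ring
  -- otherwise `v` is a vertex of the path
  obtain ⟨j, hj, hvj⟩ : ∃ j ≤ l, v = P.vertex ((s + j : ℕ) : ZMod P.n) := by
    rcases ht0.eq_or_lt with rfl | ht0
    · exact ⟨i, hi.le, by rw [hvt]; push_cast; ring⟩
    rcases ht1.eq_or_lt with rfl | ht1
    · exact ⟨i + 1, hi, by rw [hvt, ← add_assoc]; push_cast; ring⟩
    · exact absurd ⟨ht0, ht1⟩ htI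
  obtain ⟨r, hr, hball⟩ := P.exists_ball_side v
  have hdir : ∀ x, segment ℝ v (v + x) ⊆ (P.subpath s l).carrier →
      (j < l ∧ ∃ m : ℝ, 0 ≤ m ∧ x = m * (P.vertex (((s + j : ℕ) : ZMod P.n) + 1)
        - P.vertex ((s + j : ℕ) : ZMod P.n))) ∨
      (∃ j', j = j' + 1 ∧ ∃ m : ℝ, 0 ≤ m ∧ x = -m * (P.vertex (((s + j' : ℕ) : ZMod P.n) + 1)
        - P.vertex ((s + j' : ℕ) : ZMod P.n))) := by
    intro x hx
    obtain ⟨ε, h1, h2, h3⟩ := exists_pos_mem_ball v x hr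
    have hεc : (ε : ℂ) ≠ 0 := Complex.ofReal_ne_zero.2 h1.ne'
    obtain ⟨c, hc, hxc⟩ := exists_mem_side_of_mem_carrier hl0
      (hx (mem_segment_add_iff.2 ⟨ε, h1.le, h2, rfl⟩))
    have hvc := hball _ _ h3 hxc
    obtain ⟨m, hm0, hm1, hm⟩ := mem_side_iff.1 hxc
    rw [hvj] at hvc
    rcases eq_of_vertex_mem_side hvc with h4 | h4
    · obtain rfl := natCast_inj_of_lt (P := P) (by omega) (by omega) h4
      refine Or.inl ⟨hc, m / ε, by positivity, ?_⟩
      push_cast at hm hvj ⊢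
      field_simp
      linear_combination hm - hvj
    · obtain rfl : j = c + 1 := natCast_inj_of_lt (P := P) (s := s) (by omega) (by omega) (by
        rw [h4]; push_cast; ring)
      refine Or.inr ⟨c, rfl, (1 - m) / ε, div_nonneg (by linarith) h1.le, ?_⟩
      rw [h4] at hvj
      push_cast at hm hvj ⊢
      field_simp
      linear_combination hm - hvj
  by_contra hcr
  have key : ∀ p q : ℂ, cross p q ≠ 0 → tri v p q ⊆ P.region → ∀ j', j = j' + 1 → j < l →
      ∀ m m' : ℝ, 0 ≤ m → 0 ≤ m' → p = -m * (P.vertex (((s + j' : ℕ) : ZMod P.n) + 1)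
        - P.vertex ((s + j' : ℕ) : ZMod P.n)) →
      q = m' * (P.vertex (((s + j : ℕ) : ZMod P.n) + 1) - P.vertex ((s + j : ℕ) : ZMod P.n)) →
      False := by
    intro p q hcr htri j' hj' hjl m m' hm hm' hpm hqm
    have hcast : ((s + j : ℕ) : ZMod P.n) = ((s + j' : ℕ) : ZMod P.n) + 1 := by
      rw [hj']; push_cast; ring
    have hturn := IsReflex.cross_nonpos (P := P) (k := ((s + j' : ℕ) : ZMod P.n)) (by
      rw [← hcast]
      exact hreflex (s + j) (by omega) (by omega))
    rw [hcast] at hqm hvj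
    set d := P.vertex (((s + j' : ℕ) : ZMod P.n) + 1) - P.vertex ((s + j' : ℕ) : ZMod P.n) with hd
    have hpm' : p = ((-m : ℝ) : ℂ) * d := by rw [hpm]; push_cast; ring
    have hcr' := hcr
    rw [hpm', hqm, cross_mul_left, cross_mul_right] at hcr'
    have hm0 : 0 < m := lt_of_le_of_ne hm fun h => hcr' (by rw [← h]; ring)
    have hm0' : 0 < m' := lt_of_le_of_ne hm' fun h => hcr' (by rw [← h]; ring)
    have hneg : cross d q < 0 := by
      rw [hqm, cross_mul_right]
      refine mul_neg_of_pos_of_neg hm0' (lt_of_le_of_ne hturn fun h => hcr' (by rw [h]; ring))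
    -- The point v + θ p is an inner point of the incoming side because 0 < θ m < 1. From there a
    -- step of at most q/2 stays in the triangle because θ ≤ 1/2, yet it leaves P because `cross d
    -- q` is negative.
    obtain ⟨θ, hθ0, hθ1, hθ2⟩ : ∃ θ : ℝ, 0 < θ ∧ θ ≤ 1 / 2 ∧ θ * m < 1 := by
      refine ⟨min (1 / 2) (1 / (m + 1)), by positivity, min_le_left _ _, ?_⟩
      have : min (1 / 2) (1 / (m + 1)) * m ≤ 1 / (m + 1) * m := by gcongr; exact min_le_right _ _
      refine this.trans_lt ?_
      rw [div_mul_eq_mul_div, div_lt_one (by positivity)]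
      linarith
    obtain ⟨r, hr, hball⟩ := exists_half_ball hP ((s + j' : ℕ) : ZMod P.n) (t := 1 - θ * m)
      ⟨by linarith, by linarith [mul_pos hθ0 hm0]⟩ hd rfl
    set z := P.vertex ((s + j' : ℕ) : ZMod P.n) + ((1 - θ * m : ℝ) : ℂ) * d with hz
    have hzv : z = v + θ * p := by
      rw [hz, hvj, hpm, hd]
      push_cast
      ring
    obtain ⟨ε, hε0, hε1, hεb⟩ := exists_pos_mem_ball z (((1 / 2 : ℝ) : ℂ) * q) hr
    refine (hball _ hεb).2.1 ?_ (htri ⟨θ, ε * (1 / 2), hθ0.le, by positivity, by linarith, ?_⟩)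
    · rw [add_sub_cancel_left, cross_mul_right, cross_mul_right]
      nlinarith
    · rw [hzv]
      push_cast
      ring
  have hswap : tri v q p ⊆ P.region := by
    rintro x ⟨s, t, hs, ht, hst, rfl⟩
    exact htri ⟨t, s, ht, hs, by linarith, by ring⟩
  rcases hdir p hp with ⟨hjl, m, hm, hpm⟩ | ⟨j', hj', m, hm, hpm⟩ <;>
    rcases hdir q hq with ⟨hjl', m', hm', hqm⟩ | ⟨j'', hj'', m', hm', hqm⟩
  · refine hcr ?_
    rw [hpm, hqm, cross_mul_left, cross_mul_right, cross_same]
    ring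
  · refine key q p (by rw [cross_swap]; exact neg_ne_zero.2 hcr) hswap j'' hj'' hjl m' m hm' hm ?_
      hpm
    exact hqm
  · exact key p q hcr htri j' hj' hjl' m m' hm hm' hpm hqm
  · obtain rfl : j' = j'' := by omega
    refine hcr ?_
    have h1 : p = ((-m : ℝ) : ℂ) * (P.vertex (((s + j' : ℕ) : ZMod P.n) + 1)
        - P.vertex ((s + j' : ℕ) : ZMod P.n)) := by rw [hpm]; push_cast; ring
    have h2 : q = ((-m' : ℝ) : ℂ) * (P.vertex (((s + j' : ℕ) : ZMod P.n) + 1)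
        - P.vertex ((s + j' : ℕ) : ZMod P.n)) := by rw [hqm]; push_cast; ring
    rw [h1, h2, cross_mul_left, cross_mul_right, cross_same]
    ring

end SimplePolygon

/-! ### Taut arcs -/

/-- A polygonal arc in `K` which is locally shortest there. -/
structure TautArc (K S : Set ℂ) (a b : ℂ) : Prop where
  arc : PolyArc S a b
  subset : S ⊆ K
  taut : Taut K S

namespace TautArc

variable {K S T X Y M : Set ℂ} {a b u w x s t : ℂ}

theorem symm (h : TautArc K S a b) : TautArc K S b a := ⟨h.arc.symm, h.subset, h.taut⟩

theorem mono (h : TautArc K S a b) (hM : PolyArc M u w) (hMS : M ⊆ S) : TautArc K M u w :=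
  ⟨hM, hMS.trans h.subset, h.taut.mono hMS⟩

theorem left (h : TautArc K S a b) (hs : PolySplit X Y S a x b) : TautArc K X a x :=
  h.mono hs.left hs.subset_left

theorem right (h : TautArc K S a b) (hs : PolySplit X Y S a x b) : TautArc K Y x b :=
  h.mono hs.right hs.subset_right

theorem eq (hK : ∀ D ⊆ K, enclosedRegion D ⊆ K) (hS : TautArc K S a b) (hT : TautArc K T a b) :
    S = T :=
  hS.arc.eq_of_taut hK hT.arc hS.subset hT.subset hS.taut hT.taut

/-- A taut arc between two points of a second taut arc is part of the latter. -/
theorem subset_of_mem (hK : ∀ D ⊆ K, enclosedRegion D ⊆ K) (hS : TautArc K S u w)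
    (hT : TautArc K T a b) (hu : u ∈ T) (hw : w ∈ T) : S ⊆ T := by
  obtain ⟨N, hNT, hN, -⟩ := hT.arc.exists_subarc hu hw
  rw [hS.eq hK (hT.mono hN hNT)]
  exact hNT

/-- Two overlapping taut arcs combine into one. -/
theorem union (hX : PolyArc X a s) (hM : PolyArc M s t) (hY : PolyArc Y t b)
    (hXM : X ∩ M = {s}) (hMY : M ∩ Y = {t}) (hXY : Disjoint X Y) (hXK : X ∪ M ⊆ K)
    (hYK : M ∪ Y ⊆ K) (h₁ : Taut K (X ∪ M)) (h₂ : Taut K (M ∪ Y)) :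
    TautArc K (X ∪ M ∪ Y) a b := by
  refine ⟨(hX.trans hM hXM).trans hY ?_, union_subset hXK (subset_union_right.trans hYK),
    Taut.union hX.isClosed hY.isClosed hXY h₁ h₂⟩
  rw [union_inter_distrib_right, hXY.inter_eq, empty_union, hMY]

end TautArc

/-- The first point of an arc on a closed set that it meets. -/
theorem PolyArc.exists_first_of_nonempty {S T : Set ℂ} {a b : ℂ} (h : PolyArc S a b)
    (hT : IsClosed T) (hne : (S ∩ T).Nonempty) :
    ∃ x S₁ S₂, PolySplit S₁ S₂ S a x b ∧ S₁ ∩ T = {x} := by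
  obtain ⟨z, hzS, hzT⟩ := hne
  obtain ⟨Z, Z', hz⟩ := h.exists_split hzS
  obtain ⟨x, S₁, S₂, hs, hx⟩ := hz.left.exists_first hT hzT
  obtain ⟨R₁, R₂, hr⟩ := h.exists_split (hz.subset_left (hs.subset_left hs.left.right_mem))
  have : S₁ = R₁ := hr.eq_left hs.left (hs.subset_left.trans hz.subset_left)
  exact ⟨x, R₁, R₂, hr, this ▸ hx⟩

/-- The parts of an arc before its first point and after its last point on a closed set. -/
theorem PolyArc.exists_first_last {S T : Set ℂ} {a b : ℂ} (h : PolyArc S a b)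
    (hT : IsClosed T) (hne : (S ∩ T).Nonempty) :
    ∃ s t X R M Y, PolySplit X R S a s b ∧ PolySplit M Y R s t b ∧ X ∩ T = {s} ∧ Y ∩ T = {t} := by
  obtain ⟨s, X, R, hs, hXT⟩ := h.exists_first_of_nonempty hT hne
  obtain ⟨t, Y, M, ht, hYT⟩ := hs.right.symm.exists_first_of_nonempty hT
    ⟨s, hs.right.left_mem, (hXT.symm ▸ rfl : s ∈ X ∩ T).2⟩
  exact ⟨s, t, X, R, M, Y, hs, ht.symm, hXT, hYT⟩

/-! ### Regions bounded by unions -/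

/-- Off D ∪ E, a logarithm on the union amounts to one on each part, since they glue along the
connected intersection. The disjointness conditions take care of points on D ∪ E. -/
theorem enclosedRegion_union {D E : Set ℂ} (hD : IsCompact D) (hE : IsCompact E)
    (hc : IsPreconnected (D ∩ E)) (hDE : Disjoint D (enclosedRegion E))
    (hED : Disjoint E (enclosedRegion D)) :
    enclosedRegion (D ∪ E) = enclosedRegion D ∪ enclosedRegion E := by
  ext x
  by_cases hx : x ∈ D ∪ E
  · refine iff_of_false (fun h => h.1 hx) ?_
    rintro (h | h) <;> rcases hx with hx | hx
    · exact h.1 hx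
    · exact Set.disjoint_left.1 hED hx h
    · exact Set.disjoint_left.1 hDE hx h
    · exact h.1 hx
  · have hxD : x ∉ D := fun h => hx (Or.inl h)
    have hxE : x ∉ E := fun h => hx (Or.inr h)
    rw [Set.mem_union, mem_enclosedRegion_iff (hD.union hE) hx, mem_enclosedRegion_iff hD hxD,
      mem_enclosedRegion_iff hE hxE, ← not_and_or, not_iff_not]
    exact ⟨fun h => ⟨h.mono subset_union_left, h.mono subset_union_right⟩,
      fun h => h.1.union h.2 hD.isClosed hE.isClosed hc⟩

/-! ### The polygon cut off by two taut arcs from a point to the ends of a third -/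

/-- `Q` is bounded by a part of `B` and parts of arcs from `p` to `B`, and the boundary of `Q`
consists otherwise of pieces leading from `B` to `p`. -/
structure IsCap (Q : SimplePolygon) (B D : Set ℂ) (p : ℂ) : Prop where
  union_eq : B ∪ Q.boundary = D
  inter : ∃ N q₁ q₂, q₁ ≠ q₂ ∧ PolyArc N q₁ q₂ ∧ Q.boundary ∩ B = N
  mem : p ∈ Q.boundary
  connect : ∀ z ∈ Q.boundary \ {p}, ∃ C ⊆ Q.boundary \ {p}, IsPreconnected C ∧ z ∈ C ∧
    (C ∩ B).Nonempty

/-- Follow X₁ and X₂ from p to their first points q₁, q₂ on B. By uniqueness of taut arcs the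
remaining tails run within B, so they add nothing to the union. The polygon consists of the two
initial parts and the piece of B between q₁ and q₂. -/
theorem exists_isCap {K B X₁ X₂ : Set ℂ} {a b p : ℂ} (hK : ∀ D ⊆ K, enclosedRegion D ⊆ K)
    (hB : TautArc K B a b) (h₁ : TautArc K X₁ a p) (h₂ : TautArc K X₂ b p) (hX : X₁ ∩ X₂ = {p})
    (hp : p ∉ B) : ∃ Q, IsCap Q B (B ∪ X₁ ∪ X₂) p := by
  obtain ⟨q₁, S₁, S₂, hS, hSB⟩ := h₁.arc.symm.exists_first hB.arc.isClosed hB.arc.left_mem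
  obtain ⟨q₂, T₁, T₂, hT, hTB⟩ := h₂.arc.symm.exists_first hB.arc.isClosed hB.arc.right_mem
  have hq₁ : q₁ ∈ S₁ ∩ B := hSB ▸ rfl
  have hq₂ : q₂ ∈ T₁ ∩ B := hTB ▸ rfl
  have hS₂ : S₂ ⊆ B := (h₁.symm.right hS).subset_of_mem hK hB hq₁.2 hB.arc.left_mem
  have hT₂ : T₂ ⊆ B := (h₂.symm.right hT).subset_of_mem hK hB hq₂.2 hB.arc.right_mem
  have hST : S₁ ∩ T₁ = {p} := by
    refine Subset.antisymm ?_ (singleton_subset_iff.2 ⟨hS.left.left_mem, hT.left.left_mem⟩)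
    rw [← hX]
    exact inter_subset_inter hS.subset_left hT.subset_left
  have hpq₁ : q₁ ≠ p := fun h => hp (h ▸ hq₁.2)
  have hpq₂ : q₂ ≠ p := fun h => hp (h ▸ hq₂.2)
  have hq : q₁ ≠ q₂ := fun h => hpq₁ (hST.subset ⟨hq₁.1, h ▸ hq₂.1⟩)
  obtain ⟨N, hNB, hN, -⟩ := hB.arc.exists_subarc hq₁.2 hq₂.2
  obtain ⟨Q, hQ⟩ := hN.exists_simplePolygon (hS.left.symm.trans hT.left hST) hq (by
    refine Subset.antisymm ?_ ?_
    · rintro x ⟨hxN, hx | hx⟩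
      · exact Or.inl (hSB.subset ⟨hx, hNB hxN⟩)
      · exact Or.inr (hTB.subset ⟨hx, hNB hxN⟩)
    · rintro x (rfl | rfl)
      · exact ⟨hN.left_mem, Or.inl hq₁.1⟩
      · exact ⟨hN.right_mem, Or.inr hq₂.1⟩)
  refine ⟨Q, ?_, ⟨N, q₁, q₂, hq, hN, ?_⟩, ?_, ?_⟩
  · rw [hQ, ← hS.union, ← hT.union]
    ext x
    have h1 := @hS₂ x
    have h2 := @hT₂ x
    have h3 := @hNB x
    simp only [Set.mem_union]
    tauto
  · rw [hQ]
    refine Subset.antisymm ?_ fun x hx => ⟨Or.inl hx, hNB hx⟩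
    rintro x ⟨hx | hx | hx, hxB⟩
    · exact hx
    · rw [show x = q₁ from hSB.subset ⟨hx, hxB⟩]
      exact hN.left_mem
    · rw [show x = q₂ from hTB.subset ⟨hx, hxB⟩]
      exact hN.right_mem
  · rw [hQ]
    exact Or.inr (Or.inl hS.left.left_mem)
  · rw [hQ]
    rintro z ⟨hz | hz | hz, hzp⟩
    · exact ⟨N, fun x hx => ⟨Or.inl hx, fun h => hp ((show x = p from h) ▸ hNB hx)⟩,
        hN.isPreconnected, hz, q₁, hN.left_mem, hq₁.2⟩
    · exact ⟨S₁ \ {p}, fun x hx => ⟨Or.inr (Or.inl hx.1), hx.2⟩,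
        hS.left.symm.isPreconnected_diff_right, ⟨hz, hzp⟩, q₁, ⟨hq₁.1, hpq₁⟩, hq₁.2⟩
    · exact ⟨T₁ \ {p}, fun x hx => ⟨Or.inr (Or.inr hx.1), hx.2⟩,
        hT.left.symm.isPreconnected_diff_right, ⟨hz, hzp⟩, q₂, ⟨hq₂.1, hpq₂⟩, hq₂.2⟩

namespace IsCap

variable {P Q Q' : SimplePolygon} {B B' D D' : Set ℂ} {p : ℂ}

theorem boundary_subset (h : IsCap Q B D p) : Q.boundary ⊆ D := h.union_eq ▸ subset_union_right

theorem isPathOfPositiveLength (h : IsCap Q B D p) : IsPathOfPositiveLength (Q.boundary ∩ B) := by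
  obtain ⟨N, q₁, q₂, hq, hN, hNB⟩ := h.inter
  exact hNB ▸ hN.isPathOfPositiveLength hq

theorem disjoint_boundary_inside (h : IsCap Q B D p) (hP : P.IsCounterclockwise)
    (hD : D ⊆ P.region) : Disjoint P.boundary Q.inside :=
  SimplePolygon.disjoint_boundary_enclosedRegion hP SimplePolygon.isCompact_boundary.isClosed
    (h.boundary_subset.trans hD)

/-- The arc B encloses nothing and meets the boundary of Q in a connected piece. -/
theorem enclosedRegion_eq (h : IsCap Q B D p) (hP : P.IsCounterclockwise) {a b : ℂ}
    (hB : PolyArc B a b) (hBP : B ⊆ P.boundary) (hD : D ⊆ P.region) :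
    enclosedRegion D = Q.inside := by
  obtain ⟨N, q₁, q₂, hq, hN, hNB⟩ := h.inter
  rw [← h.union_eq, enclosedRegion_union hB.isCompact SimplePolygon.isCompact_boundary,
    hB.enclosedRegion_eq_empty, empty_union, SimplePolygon.inside]
  · rw [inter_comm, hNB]
    exact hN.isPreconnected
  · exact (h.disjoint_boundary_inside hP hD).mono_left hBP
  · rw [hB.enclosedRegion_eq_empty]
    exact disjoint_empty _

/-- A boundary point of Q' inside Q could be joined, within that boundary and avoiding p, to a point
of B'. The connection misses the boundary of Q, so Q would enclose a point of ∂P. -/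
theorem disjoint_inside (h : IsCap Q B D p) (h' : IsCap Q' B' D' p) (hP : P.IsCounterclockwise)
    (hBP' : B' ⊆ P.boundary) (hD : D ⊆ P.region) (hDD : D ∩ D' ⊆ {p}) :
    Disjoint Q'.boundary Q.inside := by
  rw [Set.disjoint_left]
  intro z hz hzQ
  have hzp : z ≠ p := fun hzp => hzQ.1 (hzp ▸ h.mem)
  obtain ⟨C, hC, hCc, hzC, y, hyC, hyB⟩ := h'.connect z ⟨hz, hzp⟩
  refine Set.disjoint_left.1 (h.disjoint_boundary_inside hP hD) (hBP' hyB) ?_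
  refine hCc.mem_enclosedRegion ?_ hzC hyC hzQ
  rw [Set.disjoint_left]
  exact fun w hw hwQ => (hC hw).2 (hDD ⟨h.boundary_subset hwQ, h'.boundary_subset (hC hw).1⟩)

/-- The boundaries meet only in p, and a single point does not separate the plane, so the insides
are disjoint. -/
theorem region_inter_region (h : IsCap Q B D p) (h' : IsCap Q' B' D' p)
    (hQ : Disjoint Q.boundary Q'.inside) (hQ' : Disjoint Q'.boundary Q.inside)
    (hDD : D ∩ D' ⊆ {p}) : Q.region ∩ Q'.region = {p} := by
  have hbb : Q.boundary ∩ Q'.boundary = {p} :=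
    Subset.antisymm ((inter_subset_inter h.boundary_subset h'.boundary_subset).trans hDD)
      (singleton_subset_iff.2 ⟨h.mem, h'.mem⟩)
  have hii : Disjoint Q.inside Q'.inside := by
    refine disjoint_enclosedRegion SimplePolygon.isCompact_boundary.isClosed
      SimplePolygon.isCompact_boundary.isClosed SimplePolygon.isCompact_boundary.isBounded hQ hQ' ?_
    rw [hbb]
    exact (isConnected_compl_singleton_of_one_lt_rank (by simp) p).isPreconnected
  refine Subset.antisymm ?_
    (singleton_subset_iff.2 ⟨Or.inl h.mem, Or.inl h'.mem⟩)
  rintro x ⟨hx | hx, hx' | hx'⟩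
  · exact hbb.subset ⟨hx, hx'⟩
  · exact absurd hx' (Set.disjoint_left.1 hQ hx)
  · exact absurd hx (Set.disjoint_left.1 hQ' hx')
  · exact absurd hx' (Set.disjoint_left.1 hii hx)

end IsCap

/-! ### Two taut arcs with crossing connections -/

/-- The taut arcs `B` and `B'` are joined by two taut arcs `X₁ ∪ Y₁` and `X₂ ∪ Y₂`, which cross in
the single point `p`. -/
structure CrossedArcs (K B B' X₁ Y₁ X₂ Y₂ : Set ℂ) (a b a' b' p : ℂ) : Prop where
  arc : TautArc K B a b
  arc' : TautArc K B' a' b'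
  disjoint : Disjoint B B'
  split₁ : PolySplit X₁ Y₁ (X₁ ∪ Y₁) a p a'
  taut₁ : TautArc K (X₁ ∪ Y₁) a a'
  split₂ : PolySplit X₂ Y₂ (X₂ ∪ Y₂) b p b'
  taut₂ : TautArc K (X₂ ∪ Y₂) b b'
  inter : (X₁ ∪ Y₁) ∩ (X₂ ∪ Y₂) = {p}

namespace CrossedArcs

variable {K B B' X₁ Y₁ X₂ Y₂ : Set ℂ} {a b a' b' p : ℂ}

/-- This and `flip` are the symmetries of the configuration. The lemmas below treat X₁ or one side,
and the symmetries yield the other cases. -/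
theorem swap (h : CrossedArcs K B B' X₁ Y₁ X₂ Y₂ a b a' b' p) :
    CrossedArcs K B' B Y₁ X₁ Y₂ X₂ a' b' a b p where
  arc := h.arc'
  arc' := h.arc
  disjoint := h.disjoint.symm
  split₁ := union_comm X₁ Y₁ ▸ h.split₁.symm
  taut₁ := union_comm X₁ Y₁ ▸ h.taut₁.symm
  split₂ := union_comm X₂ Y₂ ▸ h.split₂.symm
  taut₂ := union_comm X₂ Y₂ ▸ h.taut₂.symm
  inter := by rw [union_comm Y₁, union_comm Y₂, h.inter]

theorem flip (h : CrossedArcs K B B' X₁ Y₁ X₂ Y₂ a b a' b' p) :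
    CrossedArcs K B B' X₂ Y₂ X₁ Y₁ b a b' a' p where
  arc := h.arc.symm
  arc' := h.arc'.symm
  disjoint := h.disjoint
  split₁ := h.split₂
  taut₁ := h.taut₂
  split₂ := h.split₁
  taut₂ := h.taut₁
  inter := by rw [inter_comm, h.inter]

theorem eq_of_mem₁ (h : CrossedArcs K B B' X₁ Y₁ X₂ Y₂ a b a' b' p) {x : ℂ} (h₁ : x ∈ X₁)
    (h₂ : x ∈ X₂ ∪ Y₂) : x = p := h.inter.subset ⟨Or.inl h₁, h₂⟩

theorem inter_eq (h : CrossedArcs K B B' X₁ Y₁ X₂ Y₂ a b a' b' p) : X₁ ∩ X₂ = {p} :=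
  Subset.antisymm (fun _ hx => h.eq_of_mem₁ hx.1 (Or.inl hx.2))
    (singleton_subset_iff.2 ⟨h.split₁.left.right_mem, h.split₂.left.right_mem⟩)

/-- From a point of X₁ on B' the taut connection goes on to a', again on B'. So it stays in B' from
there on, and p is on this stretch. -/
theorem mem_of_inter (hK : ∀ D ⊆ K, enclosedRegion D ⊆ K)
    (h : CrossedArcs K B B' X₁ Y₁ X₂ Y₂ a b a' b' p) (hne : (X₁ ∩ B').Nonempty) : p ∈ B' := by
  obtain ⟨z, hzX, hzB⟩ := hne
  obtain ⟨R₁, R₂, hR⟩ := h.taut₁.arc.exists_split (Or.inl hzX : z ∈ X₁ ∪ Y₁)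
  refine (h.taut₁.right hR).subset_of_mem hK h.arc' hzB h.arc'.arc.left_mem ?_
  obtain ⟨Z₁, Z₂, hZ⟩ := h.split₁.left.exists_split hzX
  have hZY : PolyArc (Z₂ ∪ Y₁) z a' := hZ.right.trans h.split₁.right (Subset.antisymm
    (fun x hx => h.split₁.inter.subset ⟨hZ.subset_right hx.1, hx.2⟩)
    (singleton_subset_iff.2 ⟨hZ.right.right_mem, h.split₁.right.left_mem⟩))
  rw [← hR.eq_right hZY (union_subset_union_left _ hZ.subset_right)]
  exact Or.inl hZ.right.right_mem

theorem subset_of_mem (hK : ∀ D ⊆ K, enclosedRegion D ⊆ K)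
    (h : CrossedArcs K B B' X₁ Y₁ X₂ Y₂ a b a' b' p) (hp : p ∈ B') : Y₁ ⊆ B' :=
  (h.taut₁.right h.split₁).subset_of_mem hK h.arc' hp h.arc'.arc.left_mem

/-- Both Y₁ and Y₂ lie in B' by uniqueness. Their union is connected and contains both ends of B',
so it is all of B'. -/
theorem eq_union_of_mem (hK : ∀ D ⊆ K, enclosedRegion D ⊆ K)
    (h : CrossedArcs K B B' X₁ Y₁ X₂ Y₂ a b a' b' p) (hp : p ∈ B') : B' = Y₁ ∪ Y₂ :=
  (h.arc'.arc.eq_of_isPreconnected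
    (h.split₁.right.isPreconnected.union p h.split₁.right.left_mem h.split₂.right.left_mem
      h.split₂.right.isPreconnected)
    (union_subset (h.subset_of_mem hK hp) (h.flip.subset_of_mem hK hp))
    (Or.inl h.split₁.right.right_mem) (Or.inr h.split₂.right.right_mem)).symm

/-- As soon as X₁ meets B', the latter is Y₁ ∪ Y₂, and X₁ meets each of these only in p. -/
theorem eq_of_mem_arc (hK : ∀ D ⊆ K, enclosedRegion D ⊆ K)
    (h : CrossedArcs K B B' X₁ Y₁ X₂ Y₂ a b a' b' p) {x : ℂ} (hx : x ∈ X₁) (hxB : x ∈ B') :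
    x = p := by
  rw [h.eq_union_of_mem hK (h.mem_of_inter hK ⟨x, hx, hxB⟩)] at hxB
  rcases hxB with hxY | hxY
  · exact h.split₁.inter.subset ⟨hx, hxY⟩
  · exact h.eq_of_mem₁ hx (Or.inr hxY)

theorem subset (h : CrossedArcs K B B' X₁ Y₁ X₂ Y₂ a b a' b' p) : B ∪ X₁ ∪ X₂ ⊆ K :=
  union_subset (union_subset h.arc.subset (subset_union_left.trans h.taut₁.subset))
    (subset_union_left.trans h.taut₂.subset)

theorem exists_isCap (hK : ∀ D ⊆ K, enclosedRegion D ⊆ K)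
    (h : CrossedArcs K B B' X₁ Y₁ X₂ Y₂ a b a' b' p) (hp : p ∉ B) :
    ∃ Q, IsCap Q B (B ∪ X₁ ∪ X₂) p :=
  _root_.exists_isCap hK h.arc (h.taut₁.left h.split₁) (h.taut₂.left h.split₂) h.inter_eq hp

theorem inter_arc_subset (hK : ∀ D ⊆ K, enclosedRegion D ⊆ K)
    (h : CrossedArcs K B B' X₁ Y₁ X₂ Y₂ a b a' b' p) : (B ∪ X₁ ∪ X₂) ∩ B' ⊆ {p} := by
  rintro x ⟨(hx | hx) | hx, hxB⟩
  · exact absurd hxB (Set.disjoint_left.1 h.disjoint hx)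
  · exact h.eq_of_mem_arc hK hx hxB
  · exact h.flip.eq_of_mem_arc hK hx hxB

theorem inter_union_subset (hK : ∀ D ⊆ K, enclosedRegion D ⊆ K)
    (h : CrossedArcs K B B' X₁ Y₁ X₂ Y₂ a b a' b' p) :
    (B ∪ X₁ ∪ X₂) ∩ (B' ∪ Y₁ ∪ Y₂) ⊆ {p} := by
  rintro x ⟨hx, (hxB | hxY) | hxY⟩
  · exact h.inter_arc_subset hK ⟨hx, hxB⟩
  · rcases hx with (hx | hx) | hx
    · exact h.swap.eq_of_mem_arc hK hxY hx
    · exact h.split₁.inter.subset ⟨hx, hxY⟩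
    · exact h.swap.eq_of_mem₁ hxY (Or.inr hx)
  · rcases hx with (hx | hx) | hx
    · exact h.flip.swap.eq_of_mem_arc hK hxY hx
    · exact h.flip.swap.eq_of_mem₁ hxY (Or.inr hx)
    · exact h.split₂.inter.subset ⟨hx, hxY⟩

end CrossedArcs

/-! ### The crossing point relative to the polygon -/

/-- Three taut prongs do not meet at an inner point. -/
theorem notMem_of_taut_prongs {K W X₁ X₂ M : Set ℂ} {a b s t : ℂ} (hW : IsOpen W) (hWK : W ⊆ K)
    (h₁ : PolyArc X₁ a s) (h₂ : PolyArc X₂ b s) (hM : PolyArc M s t) (ha : s ≠ a) (hb : s ≠ b)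
    (ht : s ≠ t) (hX : X₁ ∩ X₂ ⊆ {s}) (h₁M : X₁ ∩ M ⊆ {s}) (h₂M : X₂ ∩ M ⊆ {s})
    (ht₁ : Taut K (X₁ ∪ M)) (ht₂ : Taut K (X₂ ∪ M)) : s ∉ W := by
  intro hs
  obtain ⟨x, hx, hxX, -⟩ := h₁.symm.exists_direction ha
  obtain ⟨y, hy, hyX, -⟩ := h₂.symm.exists_direction hb
  obtain ⟨m, hm, hmM, -⟩ := hM.exists_direction ht
  -- At an inner point tautness makes both X₁ and X₂ leave s opposite to M, hence in the same
  -- direction, so they overlap.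
  obtain ⟨α, hα, hxm⟩ := exists_neg_mul_of_cross_eq_zero (inter_comm X₁ M ▸ h₁M) hm hx hmM hxX
    (ht₁.cross_eq_zero_of_isOpen hW hWK hs (hmM.trans subset_union_right)
      (hxX.trans subset_union_left))
  obtain ⟨γ, hγ, hym⟩ := exists_neg_mul_of_cross_eq_zero (inter_comm X₂ M ▸ h₂M) hm hy hmM hyX
    (ht₂.cross_eq_zero_of_isOpen hW hWK hs (hmM.trans subset_union_right)
      (hyX.trans subset_union_left))
  exact not_neg_mul_neg_mul hX hx hxX hyX hα hγ hxm hym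

namespace SimplePolygon

variable {P : SimplePolygon}

/-- A taut arc through an inner point of a side runs along this side. -/
theorem exists_direction_of_taut (hP : P.IsCounterclockwise) {k : ZMod P.n} {t : ℝ}
    (ht : t ∈ Ioo (0 : ℝ) 1) {d z : ℂ} (hd : d = P.vertex (k + 1) - P.vertex k)
    (hz : z = P.vertex k + t * d) {S X Y : Set ℂ} {a b : ℂ} (hS : TautArc P.region S a b)
    (hs : PolySplit X Y S a z b) (ha : z ≠ a) (hb : z ≠ b) :
    ∃ x y, x ≠ 0 ∧ y ≠ 0 ∧ segment ℝ z (z + x) ⊆ X ∧ segment ℝ z (z + y) ⊆ Y ∧ cross d x = 0 ∧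
      ∃ τ : ℝ, τ < 0 ∧ y = τ * x := by
  obtain ⟨x, hx, hxX, -⟩ := hs.left.symm.exists_direction ha
  obtain ⟨y, hy, hyY, -⟩ := hs.right.exists_direction hb
  obtain ⟨h1, h2⟩ := cross_eq_zero_of_taut hP ht hd hz hS.subset hS.taut
    (hxX.trans hs.subset_left) (hyY.trans hs.subset_right)
  obtain ⟨h3, -⟩ := cross_eq_zero_of_taut hP ht hd hz hS.subset hS.taut
    (hyY.trans hs.subset_right) (hxX.trans hs.subset_left)
  obtain ⟨τ, hτ, hyx⟩ := exists_neg_mul_of_cross_eq_zero hs.inter.subset hx hy hxX hyY h2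
  refine ⟨x, y, hx, hy, hxX, hyY, ?_, τ, hτ, hyx⟩
  rw [hyx, cross_mul_right] at h3
  nlinarith

theorem exists_vertex_or_mem_Ioo {k : ZMod P.n} {x : ℂ} (hx : x ∈ P.side k) :
    x = P.vertex k ∨ x = P.vertex (k + 1) ∨ ∃ t ∈ Ioo (0 : ℝ) 1,
      x = P.vertex k + t * (P.vertex (k + 1) - P.vertex k) := by
  obtain ⟨t, ht0, ht1, rfl⟩ := mem_side_iff.1 hx
  rcases ht0.eq_or_lt with rfl | ht0
  · exact Or.inl (by push_cast; ring)
  rcases ht1.eq_or_lt with rfl | ht1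
  · exact Or.inr (Or.inl (by push_cast; ring))
  · exact Or.inr (Or.inr ⟨t, ⟨ht0, ht1⟩, rfl⟩)

end SimplePolygon

namespace CrossedArcs

variable {P : SimplePolygon} {B B' X₁ Y₁ X₂ Y₂ : Set ℂ} {a b a' b' p : ℂ}

/-- At an inner point of a side both connections would run along the side. X₁ and X₂ would leave p
in opposite directions, so X₂ would leave in the direction of Y₁ and overlap with it. -/
theorem mem_inside_or_vertex (hP : P.IsCounterclockwise)
    (h : CrossedArcs P.region B B' X₁ Y₁ X₂ Y₂ a b a' b' p) (hpB : p ∉ B) (hpB' : p ∉ B') :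
    p ∈ P.inside ∨ p ∈ Set.range P.vertex := by
  rcases h.taut₁.subset (Or.inl h.split₁.left.right_mem) with hp | hp
  swap
  · exact Or.inl hp
  obtain ⟨k, hk⟩ := SimplePolygon.mem_boundary.1 hp
  rcases SimplePolygon.exists_vertex_or_mem_Ioo hk with rfl | rfl | ⟨t, ht, hpt⟩
  · exact Or.inr ⟨_, rfl⟩
  · exact Or.inr ⟨_, rfl⟩
  exfalso
  obtain ⟨x₁, y₁, hx₁, -, hX₁, hY₁, hc₁, τ, hτ, hyx⟩ := SimplePolygon.exists_direction_of_taut hP ht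
    rfl hpt h.taut₁ h.split₁ (fun hpa => hpB (hpa ▸ h.arc.arc.left_mem))
    (fun hpa => hpB' (hpa ▸ h.arc'.arc.left_mem))
  obtain ⟨x₂, y₂, hx₂, -, hX₂, -, hc₂, -⟩ := SimplePolygon.exists_direction_of_taut hP ht
    rfl hpt h.taut₂ h.split₂ (fun hpa => hpB (hpa ▸ h.arc.arc.right_mem))
    (fun hpa => hpB' (hpa ▸ h.arc'.arc.right_mem))
  have hd0 := sub_ne_zero.2 (P.vertex_ne k)
  obtain ⟨m₁, hm₁⟩ := exists_eq_mul_of_cross_eq_zero hd0 hc₁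
  obtain ⟨m₂, hm₂⟩ := exists_eq_mul_of_cross_eq_zero hd0 hc₂
  have hc : cross x₁ x₂ = 0 := by
    rw [hm₁, hm₂, cross_mul_left, cross_mul_right, cross_same]
    ring
  obtain ⟨σ, hσ, hxx⟩ := exists_neg_mul_of_cross_eq_zero h.inter_eq.subset hx₁ hx₂ hX₁ hX₂ hc
  exact not_neg_mul_neg_mul (fun x hx => h.flip.eq_of_mem₁ hx.1 (Or.inr hx.2)) hx₂ hX₂ hY₁ hσ hτ
    hxx hyx

/-- At an inner point of a side of the path, X₁ would start along this side, although it meets the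
path only in p. -/
theorem mem_range_vertex (hP : P.IsCounterclockwise) {s l : ℕ} (hl : 0 < l)
    (h : CrossedArcs P.region B (P.subpath s l).carrier X₁ Y₁ X₂ Y₂ a b
      (P.vertex (s : ZMod P.n)) b' p) (hp : p ∈ (P.subpath s l).carrier) :
    p ∈ Set.range (P.subpath s l).vertex := by
  have hpB : p ∉ B := fun hpB => Set.disjoint_left.1 h.disjoint hpB hp
  have hmem : ∀ j ≤ l, P.vertex ((s + j : ℕ) : ZMod P.n) ∈ Set.range (P.subpath s l).vertex :=
    fun j hj => ⟨⟨j, Nat.lt_succ_of_le hj⟩, rfl⟩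
  by_contra hcon
  obtain ⟨i, hi, hpi⟩ := SimplePolygon.exists_mem_side_of_mem_carrier hl hp
  rcases SimplePolygon.exists_vertex_or_mem_Ioo hpi with hpv | hpv | ⟨t, ht, hpt⟩
  · exact hcon (hpv ▸ hmem i hi.le)
  · refine hcon (hpv ▸ ?_)
    have := hmem (i + 1) hi
    rwa [← add_assoc, Nat.cast_succ] at this
  obtain ⟨x, y, hx, -, hX, -, hc, -⟩ := SimplePolygon.exists_direction_of_taut hP ht
    rfl hpt h.taut₁ h.split₁ (fun hpa => hpB (hpa ▸ h.arc.arc.left_mem))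
    (fun hpa => hcon (hpa ▸ by simpa using hmem 0 hl.le))
  obtain ⟨r, hr, hball⟩ := SimplePolygon.exists_half_ball hP _ ht rfl hpt
  obtain ⟨ε, h1, h2, h3⟩ := exists_pos_mem_ball p x hr
  have hside := (hball _ h3).2.2.1 (by rw [add_sub_cancel_left, cross_mul_right, hc, mul_zero])
  have heq := h.eq_of_mem_arc (fun _ => SimplePolygon.enclosedRegion_subset_region)
    (hX (mem_segment_add_iff.2 ⟨ε, h1.le, h2, rfl⟩))
    (SimplePolygon.mem_carrier_subpath.2 (Or.inr ⟨i, hi, hside⟩))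
  have h0 : (ε : ℂ) * x = 0 := by linear_combination heq
  exact mul_ne_zero (Complex.ofReal_ne_zero.2 h1.ne') hx h0

/-! ### The region bounded by the four arcs -/

/-- The union splits into one part for each of B and B', and these meet at most in p. Each part
encloses exactly the inside of its cap. -/
theorem exists_two_polygons (hP : P.IsCounterclockwise)
    (h : CrossedArcs P.region B B' X₁ Y₁ X₂ Y₂ a b a' b' p) (hB : B ⊆ P.boundary)
    (hB' : B' ⊆ P.boundary) (hpB : p ∉ B) (hpB' : p ∉ B') :
    ∃ Q₁ Q₂ : SimplePolygon,
      Q₁.boundary ∪ Q₂.boundary ⊆ B ∪ B' ∪ (X₁ ∪ Y₁) ∪ (X₂ ∪ Y₂) ∧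
      enclosedRegion (B ∪ B' ∪ (X₁ ∪ Y₁) ∪ (X₂ ∪ Y₂)) = Q₁.inside ∪ Q₂.inside ∧
      IsPathOfPositiveLength (Q₁.boundary ∩ B) ∧ Disjoint Q₁.boundary B' ∧
      IsPathOfPositiveLength (Q₂.boundary ∩ B') ∧ Disjoint Q₂.boundary B ∧
      Q₁.region ∩ Q₂.region = {p} := by
  have hK : ∀ D ⊆ P.region, enclosedRegion D ⊆ P.region :=
    fun _ => SimplePolygon.enclosedRegion_subset_region
  obtain ⟨Q, hQ⟩ := h.exists_isCap hK hpB
  obtain ⟨Q', hQ'⟩ := h.swap.exists_isCap hK hpB'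
  have hU : B ∪ B' ∪ (X₁ ∪ Y₁) ∪ (X₂ ∪ Y₂) = (B ∪ X₁ ∪ X₂) ∪ (B' ∪ Y₁ ∪ Y₂) := by
    ext x
    simp only [Set.mem_union]
    tauto
  have hDE := h.inter_union_subset hK
  have hED : (B' ∪ Y₁ ∪ Y₂) ∩ (B ∪ X₁ ∪ X₂) ⊆ {p} := by rwa [inter_comm]
  have hd := hQ.disjoint_inside hQ' hP hB' h.subset hDE
  have hd' := hQ'.disjoint_inside hQ hP hB h.swap.subset hED
  have hQB : ∀ {Q : SimplePolygon} {B B' D : Set ℂ}, IsCap Q B D p → p ∉ B' → D ∩ B' ⊆ {p} →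
      Disjoint Q.boundary B' := by
    intro Q B B' D hQ hp hD
    rw [Set.disjoint_left]
    intro x hx hxB
    exact hp ((show x = p from hD ⟨hQ.boundary_subset hx, hxB⟩) ▸ hxB)
  refine ⟨Q, Q', ?_, ?_, hQ.isPathOfPositiveLength, hQB hQ hpB' (h.inter_arc_subset hK),
    hQ'.isPathOfPositiveLength, hQB hQ' hpB (h.swap.inter_arc_subset hK),
    hQ.region_inter_region hQ' hd' hd hDE⟩
  · rw [hU]
    exact union_subset_union hQ.boundary_subset hQ'.boundary_subset
  · have hDc : IsCompact (B ∪ X₁ ∪ X₂) :=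
      (h.arc.arc.isCompact.union h.split₁.left.isCompact).union h.split₂.left.isCompact
    have hEc : IsCompact (B' ∪ Y₁ ∪ Y₂) :=
      (h.arc'.arc.isCompact.union h.split₁.right.isCompact).union h.split₂.right.isCompact
    have hDe := hQ.enclosedRegion_eq hP h.arc.arc hB h.subset
    have hEe := hQ'.enclosedRegion_eq hP h.arc'.arc hB' h.swap.subset
    rw [hU, enclosedRegion_union hDc hEc, hDe, hEe]
    · exact (Set.subsingleton_singleton.anti hDE).isPreconnected
    · rw [hEe, ← hQ.union_eq]
      exact Disjoint.union_left
        ((hQ'.disjoint_boundary_inside hP h.swap.subset).mono_left hB) hd'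
    · rw [hDe, ← hQ'.union_eq]
      exact Disjoint.union_left ((hQ.disjoint_boundary_inside hP h.subset).mono_left hB') hd

/-- Since p is on B', this path is Y₁ ∪ Y₂. The part on its side is a mere arc, which encloses
nothing. -/
theorem exists_one_polygon (hP : P.IsCounterclockwise)
    (h : CrossedArcs P.region B B' X₁ Y₁ X₂ Y₂ a b a' b' p) (hB : B ⊆ P.boundary)
    (hB' : B' ⊆ P.boundary) (hp : p ∈ B') :
    ∃ Q : SimplePolygon, Q.boundary ⊆ B ∪ B' ∪ (X₁ ∪ Y₁) ∪ (X₂ ∪ Y₂) ∧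
      enclosedRegion (B ∪ B' ∪ (X₁ ∪ Y₁) ∪ (X₂ ∪ Y₂)) = Q.inside ∧
      IsPathOfPositiveLength (Q.boundary ∩ B) ∧ Q.boundary ∩ B' = {p} := by
  have hK : ∀ D ⊆ P.region, enclosedRegion D ⊆ P.region :=
    fun _ => SimplePolygon.enclosedRegion_subset_region
  obtain ⟨Q, hQ⟩ := h.exists_isCap hK fun hpB => Set.disjoint_left.1 h.disjoint hpB hp
  have hU : B ∪ B' ∪ (X₁ ∪ Y₁) ∪ (X₂ ∪ Y₂) = (B ∪ X₁ ∪ X₂) ∪ B' := by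
    rw [h.eq_union_of_mem hK hp]
    ext x
    simp only [Set.mem_union]
    tauto
  have hDB := h.inter_arc_subset hK
  have hDe := hQ.enclosedRegion_eq hP h.arc.arc hB h.subset
  refine ⟨Q, ?_, ?_, hQ.isPathOfPositiveLength, ?_⟩
  · rw [hU]
    exact hQ.boundary_subset.trans subset_union_left
  · rw [hU, enclosedRegion_union ((h.arc.arc.isCompact.union h.split₁.left.isCompact).union
      h.split₂.left.isCompact) h.arc'.arc.isCompact, hDe, h.arc'.arc.enclosedRegion_eq_empty,
      union_empty]
    · exact (Set.subsingleton_singleton.anti hDB).isPreconnected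
    · rw [h.arc'.arc.enclosedRegion_eq_empty]
      exact disjoint_empty _
    · rw [hDe]
      exact (hQ.disjoint_boundary_inside hP h.subset).mono_left hB'
  · exact Subset.antisymm (fun x hx => hDB ⟨hQ.boundary_subset hx.1, hx.2⟩)
      (singleton_subset_iff.2 ⟨hQ.mem, hp⟩)

end CrossedArcs

namespace SimplePolygon

variable {P : SimplePolygon}

/-! ### The connecting arcs cross in one point -/

/-- A chord does not continue both boundary arcs at its endpoint tautly. -/
theorem not_taut_chord {B C X₁ X₂ : Set ℂ} {a b p q : ℂ} (hX : PolySplit X₁ X₂ B a p b)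
    (hC : IsClosed C) (hBC : B ∪ C = P.boundary) (hinter : B ∩ C ⊆ {a, b}) (ha : p ≠ a)
    (hb : p ≠ b) (hpq : p ≠ q) (hc : segment ℝ p q ⊆ P.region)
    (hcP : segment ℝ p q ∩ P.boundary = {p, q}) (h₁ : Taut P.region (X₁ ∪ segment ℝ p q))
    (h₂ : Taut P.region (X₂ ∪ segment ℝ p q)) : False := by
  -- Half of the chord suffices as a direction and meets ∂P in p only.
  obtain ⟨u, hu, huc, hub⟩ : ∃ u, u ≠ 0 ∧ segment ℝ p (p + u) ⊆ segment ℝ p q ∧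
      segment ℝ p (p + u) ∩ P.boundary ⊆ {p} := by
    have hd : q - p ≠ 0 := sub_ne_zero.2 hpq.symm
    have hsub : segment ℝ p (p + ((1 / 2 : ℝ) : ℂ) * (q - p)) ⊆ segment ℝ p q := by
      refine segment_subset_left ?_
      rw [segment_eq_image_add_mul]
      exact ⟨1 / 2, by norm_num, rfl⟩
    refine ⟨((1 / 2 : ℝ) : ℂ) * (q - p), mul_ne_zero (by norm_num) hd, hsub, ?_⟩
    rintro x ⟨hx, hxb⟩
    rcases hcP.subset ⟨hsub hx, hxb⟩ with h | h
    · exact h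
    · exfalso
      obtain ⟨s, -, hs1, hs⟩ := mem_segment_add_iff.1 hx
      have h3 : p + ((s / 2 : ℝ) : ℂ) * (q - p) = p + ((1 : ℝ) : ℂ) * (q - p) := by
        rw [show x = q from h] at hs
        push_cast at hs ⊢
        linear_combination -hs
      have := add_mul_injective hd h3
      linarith
  obtain ⟨x, hx, hxX, r₁, hr₁, hxr⟩ := hX.left.symm.exists_direction ha
  obtain ⟨y, hy, hyX, r₂, hr₂, hyr⟩ := hX.right.exists_direction hb
  have hpB : p ∈ B := hX.subset_left hX.left.right_mem
  have hpC : p ∉ C := fun h => by rcases hinter ⟨hpB, h⟩ with h | h <;> contradiction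
  obtain ⟨r₃, hr₃, hCr⟩ := Metric.isOpen_iff.1 hC.isOpen_compl p hpC
  have hXP : X₁ ⊆ P.boundary := hX.subset_left.trans (hBC ▸ subset_union_left)
  have hYP : X₂ ⊆ P.boundary := hX.subset_right.trans (hBC ▸ subset_union_left)
  have hr : 0 < min (min r₁ r₂) r₃ := by positivity
  have hbd : ball p (min (min r₁ r₂) r₃) ∩ P.boundary ⊆
      segment ℝ p (p + x) ∪ segment ℝ p (p + y) := by
    rintro z ⟨hz, hzb⟩
    rw [← hBC, ← hX.union] at hzb
    rcases hzb with (hz' | hz') | hz'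
    · exact Or.inl (hxr ⟨ball_subset_ball ((min_le_left _ _).trans (min_le_left _ _)) hz, hz'⟩)
    · exact Or.inr (hyr ⟨ball_subset_ball ((min_le_left _ _).trans (min_le_right _ _)) hz, hz'⟩)
    · exact absurd hz' (hCr (ball_subset_ball (min_le_right _ _) hz))
  have hub' : segment ℝ p (p + u) ∩ ball p (min (min r₁ r₂) r₃) ∩ P.boundary ⊆ {p} :=
    fun z hz => hub ⟨hz.1.1, hz.2⟩
  have hcone := cross_eq_zero_or_mem_cone h₁ hr (hxX.trans hXP) hbd (huc.trans hc) hub'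
    (hxX.trans subset_union_left) (huc.trans subset_union_right)
  have hcone' := cross_eq_zero_or_mem_cone h₂ hr (hyX.trans hYP) (union_comm _ _ ▸ hbd)
    (huc.trans hc) hub' (hyX.trans subset_union_left) (huc.trans subset_union_right)
  have hcomb : ∀ {x y : ℂ} {α γ : ℝ}, y = α * x + γ * u → cross u y = α * cross u x := by
    rintro x y α γ rfl
    rw [cross_add_right, cross_mul_right, cross_mul_right, cross_same]
    ring
  -- Each boundary prong is parallel to the chord, or the other prong lies in the open cone between
  -- it and the chord. If both cone conditions hold and the prongs are not parallel to u,
  -- substituting one into the other gives α' α = 1 and a positive multiple of u equal to 0. So both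
  -- prongs are parallel to u, hence both opposite to it, and they overlap.
  obtain ⟨hx0, hy0⟩ : cross u x = 0 ∧ cross u y = 0 := by
    rcases hcone with h | ⟨α, γ, hα, hγ, hyx⟩ <;> rcases hcone' with h' | ⟨α', γ', hα', hγ', hxy⟩
    · rw [cross_swap, h, cross_swap, h']
      simp
    · have hux : cross u x = 0 := by rw [cross_swap, h, neg_zero]
      refine ⟨hux, ?_⟩
      have := hcomb hxy
      rw [hux] at this
      exact (mul_eq_zero.1 this.symm).resolve_left hα'.ne'
    · have huy : cross u y = 0 := by rw [cross_swap, h', neg_zero]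
      refine ⟨?_, huy⟩
      have := hcomb hyx
      rw [huy] at this
      exact (mul_eq_zero.1 this.symm).resolve_left hα.ne'
    · have hux : cross u x = 0 := by
        by_contra hne
        have h1 := hcomb hxy
        rw [hcomb hyx, ← mul_assoc] at h1
        have h2 : α' * α = 1 := by
          refine mul_right_cancel₀ hne ?_
          linarith
        have h3 : ((α' * γ + γ' : ℝ) : ℂ) * u = 0 := by
          have h4 : (α' : ℂ) * α = 1 := by exact_mod_cast h2
          push_cast
          linear_combination (-α' : ℂ) * hyx - hxy - x * h4
        exact mul_ne_zero (Complex.ofReal_ne_zero.2 (by positivity)) hu h3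
      exact ⟨hux, by rw [hcomb hyx, hux, mul_zero]⟩
  obtain ⟨σ, hσ, hxu⟩ := exists_neg_mul_of_cross_eq_zero hub hu hx subset_rfl (hxX.trans hXP) hx0
  obtain ⟨τ, hτ, hyu⟩ := exists_neg_mul_of_cross_eq_zero hub hu hy subset_rfl (hyX.trans hYP) hy0
  exact not_neg_mul_neg_mul hX.inter.subset hx hxX hyX hσ hτ hxu hyu

/-- The subarc from a point of one of two arcs to their common end. -/
theorem _root_.exists_subarc_of_mem_union {X₁ X₂ : Set ℂ} {a b s z : ℂ} (h₁ : PolyArc X₁ a s)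
    (h₂ : PolyArc X₂ b s) (hz : z ∈ X₁ ∪ X₂) :
    ∃ Z, PolyArc Z z s ∧ (Z ⊆ X₁ ∨ Z ⊆ X₂) := by
  rcases hz with hz | hz
  · obtain ⟨Z₁, Z₂, h⟩ := h₁.exists_split hz
    exact ⟨Z₂, h.right, Or.inl h.subset_right⟩
  · obtain ⟨Z₁, Z₂, h⟩ := h₂.exists_split hz
    exact ⟨Z₂, h.right, Or.inr h.subset_right⟩

/-- Taut connections between two mutually visible boundary arcs do not run along each other in the
same direction. -/
theorem not_overlap (hP : P.IsCounterclockwise) {B B' C C' X₁ X₂ M Y₁ Y₂ : Set ℂ}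
    {a b a' b' p q s t : ℂ} (hB : TautArc P.region B a b)
    (hBB : Disjoint B B') (hC : IsCompact C) (hBC : B ∪ C = P.boundary) (hinter : B ∩ C ⊆ {a, b})
    (hB' : IsCompact B') (hC' : IsCompact C') (hBC' : B' ∪ C' = P.boundary)
    (hinter' : B' ∩ C' ⊆ {a', b'}) (ha' : a' ∈ B') (hb' : b' ∈ B')
    (hpB : p ∈ B) (hpa : p ≠ a) (hpb : p ≠ b) (hqB : q ∈ B')
    (hc : segment ℝ p q ⊆ P.region) (hcP : segment ℝ p q ∩ P.boundary = {p, q})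
    (hX₁ : PolyArc X₁ a s) (hX₂ : PolyArc X₂ b s) (hM : PolyArc M s t) (hY₁ : PolyArc Y₁ t a')
    (hY₂ : PolyArc Y₂ t b') (hst : s ≠ t) (hXX : X₁ ∩ X₂ = {s}) (hYY : Y₁ ∩ Y₂ = {t})
    (hX₁M : X₁ ∩ M = {s}) (hX₂M : X₂ ∩ M = {s}) (hMY₁ : M ∩ Y₁ = {t}) (hMY₂ : M ∩ Y₂ = {t})
    (hXY : Disjoint (X₁ ∪ X₂) (Y₁ ∪ Y₂)) (hK₁ : X₁ ∪ M ∪ Y₁ ⊆ P.region)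
    (hK₂ : X₂ ∪ M ∪ Y₂ ⊆ P.region) (ht₁ : Taut P.region (X₁ ∪ M ∪ Y₁))
    (ht₂ : Taut P.region (X₂ ∪ M ∪ Y₂)) : False := by
  have hK : ∀ D ⊆ P.region, enclosedRegion D ⊆ P.region := fun _ => enclosedRegion_subset_region
  have hBP : B ⊆ P.boundary := hBC ▸ subset_union_left
  have hBP' : B' ⊆ P.boundary := hBC' ▸ subset_union_left
  have hqC : q ∈ C := (hBC.symm ▸ hBP' hqB : q ∈ B ∪ C).resolve_left
    fun h => Set.disjoint_left.1 hBB h hqB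
  have hpC : p ∈ C' := (hBC'.symm ▸ hBP hpB : p ∈ B' ∪ C').resolve_left
    fun h => Set.disjoint_left.1 hBB hpB h
  have hseg : IsPreconnected (segment ℝ p q) := (PolyArc.segment p q).isPreconnected
  -- The visibility segment leads from B to the rest of the boundary, so it crosses X₁ ∪ X₂, which
  -- joins the ends of B. Likewise it crosses Y₁ ∪ Y₂.
  obtain ⟨z, hzc, hz⟩ := nonempty_inter_of_crossing hP hB.arc.isCompact hC hBC hinter
    (hX₁.trans hX₂.symm hXX) (union_subset (fun x hx => hK₁ (Or.inl (Or.inl hx)))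
      fun x hx => hK₂ (Or.inl (Or.inl hx))) hseg hc (left_mem_segment ℝ p q) hpB
    (right_mem_segment ℝ p q) hqC
  obtain ⟨z', hzc', hz'⟩ := nonempty_inter_of_crossing hP hB' hC' hBC' hinter'
    (hY₁.symm.trans hY₂ hYY) (union_subset (fun x hx => hK₁ (Or.inr hx))
      fun x hx => hK₂ (Or.inr hx)) hseg hc (right_mem_segment ℝ p q) hqB
    (left_mem_segment ℝ p q) hpC
  have htX₁ : Taut P.region (X₁ ∪ M) := ht₁.mono subset_union_left
  have htX₂ : Taut P.region (X₂ ∪ M) := ht₂.mono subset_union_left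
  have htY₁ : Taut P.region (M ∪ Y₁) := ht₁.mono (by rw [union_assoc]; exact subset_union_right)
  have htY₂ : Taut P.region (M ∪ Y₂) := ht₂.mono (by rw [union_assoc]; exact subset_union_right)
  have hMK : M ⊆ P.region := fun x hx => hK₁ (Or.inl (Or.inr hx))
  -- From z along one prong to s, through M, and along a prong from t to z' there is a taut arc. Its
  -- ends lie on the taut segment pq, so it is contained in pq.
  have hMc : M ⊆ segment ℝ p q := by
    obtain ⟨Z, hZ, hZX⟩ := exists_subarc_of_mem_union hX₁ hX₂ hz
    obtain ⟨Z', hZ', hZY⟩ := exists_subarc_of_mem_union hY₁.symm hY₂.symm hz'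
    have hZm : Z ∩ M = {s} := by
      refine Subset.antisymm ?_ (singleton_subset_iff.2 ⟨hZ.right_mem, hM.left_mem⟩)
      rcases hZX with h | h
      · exact (inter_subset_inter_left _ h).trans hX₁M.subset
      · exact (inter_subset_inter_left _ h).trans hX₂M.subset
    have hZm' : M ∩ Z' = {t} := by
      refine Subset.antisymm ?_ (singleton_subset_iff.2 ⟨hM.right_mem, hZ'.right_mem⟩)
      rcases hZY with h | h
      · exact (inter_subset_inter_right _ h).trans hMY₁.subset
      · exact (inter_subset_inter_right _ h).trans hMY₂.subset
    have hZZ : Disjoint Z Z' := hXY.mono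
      (hZX.elim (fun h => h.trans subset_union_left) fun h => h.trans subset_union_right)
      (hZY.elim (fun h => h.trans subset_union_left) fun h => h.trans subset_union_right)
    have hZt : Z ∪ M ⊆ P.region ∧ Taut P.region (Z ∪ M) := by
      rcases hZX with h | h
      · exact ⟨(union_subset_union_left _ h).trans (subset_union_left.trans hK₁),
          htX₁.mono (union_subset_union_left _ h)⟩
      · exact ⟨(union_subset_union_left _ h).trans (subset_union_left.trans hK₂),
          htX₂.mono (union_subset_union_left _ h)⟩
    have hZt' : M ∪ Z' ⊆ P.region ∧ Taut P.region (M ∪ Z') := by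
      rcases hZY with h | h
      · exact ⟨union_subset hMK fun x hx => hK₁ (Or.inr (h hx)),
          htY₁.mono (union_subset_union_right _ h)⟩
      · exact ⟨union_subset hMK fun x hx => hK₂ (Or.inr (h hx)),
          htY₂.mono (union_subset_union_right _ h)⟩
    have harc := TautArc.union hZ hM hZ'.symm hZm hZm' hZZ hZt.1 hZt'.1 hZt.2 hZt'.2
    exact fun x hx => harc.subset_of_mem hK ⟨PolyArc.segment p q, hc, taut_segment _ p q⟩ hzc hzc'
      (Or.inl (Or.inr hx))
  have hbdry : ∀ {s : ℂ}, s ∈ M → s ∉ P.inside → s = p ∨ s = q := fun {s} hs hsi =>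
    hcP.subset ⟨hMc hs, (hMK hs).resolve_right hsi⟩
  have hnot : ∀ {v s : ℂ}, v ∈ P.boundary → s ∈ P.inside → s ≠ v := by
    rintro v s hv hs rfl
    exact hs.1 hv
  -- Inside P three taut prongs cannot meet at s. So s is on ∂P, which the visibility segment
  -- touches only at p and q.
  have hs : s = p ∨ s = q := hbdry hM.left_mem fun hs =>
    notMem_of_taut_prongs isOpen_inside subset_union_right hX₁ hX₂ hM
      (hnot (hBP hB.arc.left_mem) hs) (hnot (hBP hB.arc.right_mem) hs) hst hXX.subset hX₁M.subset
      hX₂M.subset htX₁ htX₂ hs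
  have ht : t = p ∨ t = q := hbdry hM.right_mem fun ht =>
    notMem_of_taut_prongs isOpen_inside subset_union_right hY₁.symm hY₂.symm hM.symm
      (hnot (hBP' ha') ht) (hnot (hBP' hb') ht) hst.symm hYY.subset
      (inter_comm M Y₁ ▸ hMY₁.subset) (inter_comm M Y₂ ▸ hMY₂.subset)
      (union_comm M Y₁ ▸ htY₁) (union_comm M Y₂ ▸ htY₂) ht
  -- If M runs from p to q, then X₁ and X₂ are the two parts of B at p by uniqueness, and the chord
  -- continues both tautly. If it runs from q to p, the taut arc X₁ ∪ M joins two points of B and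
  -- thus puts q on B.
  rcases hs with rfl | rfl
  · obtain rfl : t = q := ht.resolve_left fun h => hst h.symm
    have hMs : M = segment ℝ s t := (PolyArc.segment s t).subarc_unique hM hMc
      (PolyArc.segment s t) subset_rfl
    obtain ⟨R₁, R₂, hR⟩ := hB.arc.exists_split hpB
    have h₁ : X₁ = R₁ := TautArc.eq hK ⟨hX₁, fun x hx => hK₁ (Or.inl (Or.inl hx)),
      htX₁.mono subset_union_left⟩ (hB.left hR)
    have h₂ : X₂ = R₂ := TautArc.eq hK ⟨hX₂.symm, fun x hx => hK₂ (Or.inl (Or.inl hx)),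
      htX₂.mono subset_union_left⟩ (hB.right hR)
    subst h₁ h₂
    rw [hMs] at htX₁ htX₂
    exact not_taut_chord hR hC.isClosed hBC hinter hpa hpb hst hc hcP htX₁ htX₂
  · obtain rfl : t = p := ht.resolve_right fun h => hst h.symm
    have hsub := TautArc.subset_of_mem hK ⟨hX₁.trans hM hX₁M, subset_union_left.trans hK₁, htX₁⟩ hB
      hB.arc.left_mem hpB
    exact Set.disjoint_left.1 hBB (hsub (Or.inr hM.left_mem)) hqB

/-- Between the first and last common points s and t on β₁, both connections contain the same taut
arc M by uniqueness. It remains to exclude s ≠ t, according to the order of s and t on β₂. -/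
theorem exists_crossedArcs (hP : P.IsCounterclockwise) {B B' C C' β₁ β₂ : Set ℂ}
    {a b a' b' p q : ℂ} (hB : TautArc P.region B a b) (hB' : TautArc P.region B' a' b')
    (hBB : Disjoint B B') (hC : IsCompact C) (hBC : B ∪ C = P.boundary) (hinter : B ∩ C ⊆ {a, b})
    (hC' : IsCompact C') (hBC' : B' ∪ C' = P.boundary) (hinter' : B' ∩ C' ⊆ {a', b'})
    (hpB : p ∈ B) (hpa : p ≠ a) (hpb : p ≠ b) (hqB : q ∈ B')
    (hc : segment ℝ p q ⊆ P.region) (hcP : segment ℝ p q ∩ P.boundary = {p, q})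
    (hβ₁ : TautArc P.region β₁ a a') (hβ₂ : TautArc P.region β₂ b b')
    (hne : (β₁ ∩ β₂).Nonempty) :
    ∃ x X₁ Y₁ X₂ Y₂, CrossedArcs P.region B B' X₁ Y₁ X₂ Y₂ a b a' b' x ∧ X₁ ∪ Y₁ = β₁ ∧
      X₂ ∪ Y₂ = β₂ := by
  have hK : ∀ D ⊆ P.region, enclosedRegion D ⊆ P.region := fun _ => enclosedRegion_subset_region
  suffices h : ∃ x, β₁ ∩ β₂ = {x} by
    obtain ⟨x, hx⟩ := h
    have hx' : x ∈ β₁ ∩ β₂ := hx ▸ rfl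
    obtain ⟨X₁, Y₁, h₁⟩ := hβ₁.arc.exists_split hx'.1
    obtain ⟨X₂, Y₂, h₂⟩ := hβ₂.arc.exists_split hx'.2
    obtain rfl := h₁.union
    obtain rfl := h₂.union
    exact ⟨x, X₁, Y₁, X₂, Y₂, ⟨hB, hB', hBB, h₁, hβ₁, h₂, hβ₂, hx⟩, rfl, rfl⟩
  obtain ⟨s, t, X₁, R₁, M, Y₁, hs, ht, hXT, hYT⟩ :=
    hβ₁.arc.exists_first_last hβ₂.arc.isClosed hne
  have hsβ : s ∈ X₁ ∩ β₂ := hXT ▸ rfl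
  have htβ : t ∈ Y₁ ∩ β₂ := hYT ▸ rfl
  by_cases hst : s = t
  · subst hst
    refine ⟨s, Subset.antisymm ?_ (singleton_subset_iff.2 ⟨hs.subset_left hsβ.1, hsβ.2⟩)⟩
    rintro x ⟨hx, hxβ⟩
    rw [← hs.union, ← ht.union, ht.left.eq_singleton] at hx
    rcases hx with hx | hx | hx
    · exact hXT.subset ⟨hx, hxβ⟩
    · exact hx
    · exact hYT.subset ⟨hx, hxβ⟩
  exfalso
  have hβ₁eq : X₁ ∪ M ∪ Y₁ = β₁ := by rw [union_assoc, ht.union, hs.union]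
  have hMt : TautArc P.region M s t := (hβ₁.right hs).left ht
  have hX₁M : X₁ ∩ M = {s} := Subset.antisymm
    (fun x hx => hs.inter.subset ⟨hx.1, ht.subset_left hx.2⟩)
    (singleton_subset_iff.2 ⟨hs.left.right_mem, ht.left.left_mem⟩)
  have hβ₁K : X₁ ∪ M ∪ Y₁ ⊆ P.region := hβ₁eq ▸ hβ₁.subset
  have hβ₁t : Taut P.region (X₁ ∪ M ∪ Y₁) := hβ₁eq ▸ hβ₁.taut
  have hsub : M ∪ Y₁ ⊆ X₁ ∪ M ∪ Y₁ := by rw [union_assoc]; exact subset_union_right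
  obtain ⟨X₂, R₂, hs₂⟩ := hβ₂.arc.exists_split hsβ.2
  rcases (hs₂.union.symm ▸ htβ.2 : t ∈ X₂ ∪ R₂) with ht' | ht'
  -- Here β₂ traverses M backwards. Changing over along M gives taut arcs from a to b and from a' to
  -- b' through M, which lie in B and in B'.
  · obtain ⟨Z, M', hZ⟩ := hs₂.left.exists_split ht'
    obtain rfl : M = M' := hMt.symm.eq hK ((hβ₂.left hs₂).right hZ)
    have hMR : M ∩ R₂ = {s} := Subset.antisymm
      (fun x hx => hs₂.inter.subset ⟨hZ.subset_right hx.1, hx.2⟩)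
      (singleton_subset_iff.2 ⟨hMt.arc.left_mem, hs₂.right.left_mem⟩)
    have hXZ : Disjoint X₁ Z := by
      rw [Set.disjoint_left]
      intro x hx hxZ
      obtain rfl : x = s := hXT.subset ⟨hx, hs₂.subset_left (hZ.subset_left hxZ)⟩
      exact hst (hZ.inter.subset ⟨hxZ, hMt.arc.left_mem⟩)
    have hYR : Disjoint Y₁ R₂ := by
      rw [Set.disjoint_left]
      intro x hx hxR
      obtain rfl : x = t := hYT.subset ⟨hx, hs₂.subset_right hxR⟩
      exact hst (hs₂.inter.subset ⟨ht', hxR⟩).symm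
    have hMZ : M ∪ Z ⊆ β₂ := by
      rw [union_comm, hZ.union]
      exact hs₂.subset_left
    have hMR₂ : M ∪ R₂ ⊆ β₂ :=
      union_subset (hZ.subset_right.trans hs₂.subset_left) hs₂.subset_right
    have hab := TautArc.union hs.left hMt.arc hZ.left.symm hX₁M
      (by rw [inter_comm, hZ.inter]) hXZ (subset_union_left.trans hβ₁K) (hMZ.trans hβ₂.subset)
      (hβ₁t.mono subset_union_left) (hβ₂.taut.mono hMZ)
    have hab' := TautArc.union ht.right.symm hMt.arc.symm hs₂.right (by rw [inter_comm, ht.inter])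
      hMR hYR (union_comm M Y₁ ▸ hsub.trans hβ₁K) (hMR₂.trans hβ₂.subset)
      (union_comm M Y₁ ▸ hβ₁t.mono hsub) (hβ₂.taut.mono hMR₂)
    exact Set.disjoint_left.1 hBB
      (hab.subset_of_mem hK hB hB.arc.left_mem hB.arc.right_mem (Or.inl (Or.inr hMt.arc.left_mem)))
      (hab'.subset_of_mem hK hB' hB'.arc.left_mem hB'.arc.right_mem
        (Or.inl (Or.inr hMt.arc.left_mem)))
  -- Here both connections traverse M in the same sense, and the visibility segment is needed.
  · obtain ⟨M', Y₂, hY₂⟩ := hs₂.right.exists_split ht'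
    obtain rfl : M = M' := hMt.eq hK ((hβ₂.right hs₂).left hY₂)
    have hβ₂eq : X₂ ∪ M ∪ Y₂ = β₂ := by rw [union_assoc, hY₂.union, hs₂.union]
    have hX₂M : X₂ ∩ M = {s} := Subset.antisymm
      (fun x hx => hs₂.inter.subset ⟨hx.1, hY₂.subset_left hx.2⟩)
      (singleton_subset_iff.2 ⟨hs₂.left.right_mem, hMt.arc.left_mem⟩)
    have hXX : X₁ ∩ X₂ = {s} := Subset.antisymm
      (fun x hx => hXT.subset ⟨hx.1, hs₂.subset_left hx.2⟩)
      (singleton_subset_iff.2 ⟨hs.left.right_mem, hs₂.left.right_mem⟩)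
    have hYY : Y₁ ∩ Y₂ = {t} := Subset.antisymm
      (fun x hx => hYT.subset ⟨hx.1, hs₂.subset_right (hY₂.subset_right hx.2)⟩)
      (singleton_subset_iff.2 ⟨ht.right.left_mem, hY₂.right.left_mem⟩)
    have hXY : Disjoint (X₁ ∪ X₂) (Y₁ ∪ Y₂) := by
      rw [Set.disjoint_left]
      rintro x (hx | hx) (hx' | hx')
      · obtain rfl := hs.eq_of_mem hx (ht.subset_right hx')
        exact hst (ht.inter.subset ⟨hMt.arc.left_mem, hx'⟩)
      · obtain rfl : x = s := hXT.subset ⟨hx, hs₂.subset_right (hY₂.subset_right hx')⟩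
        exact hst (hY₂.inter.subset ⟨hMt.arc.left_mem, hx'⟩)
      · obtain rfl : x = t := hYT.subset ⟨hx', hs₂.subset_left hx⟩
        exact hst (hs₂.inter.subset ⟨hx, ht'⟩).symm
      · obtain rfl := hs₂.eq_of_mem hx (hY₂.subset_right hx')
        exact hst (hY₂.inter.subset ⟨hMt.arc.left_mem, hx'⟩)
    exact not_overlap hP hB hBB hC hBC hinter hB'.arc.isCompact hC' hBC' hinter' hB'.arc.left_mem
      hB'.arc.right_mem hpB hpa hpb hqB hc hcP hs.left hs₂.left hMt.arc ht.right hY₂.right hst hXX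
      hYY hX₁M hX₂M ht.inter hY₂.inter hXY hβ₁K (hβ₂eq ▸ hβ₂.subset) hβ₁t (hβ₂eq ▸ hβ₂.taut)

end SimplePolygon

namespace SimplePolygon.BoundaryPartition

variable {P : SimplePolygon} {m : ℕ} (B : P.BoundaryPartition m)

/-! ### Paths of a boundary partition -/

theorem cut_lt (k : Fin m) : B.cut k.castSucc < B.cut k.succ :=
  B.strictMono Fin.castSucc_lt_succ

theorem cut_le_cut_add (k l : Fin (m + 1)) : B.cut k ≤ B.cut l + P.n := by
  have h1 := B.strictMono.monotone (Fin.le_last k)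
  have h2 := B.strictMono.monotone (Fin.zero_le l)
  have h3 := B.once_around
  omega

theorem path_eq (k : Fin m) :
    B.path k = P.subpath (B.cut k.castSucc) (B.cut k.succ - B.cut k.castSucc) := rfl

theorem vertex_castSucc_mem (k : Fin m) :
    P.vertex (B.cut k.castSucc : ZMod P.n) ∈ (B.path k).carrier :=
  source_subpath (P := P) _ _ ▸ PolyChain.vertex_mem_carrier (B.path k) 0

theorem vertex_succ_mem (k : Fin m) : P.vertex (B.cut k.succ : ZMod P.n) ∈ (B.path k).carrier := by
  have h := PolyChain.vertex_mem_carrier (B.path k) (Fin.last _)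
  have h2 : (B.path k).target = _ := target_subpath (P := P) _ _
  rw [Nat.add_sub_cancel' (B.cut_lt k).le] at h2
  rwa [← h2]

/-- Disjoint paths of the partition are subpaths with separated index ranges. -/
theorem exists_range {i j : Fin m} (hij : Disjoint (B.path i).carrier (B.path j).carrier) :
    ∃ s l s' l', 0 < l ∧ 0 < l' ∧ s + l < s' ∧ s' + l' < s + P.n ∧ B.path i = P.subpath s l ∧
      B.path j = P.subpath s' l' := by
  have hi := B.cut_lt i
  have hj := B.cut_lt j
  -- Disjointness of the paths makes the cut indices differ also after a shift by n, which turns the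
  -- inequalities between them into strict ones.
  have hd : ∀ {x y : ℕ}, P.vertex (x : ZMod P.n) ∈ (B.path i).carrier →
      P.vertex (y : ZMod P.n) ∈ (B.path j).carrier → x ≠ y ∧ x + P.n ≠ y ∧ x ≠ y + P.n := by
    intro x y hx hy
    refine ⟨?_, ?_, ?_⟩ <;> rintro rfl <;> refine Set.disjoint_left.1 hij hx ?_
    · exact hy
    · rwa [natCast_add_n] at hy
    · rwa [natCast_add_n]
  have h1 := hd (B.vertex_succ_mem i) (B.vertex_castSucc_mem j)
  have h2 := hd (B.vertex_castSucc_mem i) (B.vertex_succ_mem j)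
  have h3 := B.cut_le_cut_add j.succ i.castSucc
  have h4 := B.cut_le_cut_add i.succ j.castSucc
  rcases lt_trichotomy i j with hlt | rfl | hlt
  · have h5 : B.cut i.succ ≤ B.cut j.castSucc :=
      B.strictMono.monotone (Fin.succ_le_castSucc_iff.2 hlt)
    exact ⟨_, _, _, _, by omega, by omega, by omega, by omega, B.path_eq i, B.path_eq j⟩
  · exact absurd (B.vertex_succ_mem i) (Set.disjoint_left.1 hij (B.vertex_succ_mem i))
  -- If path j comes before path i, its indices are moved one turn ahead.
  · have h5 : B.cut j.succ ≤ B.cut i.castSucc :=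
      B.strictMono.monotone (Fin.succ_le_castSucc_iff.2 hlt)
    refine ⟨_, _, B.cut j.castSucc + P.n, B.cut j.succ - B.cut j.castSucc, ?_, ?_, ?_, ?_,
      B.path_eq i, ?_⟩
    on_goal 5 => rw [subpath_add_n]; exact B.path_eq j
    all_goals omega

theorem tautArc_path (hP : P.IsCounterclockwise) (hm : 2 ≤ m) {k : Fin m} (hB : B.OutwardConvex k) :
    TautArc P.region (B.path k).carrier (B.path k).source (B.path k).target := by
  have hk := B.cut_lt k
  -- With at least two paths, another one takes up some side, so the path is not the whole boundary.
  have hlt : B.cut k.succ - B.cut k.castSucc < P.n := by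
    have h3 := B.once_around
    have h4 := B.strictMono.monotone (Fin.zero_le k.castSucc)
    have h5 := B.strictMono.monotone (Fin.le_last k.succ)
    have h6 : B.cut 0 < B.cut k.castSucc ∨ B.cut k.succ < B.cut (Fin.last m) := by
      by_cases h : (k : ℕ) = 0
      · exact Or.inr (B.strictMono (Fin.lt_def.2 (by simp; omega)))
      · exact Or.inl (B.strictMono (Fin.lt_def.2 (by simp; omega)))
    omega
  rw [path_eq, source_subpath, target_subpath]
  exact ⟨polyArc_subpath hlt, (carrier_subpath_subset_boundary _ _).trans boundary_subset_region,
    taut_subpath hP hlt fun t h1 h2 => hB t h1 (by omega)⟩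

end SimplePolygon.BoundaryPartition

end

/-! ### The region bounded by two visible boundary paths and the shortest paths between their ends
-/

theorem theorem2p11 (P : SimplePolygon) (hP : P.IsCounterclockwise)
    (m : ℕ) (hm : 4 ≤ m) (B : P.BoundaryPartition m) (hB : ∀ k, B.OutwardConvex k)
    (i j : Fin m) (hij : Disjoint (B.path i).carrier (B.path j).carrier)
    (hvis : P.StronglyMutuallyVisible (B.path i) (B.path j))
    (β₁ β₂ : PolyChain)
    (hβ₁ : β₁.IsShortest P.region (B.path i).source (B.path j).source)
    (hβ₂ : β₂.IsShortest P.region (B.path i).target (B.path j).target)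
    (U : Set ℂ)
    (hU : U = (B.path i).carrier ∪ (B.path j).carrier ∪ β₁.carrier ∪ β₂.carrier) :
    (∃ Q₁ Q₂ : SimplePolygon, ∃ p : ℂ,
      Q₁.boundary ∪ Q₂.boundary ⊆ U ∧
      enclosedRegion U = Q₁.inside ∪ Q₂.inside ∧
      IsPathOfPositiveLength (Q₁.boundary ∩ (B.path i).carrier) ∧
      Disjoint Q₁.boundary (B.path j).carrier ∧
      IsPathOfPositiveLength (Q₂.boundary ∩ (B.path j).carrier) ∧
      Disjoint Q₂.boundary (B.path i).carrier ∧
      Q₁.region ∩ Q₂.region = {p} ∧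
      (p ∈ P.inside ∨
        p ∈ Set.range P.vertex \ ((B.path i).carrier ∪ (B.path j).carrier))) ∨
    (∃ Q : SimplePolygon,
      Q.boundary ⊆ U ∧
      enclosedRegion U = Q.inside ∧
      ((IsPathOfPositiveLength (Q.boundary ∩ (B.path i).carrier) ∧
          ∃ v ∈ Set.range (B.path j).vertex, Q.boundary ∩ (B.path j).carrier = {v}) ∨
        (IsPathOfPositiveLength (Q.boundary ∩ (B.path j).carrier) ∧
          ∃ v ∈ Set.range (B.path i).vertex, Q.boundary ∩ (B.path i).carrier = {v}))) := by
  have hPi := B.tautArc_path hP (by omega) (hB i)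
  have hPj := B.tautArc_path hP (by omega) (hB j)
  obtain ⟨s, l, s', l', hl, hl', h1, h2, hi, hj⟩ := B.exists_range hij
  obtain ⟨p, ⟨hpB, hpe⟩, q, ⟨hqB, -⟩, hc, hcP⟩ := hvis
  rw [Set.mem_insert_iff, Set.mem_singleton_iff, not_or] at hpe
  have hBi : (B.path i).carrier ⊆ P.boundary :=
    hi ▸ SimplePolygon.carrier_subpath_subset_boundary _ _
  have hBj : (B.path j).carrier ⊆ P.boundary :=
    hj ▸ SimplePolygon.carrier_subpath_subset_boundary _ _
  have hcompl : ∀ s l : ℕ, l < P.n → IsCompact (P.subpath s l).carrier := fun s l hl =>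
    (SimplePolygon.polyArc_subpath hl).isCompact
  have hT₁ : TautArc P.region β₁.carrier (B.path i).source (B.path j).source :=
    ⟨hβ₁.polyArc.1, hβ₁.subset, hβ₁.taut⟩
  have hT₂ : TautArc P.region β₂.carrier (B.path i).target (B.path j).target :=
    ⟨hβ₂.polyArc.1, hβ₂.subset, hβ₂.taut⟩
  -- Cut ∂P at the two initial points. The terminal point of B_i lies on one part and that of B_j on
  -- the other, so β₂ must cross β₁.
  have hmeet : (β₁.carrier ∩ β₂.carrier).Nonempty := by
    have hsrc := hT₁.arc
    rw [hi, hj, SimplePolygon.source_subpath, SimplePolygon.source_subpath] at hsrc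
    have htgt := hT₂.arc
    rw [hi, hj, SimplePolygon.target_subpath, SimplePolygon.target_subpath] at htgt
    have hsum : s + (s' - s) = s' := by omega
    have hunion := SimplePolygon.carrier_subpath_union (P := P) (s := s) (l := s' - s) (by omega)
    have hinter := SimplePolygon.carrier_subpath_inter (P := P) (s := s) (l := s' - s) (by omega)
    rw [hsum] at hunion hinter
    rw [Set.inter_comm]
    refine SimplePolygon.nonempty_inter_of_crossing hP (hcompl _ _ (by omega))
      (hcompl _ _ (by omega)) hunion hinter hsrc hT₁.subset htgt.isPreconnected hT₂.subset
      htgt.left_mem ?_ htgt.right_mem ?_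
    · exact SimplePolygon.carrier_subpath_mono le_rfl (by omega)
        (SimplePolygon.polyArc_subpath (P := P) (s := s) (l := l) (by omega)).right_mem
    · exact SimplePolygon.carrier_subpath_mono le_rfl (by omega)
        (SimplePolygon.polyArc_subpath (P := P) (s := s') (l := l') (by omega)).right_mem
  have hi' := SimplePolygon.carrier_subpath_inter (P := P) (s := s) (l := l) (by omega)
  have hj' := SimplePolygon.carrier_subpath_inter (P := P) (s := s') (l := l') (by omega)
  rw [← SimplePolygon.target_subpath, ← SimplePolygon.source_subpath s l, ← hi] at hi'
  rw [← SimplePolygon.target_subpath, ← SimplePolygon.source_subpath s' l', ← hj] at hj'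
  obtain ⟨x, X₁, Y₁, X₂, Y₂, hX, hX₁, hX₂⟩ := SimplePolygon.exists_crossedArcs hP hPi hPj hij
    (hcompl _ _ (by omega)) (hi ▸ SimplePolygon.carrier_subpath_union (by omega)) hi'
    (hcompl _ _ (by omega)) (hj ▸ SimplePolygon.carrier_subpath_union (by omega)) hj'
    hpB hpe.1 hpe.2 hqB hc hcP hT₁ hT₂ hmeet
  rw [← hX₁, ← hX₂] at hU
  subst hU
  by_cases hxi : x ∈ (B.path i).carrier
  -- When the crossing point lies on B_i, the two paths exchange roles, so that B_i is the one met
  -- in a single vertex.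
  · obtain ⟨Q, hQU, hQ, hQj, hQi⟩ := hX.swap.exists_one_polygon hP hBj hBi hxi
    rw [Set.union_comm (B.path j).carrier, Set.union_comm Y₁, Set.union_comm Y₂] at hQU hQ
    refine Or.inr ⟨Q, hQU, hQ, Or.inr ⟨hQj, x, ?_, hQi⟩⟩
    have hX' := hX.swap
    rw [hi, SimplePolygon.source_subpath] at hX'
    rw [hi] at hxi ⊢
    exact hX'.mem_range_vertex hP hl hxi
  by_cases hxj : x ∈ (B.path j).carrier
  · obtain ⟨Q, hQU, hQ, hQi, hQj⟩ := hX.exists_one_polygon hP hBi hBj hxj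
    refine Or.inr ⟨Q, hQU, hQ, Or.inl ⟨hQi, x, ?_, hQj⟩⟩
    have hX' := hX
    rw [hj, SimplePolygon.source_subpath] at hX'
    rw [hj] at hxj ⊢
    exact hX'.mem_range_vertex hP hl' hxj
  · obtain ⟨Q₁, Q₂, h1, h2, h3, h4, h5, h6, h7⟩ :=
      hX.exists_two_polygons hP hBi hBj hxi hxj
    exact Or.inl ⟨Q₁, Q₂, x, h1, h2, h3, h4, h5, h6, h7, (hX.mem_inside_or_vertex hP hxi hxj).imp
      id fun h => ⟨h, fun h => h.elim hxi hxj⟩⟩
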